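/- An \emph{arena} on a finite nonempty set $V$ is a bipartite directed graph $(V_0,V_1,E)$ with $V=V_0\sqcup V_1$, $E\subseteq (V_0\times V_1)\cup(V_1\times V_0)$, in which every vertex has an outgoing edge. A play is an infinite path $\rho=v_0v_1\dots$; at a vertex of $V_\sigma$ Player $\sigma\in\{0,1\}$ chooses the next edge. $\mathrm{Inf}(\rho)$ is the set of vertices that occur infinitely often in $\rho$. A \emph{KL game} $\mathcal G$ is an arena together with winning pairs $(u_1,S_1),\dots,(u_t,S_t)$, where $u_i\in V$, $S_i\subseteq V$ and $0\le t\le 2^{|V|}|V|$ (which is automatic if the pairs are distinct). Player 0 wins $\rho$ if $u_i\in\mathrm{Inf}(\rho)\subseteq S_i$ for some $i$; otherwise Player 1 wins. A \emph{Muller game} is an arena together with a partition $(\mathcal F_0,\mathcal F_1)$ of $2^V$, and Player $\sigma$ wins $\rho$ if $\mathrm{Inf}(\rho)\in\mathcal F_\sigma$. To \emph{decide} a game is to compute, for each $v\in V$, the unique player who has a winning strategy in the game starting at $v$. Let $|\mathcal G|=|V|+|E|+\sum_{i=1}^t(1+|S_i|)$ be the size of the explicit listing of $\mathcal G$. Algorithms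 are programs of a random access machine (constants, addition, subtraction, indirect load and store, tests for zero, each in unit time) with finitely many registers holding numbers up to $2^{O(|V|)}$ and with memory cells holding numbers up to $|V|^{O(1)}$. Space is the number of memory cells, including those of the input. The input lists, with vertices numbered $0,\dots,|V|-1$, the owners of the vertices, the edges, and the winning pairs, each $S_i$ by its cardinality and its elements; edges and elements are listed in any order without repetition, and $|V|$, $|E|$, $t$ are given in registers. \textbf{Theorem.} (1) There is an algorithm that, given a KL game $\mathcal G$, decides $\mathcal G$ in time $O(2^{|V|}|V||E|)$ and space $O(|\mathcal G|+2^{|V|})$. (2) There is an algorithm that, given a KL game $\mathcal G$, computes in time $O(2^{|V|}|V|^2)$ and space $O(|\mathcal G|+2^{|V|})$ the Muller game $\mathcal G'$ on the same arena with $\mathcal F_0=\{X\subseteq V: u_i\in X\subseteq S_i\text{ for some }i\}$ and $\mathcal F_1=2^V\setminus\mathcal F_0$ (the arena together with a table of $2^{|V|}$ entries that gives for each $X$ the $\sigma$ with $X\in\mathcal F_\sigma$). Every play has the same winner in $\mathcal G$ and in $\mathcal G'$. -/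

import Mathlib

/-! ### Arenas, plays, strategies -/

/-- An arena on the finite set `V` of positions. `V_σ` is `{v | owner v = σ}`, so that
`V` is the disjoint union of `V_0` and `V_1`; every edge joins `V_0` to `V_1` or `V_1` to `V_0`,
and every position has an outgoing edge. -/
structure Arena (V : Type) [Fintype V] [DecidableEq V] where
  owner : V → Fin 2
  edges : Finset (V × V)
  bipartite : ∀ e ∈ edges, owner e.1 ≠ owner e.2
  total : ∀ v, ∃ w, (v, w) ∈ edges

namespace Arena

variable {V : Type} [Fintype V] [DecidableEq V]

/-- There is an edge from `v` to `w`. -/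
def Adj (A : Arena V) (v w : V) : Prop := (v, w) ∈ A.edges

/-- A play is an infinite path. -/
def IsPlay (A : Arena V) (ρ : ℕ → V) : Prop := ∀ i, A.Adj (ρ i) (ρ (i + 1))

/-- A strategy of Player `σ`: to each finite path `v_0, …, v_k` with `v_k ∈ V_σ` it assigns a
successor of `v_k`. (The values at other lists are irrelevant.) -/
structure Strategy (A : Arena V) (σ : Fin 2) where
  move : List V → V
  legal : ∀ (h : List V) (v : V), (h ++ [v]).IsChain A.Adj → A.owner v = σ →
    A.Adj v (move (h ++ [v]))

/-- In the play `ρ` Player `σ` always moves as `f` prescribes. -/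
def Strategy.Follows {A : Arena V} {σ : Fin 2} (f : A.Strategy σ) (ρ : ℕ → V) : Prop :=
  ∀ k, A.owner (ρ k) = σ → ρ (k + 1) = f.move ((List.range (k + 1)).map ρ)

/-- Player `σ` has a strategy such that all plays from `v` that follow it lie in `W`. -/
def CanForce (A : Arena V) (σ : Fin 2) (W : Set (ℕ → V)) (v : V) : Prop :=
  ∃ f : A.Strategy σ, ∀ ρ, A.IsPlay ρ → ρ 0 = v → f.Follows ρ → ρ ∈ W

end Arena

open Classical in
/-- The infinity set of `ρ`: the positions that occur infinitely often. -/
noncomputable def infSet {V : Type} [Fintype V] (ρ : ℕ → V) : Finset V :=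
  {v | ∃ᶠ i in Filter.atTop, ρ i = v}

/-! ### KL games and Muller games -/

/-- A KL game: an arena with winning pairs `(u_1, S_1), …, (u_t, S_t)`. The index `t` ranges in
`[0, 2^|V| * |V|]`, which is automatic if the pairs are distinct. -/
structure KLGame (V : Type) [Fintype V] [DecidableEq V] where
  arena : Arena V
  pairs : List (V × Finset V)
  index_le : pairs.length ≤ 2 ^ Fintype.card V * Fintype.card V

/-- A Muller game: an arena with a partition `(F 0, F 1)` of the power set of `V`. -/
structure MullerGame (V : Type) [Fintype V] [DecidableEq V] where
  arena : Arena V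
  F : Fin 2 → Set (Finset V)
  union_eq : F 0 ∪ F 1 = Set.univ
  inter_eq : F 0 ∩ F 1 = ∅

namespace MullerGame

variable {V : Type} [Fintype V] [DecidableEq V]

/-- Player `σ` wins the play `ρ`. -/
def Wins (G : MullerGame V) (σ : Fin 2) (ρ : ℕ → V) : Prop := infSet ρ ∈ G.F σ

end MullerGame

namespace KLGame

variable {V : Type} [Fintype V] [DecidableEq V]

/-- The KL condition on a set `X`: some winning pair `(u, S)` has `u ∈ X` and `X ⊆ S`. -/
def Cond (G : KLGame V) (X : Finset V) : Prop := ∃ p ∈ G.pairs, p.1 ∈ X ∧ X ⊆ p.2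

/-- Player `σ` wins the play `ρ`. -/
def Wins (G : KLGame V) (σ : Fin 2) (ρ : ℕ → V) : Prop :=
  match σ with
  | 0 => G.Cond (infSet ρ)
  | 1 => ¬ G.Cond (infSet ρ)

/-- Player `σ` wins the game starting at `v`, that is, `v ∈ Win_σ(G)`. -/
def WinsFrom (G : KLGame V) (σ : Fin 2) (v : V) : Prop :=
  G.arena.CanForce σ {ρ | G.Wins σ ρ} v

/-- The size `|G|` of the explicit representation, which lists the positions, the edges, and for
each winning pair `(u, S)` the position `u` and the elements of `S`. -/
def size (G : KLGame V) : ℕ :=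
  Fintype.card V + G.arena.edges.card + (G.pairs.map fun p => 1 + p.2.card).sum

/-- The Muller game of a KL game: `F 0` consists of the sets `X` that satisfy the KL condition,
and `F 1` of all others. -/
def toMuller (G : KLGame V) : MullerGame V where
  arena := G.arena
  F := fun σ => match σ with
    | 0 => {X | G.Cond X}
    | 1 => {X | ¬ G.Cond X}
  union_eq := by
    ext X
    simp [em]
  inter_eq := by
    ext X
    simp

end KLGame

/-! ### Random access machines -/

/-- Programs of a random access machine with registers `0, 1, 2, …`, of which a program uses only
finitely many, and with an array of memory cells. -/
inductive Prog where
  /-- `r_d := k` -/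
  | const (d k : ℕ)
  /-- `r_d := r_a + r_b` -/
  | add (d a b : ℕ)
  /-- `r_d := max (r_a - r_b) 0` -/
  | sub (d a b : ℕ)
  /-- `r_d := mem[r_a]` -/
  | load (d a : ℕ)
  /-- `mem[r_a] := r_b` -/
  | store (a b : ℕ)
  /-- `p; q` -/
  | seq (p q : Prog)
  /-- if `r_a ≠ 0` then `p` else `q` -/
  | ite (a : ℕ) (p q : Prog)
  /-- while `r_a ≠ 0` do `p` -/
  | while (a : ℕ) (p : Prog)

/-- Contents of the registers and of the memory cells. -/
structure MState where
  reg : ℕ → ℕ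
  mem : ℕ → ℕ

/-- The resources of a machine: the number of memory cells (with addresses `0, …, space - 1`), the
largest number that fits into a register, and the largest number that fits into a cell. -/
structure Limits where
  space : ℕ
  regMax : ℕ
  cellMax : ℕ

/-- `Exec L p s s' t`: on the machine with resources `L`, the program `p` started in state `s`
halts in state `s'` after `t` steps. Each instruction and each evaluation of a test is one step. A
run that addresses a cell outside the memory, or that produces a number too large for the register
or cell it goes to, is stuck. -/
inductive Exec (L : Limits) : Prog → MState → MState → ℕ → Prop where
  | const {d k : ℕ} {s : MState} (h : k ≤ L.regMax) :
      Exec L (.const d k) s ⟨Function.update s.reg d k, s.mem⟩ 1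
  | add {d a b : ℕ} {s : MState} (h : s.reg a + s.reg b ≤ L.regMax) :
      Exec L (.add d a b) s ⟨Function.update s.reg d (s.reg a + s.reg b), s.mem⟩ 1
  | sub {d a b : ℕ} {s : MState} (h : s.reg a - s.reg b ≤ L.regMax) :
      Exec L (.sub d a b) s ⟨Function.update s.reg d (s.reg a - s.reg b), s.mem⟩ 1
  | load {d a : ℕ} {s : MState} (ha : s.reg a < L.space) (h : s.mem (s.reg a) ≤ L.regMax) :
      Exec L (.load d a) s ⟨Function.update s.reg d (s.mem (s.reg a)), s.mem⟩ 1
  | store {a b : ℕ} {s : MState} (ha : s.reg a < L.space) (h : s.reg b ≤ L.cellMax) :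
      Exec L (.store a b) s ⟨s.reg, Function.update s.mem (s.reg a) (s.reg b)⟩ 1
  | seq {p q : Prog} {s₁ s₂ s₃ : MState} {t₁ t₂ : ℕ}
      (hp : Exec L p s₁ s₂ t₁) (hq : Exec L q s₂ s₃ t₂) :
      Exec L (.seq p q) s₁ s₃ (t₁ + t₂)
  | ite_true {a : ℕ} {p q : Prog} {s s' : MState} {t : ℕ}
      (ha : s.reg a ≠ 0) (hp : Exec L p s s' t) :
      Exec L (.ite a p q) s s' (t + 1)
  | ite_false {a : ℕ} {p q : Prog} {s s' : MState} {t : ℕ}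
      (ha : s.reg a = 0) (hq : Exec L q s s' t) :
      Exec L (.ite a p q) s s' (t + 1)
  | while_done {a : ℕ} {p : Prog} {s : MState} (ha : s.reg a = 0) :
      Exec L (.while a p) s s 1
  | while_step {a : ℕ} {p : Prog} {s₁ s₂ s₃ : MState} {t₁ t₂ : ℕ}
      (ha : s₁.reg a ≠ 0) (hp : Exec L p s₁ s₂ t₁) (hw : Exec L (.while a p) s₂ s₃ t₂) :
      Exec L (.while a p) s₁ s₃ (t₁ + t₂ + 1)

/-! ### Games as input and output of machines -/

/-- The list that an arena with positions `0, …, n - 1` occupies in memory, for an enumeration `es`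
of its edges: the owners of the positions, then source and target of each edge. -/
def arenaCode {n : ℕ} (A : Arena (Fin n)) (es : List (Fin n × Fin n)) : List ℕ :=
  (List.ofFn fun v => (A.owner v : ℕ)) ++ es.flatMap fun e => [(e.1 : ℕ), (e.2 : ℕ)]

/-- The list that winning pairs `(u, S)` occupy in memory, where each `S` is given by an
enumeration: for each pair the position `u`, the number of elements of `S`, and these elements. -/
def pairsCode {n : ℕ} (ps : List (Fin n × List (Fin n))) : List ℕ :=
  ps.flatMap fun p => (p.1 : ℕ) :: p.2.length :: p.2.map fun v => (v : ℕ)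

/-- `es` enumerates the edges of `A`, in some order and without repetition. -/
def Arena.ListedBy {n : ℕ} (A : Arena (Fin n)) (es : List (Fin n × Fin n)) : Prop :=
  (es : Multiset (Fin n × Fin n)) = A.edges.val

/-- `ps` gives the winning pairs of `G`, each set enumerated in some order and without
repetition. -/
def KLGame.PairsListedBy {n : ℕ} (G : KLGame (Fin n)) (ps : List (Fin n × List (Fin n))) : Prop :=
  List.Forall₂ (fun p q => q.1 = p.1 ∧ (q.2 : Multiset (Fin n)) = p.2.val) G.pairs ps

/-- The start state on input `G`, listed by `es` and `ps`: registers `0, 1, 2` hold `|V|`, `|E|`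
and the index `t`, the memory holds the listing from address `0` on, all else is `0`. -/
def KLGame.input {n : ℕ} (G : KLGame (Fin n)) (es : List (Fin n × Fin n))
    (ps : List (Fin n × List (Fin n))) : MState where
  reg := fun i => [n, G.arena.edges.card, G.pairs.length].getD i 0
  mem := fun i => (arenaCode G.arena es ++ pairsCode ps).getD i 0

/-- The machine for input `G`: `c * (|G| + 2^n)` memory cells, which hold numbers up to `n^c`, that
is, `O(log n)` bits, and registers, which hold numbers up to `2^(c n)`, that is, `O(n)` bits. -/
def KLGame.limits {n : ℕ} (G : KLGame (Fin n)) (c : ℕ) : Limits where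
  space := c * (G.size + 2 ^ n)
  regMax := 2 ^ (c * n)
  cellMax := n ^ c

/-- The number in `[0, 2^n)` whose binary digits are given by the characteristic function of `X`. -/
def setCode {n : ℕ} (X : Finset (Fin n)) : ℕ := ∑ v ∈ X, 2 ^ (v : ℕ)

/-- The state `s` holds the Muller game `G`: the memory holds the arena, with its edges in the
order `es`, from address `0` on, and from the address in register `0` on a table with `2^n` entries
in `{0, 1}`, whose entry for each set `X` of positions is the `σ` with `X ∈ F σ`. The arena and the
table lie within the memory of the machine. -/
def MullerGame.HeldIn {n : ℕ} (G : MullerGame (Fin n)) (es : List (Fin n × Fin n)) (L : Limits)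
    (s : MState) : Prop :=
  (arenaCode G.arena es).length ≤ L.space ∧ s.reg 0 + 2 ^ n ≤ L.space ∧
  (∀ i, (hi : i < (arenaCode G.arena es).length) → s.mem i = (arenaCode G.arena es)[i]) ∧
  ∀ X : Finset (Fin n), s.mem (s.reg 0 + setCode X) < 2 ∧
    ∀ σ : Fin 2, X ∈ G.F σ ↔ s.mem (s.reg 0 + setCode X) = σ

/-- The state `s` holds the solution of `G`: for each position `v`, the cell `v` holds the number of
a player, and this player, and no other, wins the game starting at `v`. -/
def KLGame.SolutionHeldIn {n : ℕ} (G : KLGame (Fin n)) (L : Limits) (s : MState) : Prop :=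
  n ≤ L.space ∧ ∀ v : Fin n, s.mem v < 2 ∧ ∀ σ : Fin 2, G.WinsFrom σ v ↔ s.mem v = σ

/-! The game is studied in its subarenas, the sets `X` in which every position keeps a successor. If
the attractor of a set `B` for Player `σ` is removed from `X`, what remains is again a subarena,
which `σ` cannot leave: the trap that belongs to `B`. Write `W σ X` if `σ` wins the game played in
`X` from every position of `X`, and let `τ` be the opponent. For nonempty `X`, the statement `W σ X`
is equivalent to this: `W σ` holds for the trap of each single `v ∈ X`, and in addition `X` is a
good infinity set for `σ` or `W τ X` fails (`winsOn_iff`).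

A strategy that wins all of `X` also wins in each trap. Conversely, suppose that the traps are won.
If `X` is good for `σ`, then `σ` aims at the positions of `X` in turn, again and again: outside the
trap of the current target `v` the attractor leads to `v`, inside it the strategy of the trap is
used. Either some target is never reached, and the play stays in its trap and is won there, or all
positions of `X` recur and the infinity set is `X` (`winsOn_of_cond`). If `W τ X` fails, determinacy
(`determined`) yields a position `v` from which `σ` wins; the attractor of `v` and its trap make up
`X`, and both are won (`winsOn_of_mem`).

Traps of positions are proper subsets and so have smaller binary numbers. A table of all `W σ X` can
therefore be filled in increasing order of numbers, with at most `n` attractor computations of time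
`O(|E|)` per entry, in time `O(2^n n |E|)`. For each `X` the player for whom `X` is good comes
first, as this entry does not depend on the other one. Player `0` wins exactly from the positions of
those traps for Player `1` in the whole arena in which `0` wins from everywhere (`exists_trap_iff`);
finding them takes `2^n` further attractors.

The table of the Muller condition is built for one position `u` at a time: the sets `S` of the pairs
`(u, S)` are marked, the marks are closed under subsets in `n` passes, one per binary digit, and the
marked sets that contain `u` are given to Player `0`. A pass costs `O(2^n)`, so all `u` together
cost `O(2^n n^2)`. Scanning the pairs stays within this bound because `t ≤ 2^n n` and the elements
of `S` are read only when `u` is the position of the pair. Since `n ≤ |E|`, the table is also cheap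
enough for the first part.

The programs are written in a small language with named registers and arrays whose states carry the
time that has passed. The rules for `wp` prove correctness and running time together, and
`Run.compile` transfers both to the machine. -/

/-! ### Strategies with memory on subarenas -/

/-- A strategy with memory `M`: `mv m v` is the move at `v` if `m` is the memory before `v`. -/
structure MemStrategy (V : Type) where
  M : Type
  init : M
  upd : M → V → M
  mv : M → V → V

/-- The memory of the strategy along `ρ`. -/
def MemStrategy.trace {V : Type} (S : MemStrategy V) (ρ : ℕ → V) : ℕ → S.M
  | 0 => S.init
  | i + 1 => S.upd (S.trace ρ i) (ρ i)

/-- The play without its first `k` positions. -/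
def shiftPlay {V : Type} (k : ℕ) (ρ : ℕ → V) : ℕ → V := fun i => ρ (k + i)

theorem infSet_shift {V : Type} [Fintype V] (k : ℕ) (ρ : ℕ → V) :
    infSet (shiftPlay k ρ) = infSet ρ := by
  classical
  ext v
  simp only [infSet, Finset.mem_filter, Finset.mem_univ, true_and, Filter.frequently_atTop,
    shiftPlay]
  constructor
  · intro h a
    obtain ⟨b, hb, e⟩ := h a
    exact ⟨k + b, by omega, e⟩
  · intro h a
    obtain ⟨b, hb, e⟩ := h (k + a)
    exact ⟨b - k, by omega, by rwa [show k + (b - k) = b by omega]⟩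

/-- Winning depends on the infinity set only, so a strategy may spend finitely many moves on
reaching a better place. This is the form of prefix independence that `Ensures.merge` and its
consequences ask for. -/
theorem cond_shift {V : Type} [Fintype V] {C : Fin 2 → Finset V → Prop} {σ : Fin 2} (ρ : ℕ → V)
    (k : ℕ) (h : C σ (infSet (shiftPlay k ρ))) : C σ (infSet ρ) := by
  rwa [infSet_shift] at h

namespace Arena

variable {V : Type} [Fintype V] [DecidableEq V] (A : Arena V)

/-- The empty set counts as a subarena; both players win it from everywhere. -/
def Subarena (X : Finset V) : Prop := ∀ v ∈ X, ∃ w ∈ X, A.Adj v w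

def PlayIn (X : Finset V) (ρ : ℕ → V) : Prop := ∀ i, ρ i ∈ X ∧ A.Adj (ρ i) (ρ (i + 1))

/-- Required at every memory value, reachable or not, so that strategies can be recombined freely.
-/
def Legal (σ : Fin 2) (X : Finset V) (S : MemStrategy V) : Prop :=
  ∀ m, ∀ v ∈ X, A.owner v = σ → A.Adj v (S.mv m v) ∧ S.mv m v ∈ X

def Consistent (σ : Fin 2) (S : MemStrategy V) (ρ : ℕ → V) : Prop :=
  ∀ i, A.owner (ρ i) = σ → ρ (i + 1) = S.mv (S.trace ρ i) (ρ i)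

/-- Player `σ` can ensure `W` in the subarena `X` from all positions in `Y`. -/
def Ensures (σ : Fin 2) (X Y : Finset V) (W : (ℕ → V) → Prop) : Prop :=
  ∃ S, A.Legal σ X S ∧ ∀ ρ, A.PlayIn X ρ → ρ 0 ∈ Y → A.Consistent σ S ρ → W ρ

def Hits (Y : Finset V) (ρ : ℕ → V) : Prop := ∃ i, ρ i ∈ Y

variable {A}

theorem PlayIn.shift {X : Finset V} {ρ : ℕ → V} (h : A.PlayIn X ρ) (k : ℕ) :
    A.PlayIn X (shiftPlay k ρ) := fun i => h (k + i)

theorem Ensures.mono {σ : Fin 2} {X Y Y' : Finset V} {W W' : (ℕ → V) → Prop}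
    (h : A.Ensures σ X Y W) (hY : Y' ⊆ Y)
    (hW : ∀ ρ, A.PlayIn X ρ → ρ 0 ∈ Y' → W ρ → W' ρ) : A.Ensures σ X Y' W' := by
  obtain ⟨S, hS, h⟩ := h
  exact ⟨S, hS, fun ρ hρ h0 hc => hW ρ hρ h0 (h ρ hρ (hY h0) hc)⟩

/-- First reach `Y`, then ensure `W` from there. -/
theorem Ensures.merge {σ : Fin 2} {X Y Z : Finset V} {W : (ℕ → V) → Prop}
    (hW : ∀ ρ k, W (shiftPlay k ρ) → W ρ) (h₂ : A.Ensures σ X Y W)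
    (h₁ : A.Ensures σ X Z fun ρ => W ρ ∨ Hits Y ρ) : A.Ensures σ X Z W := by
  obtain ⟨S, hS, h₁⟩ := h₁
  obtain ⟨T, hT, h₂⟩ := h₂
  -- `U` runs `S` before the first visit of `Y` and a fresh `T` from then on. The switch takes
  -- effect at the visit itself: at a position of `Y` the left memory already answers with the first
  -- move of `T`.
  let U : MemStrategy V :=
    { M := S.M ⊕ T.M
      init := .inl S.init
      upd := fun m v => match m with
        | .inl m => if v ∈ Y then .inr (T.upd T.init v) else .inl (S.upd m v)
        | .inr m => .inr (T.upd m v)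
      mv := fun m v => match m with
        | .inl m => if v ∈ Y then T.mv T.init v else S.mv m v
        | .inr m => T.mv m v }
  have hl : ∀ ρ k, (∀ i < k, ρ i ∉ Y) → U.trace ρ k = .inl (S.trace ρ k) := by
    intro ρ k
    induction k with
    | zero => intro _; rfl
    | succ k ih =>
      intro h
      have := ih fun i hi => h i (by omega)
      simp only [MemStrategy.trace, this]
      simp [U, h k (by omega)]
  refine ⟨U, ?_, ?_⟩
  · rintro (m | m) v hv ho
    · by_cases hY : v ∈ Y
      · simpa [U, hY] using hT T.init v hv ho
      · simpa [U, hY] using hS m v hv ho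
    · exact hT m v hv ho
  · intro ρ hρ h0 hc
    by_cases hY : Hits Y ρ
    · classical
      have hk := Nat.find_spec hY
      have hlt : ∀ i < Nat.find hY, ρ i ∉ Y := fun i hi => Nat.find_min hY hi
      generalize Nat.find hY = k at hk hlt
      apply hW ρ k
      have hr : ∀ i, U.trace ρ (k + i + 1) = .inr (T.trace (shiftPlay k ρ) (i + 1)) := by
        intro i
        induction i with
        | zero =>
          simp only [MemStrategy.trace, hl ρ k hlt]
          simp [U, hk, shiftPlay]
        | succ i ih =>
          rw [MemStrategy.trace, show k + (i + 1) = k + i + 1 by ring, ih]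
          rfl
      apply h₂ _ (hρ.shift k) hk
      intro i ho
      have := hc (k + i) ho
      cases i with
      | zero =>
        simp only [add_zero, hl ρ k hlt] at this
        simpa [U, hk, shiftPlay, MemStrategy.trace] using this
      | succ i =>
        rw [show k + (i + 1) = k + i + 1 by ring, hr i] at this
        exact this
    · have hn : ∀ i, ρ i ∉ Y := fun i hi => hY ⟨i, hi⟩
      refine (h₁ ρ hρ h0 ?_).resolve_right hY
      intro i ho
      have := hc i ho
      rw [hl ρ i fun j _ => hn j] at this
      simpa [U, hn i] using this

/-- If each position of `X` can be reached unless `W` holds, then all positions can be visited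
infinitely often unless `W` holds. -/
theorem Ensures.cycle {σ : Fin 2} {X : Finset V} {W : (ℕ → V) → Prop}
    (hW : ∀ ρ k, W (shiftPlay k ρ) → W ρ) (hX : X.Nonempty)
    (h : ∀ v ∈ X, A.Ensures σ X X fun ρ => W ρ ∨ Hits {v} ρ) :
    A.Ensures σ X X fun ρ => W ρ ∨ ∀ v ∈ X, ∀ a, ∃ b ≥ a, ρ b = v := by
  -- The sequence of targets: an enumeration of `X`, repeated forever.
  obtain ⟨g, hgX, hg⟩ : ∃ g : ℕ → V, (∀ i, g i ∈ X) ∧ ∀ v ∈ X, ∀ a, ∃ b ≥ a, g b = v := by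
    have hpos : 0 < X.card := hX.card_pos
    refine ⟨fun i => X.equivFin.symm ⟨i % X.card, Nat.mod_lt _ hpos⟩, fun i => by simp, ?_⟩
    intro v hv a
    refine ⟨a * X.card + (X.equivFin ⟨v, hv⟩ : ℕ), ?_, ?_⟩
    · nlinarith
    · simp [Nat.mod_eq_of_lt]
  choose S hS hc using fun i => h (g i) (hgX i)
  -- The memory consists of the index of the current target and a memory of the strategy that aims
  -- at it. Reaching the target advances the index.
  let U : MemStrategy V :=
    { M := Σ i, (S i).M
      init := ⟨0, (S 0).init⟩
      upd := fun m v => if v = g m.1 then ⟨m.1 + 1, (S _).init⟩ else ⟨m.1, (S _).upd m.2 v⟩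
      mv := fun m v => (S _).mv m.2 v }
  refine ⟨U, fun m v hv ho => hS m.1 m.2 v hv ho, ?_⟩
  intro ρ hρ h0 hcons
  set tr := fun i => U.trace ρ i with htr
  have hstep : ∀ k, tr (k + 1) =
      if ρ k = g (tr k).1 then ⟨(tr k).1 + 1, (S _).init⟩
      else ⟨(tr k).1, (S _).upd (tr k).2 (ρ k)⟩ := fun k => rfl
  have hidx : ∀ k, (ρ k = g (tr k).1 ∧ (tr (k + 1)).1 = (tr k).1 + 1) ∨
      (ρ k ≠ g (tr k).1 ∧ (tr (k + 1)).1 = (tr k).1) := by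
    intro k
    rw [hstep]
    split_ifs with h
    · exact .inl ⟨h, rfl⟩
    · exact .inr ⟨h, rfl⟩
  have hmono : Monotone fun k => (tr k).1 := by
    apply monotone_nat_of_le_succ
    intro k
    rcases hidx k with ⟨_, h⟩ | ⟨_, h⟩ <;> omega
  -- If the index stops growing, its last target is not reached from the moment `k` at which it is
  -- chosen. The play from `k` on follows the strategy for this target from its initial memory, so
  -- `W` must hold.
  by_cases hb : ∃ K, ∀ k, (tr k).1 ≤ (tr K).1
  · left
    classical
    obtain ⟨K, hK⟩ := hb
    have hex : ∃ k, (tr k).1 = (tr K).1 := ⟨K, rfl⟩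
    have hk := Nat.find_spec hex
    have hmin : ∀ j < Nat.find hex, (tr j).1 ≠ (tr K).1 := fun j hj => Nat.find_min hex hj
    generalize Nat.find hex = k at hk hmin
    have hinit : tr k = ⟨(tr K).1, (S _).init⟩ := by
      rcases k with _ | k
      · rw [← hk]; rfl
      · rcases hidx k with ⟨h1, h2⟩ | ⟨h1, h2⟩
        · have := hstep k
          rw [if_pos h1] at this
          rw [this] at hk ⊢
          dsimp at hk
          rw [hk]
        · exact absurd (h2.symm.trans hk) (hmin k (by omega))
    have hnot : ∀ j, ρ (k + j) ≠ g (tr K).1 := by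
      intro j hj
      have h1 : (tr (k + j)).1 = (tr K).1 :=
        le_antisymm (hK _) (hk ▸ hmono (by omega : k ≤ k + j))
      rcases hidx (k + j) with ⟨_, h2⟩ | ⟨h2, _⟩
      · have := hK (k + j + 1)
        omega
      · exact h2 (h1 ▸ hj)
    have hall : ∀ j, tr (k + j) = ⟨(tr K).1, (S _).trace (shiftPlay k ρ) j⟩ := by
      intro j
      induction j with
      | zero => exact hinit
      | succ j ih =>
        have := hstep (k + j)
        rw [ih, if_neg (hnot j)] at this
        exact this
    apply hW ρ k
    refine (hc (tr K).1 _ (hρ.shift k) (hρ k).1 ?_).resolve_right ?_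
    · intro j ho
      have := hcons (k + j) ho
      change _ = U.mv (tr (k + j)) _ at this
      rw [hall j] at this
      exact this
    · rintro ⟨j, hj⟩
      exact hnot j (Finset.mem_singleton.1 hj)
  · right
    push Not at hb
    have hreach : ∀ i, ∃ k, i ≤ (tr k).1 := by
      intro i
      induction i with
      | zero => exact ⟨0, by omega⟩
      | succ i ih =>
        obtain ⟨k, hk⟩ := ih
        obtain ⟨k', hk'⟩ := hb k
        exact ⟨k', by omega⟩
    intro v hv a
    obtain ⟨i, hi, rfl⟩ := hg v hv (tr a).1
    classical
    have hex := hreach (i + 1)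
    have hk := Nat.find_spec hex
    have hmin : ∀ j < Nat.find hex, ¬ i + 1 ≤ (tr j).1 := fun j hj => Nat.find_min hex hj
    generalize Nat.find hex = k at hk hmin
    have hak : a < k := by
      by_contra hcon
      have : (tr k).1 ≤ (tr a).1 := hmono (by omega)
      omega
    obtain ⟨k, rfl⟩ : ∃ k', k = k' + 1 := ⟨k - 1, by omega⟩
    have := hmin k (by omega)
    refine ⟨k, by omega, ?_⟩
    rcases hidx k with ⟨h1, h2⟩ | ⟨h1, h2⟩
    · rw [h1, show (tr k).1 = i by omega]
    · omega

/-! ### Attractors -/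

variable (A) in
/-- `Player σ` can force a visit of `B` from `v` within `X` in at most `k` moves. -/
inductive AttrN (σ : Fin 2) (X B : Finset V) : ℕ → V → Prop
  | base {k v} : v ∈ B → AttrN σ X B k v
  | own {k v w} : v ∈ X → A.owner v = σ → w ∈ X → A.Adj v w → AttrN σ X B k w →
      AttrN σ X B (k + 1) v
  -- The required successor `w` keeps dead ends of `X` out of the attractor. This agrees with the
  -- program, which adds a position outside `B` only when it treats one of its edges, also if `X` is
  -- no subarena.
  | opp {k v w} : v ∈ X → A.owner v ≠ σ → w ∈ X → A.Adj v w →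
      (∀ w ∈ X, A.Adj v w → AttrN σ X B k w) → AttrN σ X B (k + 1) v

theorem AttrN.succ {σ : Fin 2} {X B : Finset V} {k : ℕ} {v : V} (h : A.AttrN σ X B k v) :
    A.AttrN σ X B (k + 1) v := by
  induction h with
  | base h => exact .base h
  | own h1 h2 h3 h4 _ ih => exact .own h1 h2 h3 h4 ih
  | opp h1 h2 h3 h4 _ ih => exact .opp h1 h2 h3 h4 ih

theorem AttrN.mono {σ : Fin 2} {X B : Finset V} {k l : ℕ} {v : V} (h : A.AttrN σ X B k v)
    (hkl : k ≤ l) : A.AttrN σ X B l v := by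
  induction hkl with
  | refl => exact h
  | step _ ih => exact ih.succ

open Classical in
variable (A) in
/-- The attractor of `B` for Player `σ` in `X`. -/
noncomputable def attr (σ : Fin 2) (X B : Finset V) : Finset V :=
  {v | ∃ k, A.AttrN σ X B k v}

theorem mem_attr {σ : Fin 2} {X B : Finset V} {v : V} :
    v ∈ A.attr σ X B ↔ ∃ k, A.AttrN σ X B k v := by
  simp [attr]

theorem subset_attr {σ : Fin 2} {X B : Finset V} : B ⊆ A.attr σ X B :=
  fun _ h => mem_attr.2 ⟨0, .base h⟩

theorem mem_attr_of_own {σ : Fin 2} {X B : Finset V} {v w : V} (hv : v ∈ X)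
    (ho : A.owner v = σ) (hw : w ∈ X) (ha : A.Adj v w) (h : w ∈ A.attr σ X B) :
    v ∈ A.attr σ X B := by
  obtain ⟨k, hk⟩ := mem_attr.1 h
  exact mem_attr.2 ⟨k + 1, .own hv ho hw ha hk⟩

theorem mem_attr_of_opp {σ : Fin 2} {X B : Finset V} {v w : V} (hv : v ∈ X)
    (ho : A.owner v ≠ σ) (hw : w ∈ X) (ha : A.Adj v w)
    (h : ∀ w ∈ X, A.Adj v w → w ∈ A.attr σ X B) :
    v ∈ A.attr σ X B := by
  have : ∀ w, ∃ k, w ∈ X → A.Adj v w → A.AttrN σ X B k w := by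
    intro w
    by_cases hw : w ∈ X ∧ A.Adj v w
    · obtain ⟨k, hk⟩ := mem_attr.1 (h w hw.1 hw.2)
      exact ⟨k, fun _ _ => hk⟩
    · exact ⟨0, fun h1 h2 => absurd ⟨h1, h2⟩ hw⟩
  choose k hk using this
  -- The ranks of the finitely many successors have a common bound.
  exact mem_attr.2 ⟨_, .opp hv ho hw ha fun w hw ha =>
    (hk w hw ha).mono (Finset.le_sup (f := k) (Finset.mem_univ w))⟩

/-- A set that contains `B` and is closed under the rules of the attractor contains it. -/
theorem attr_subset {σ : Fin 2} {X B Q : Finset V} (hB : B ⊆ Q)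
    (hown : ∀ v ∈ X, A.owner v = σ → ∀ w ∈ X, A.Adj v w → w ∈ Q → v ∈ Q)
    (hopp : ∀ v ∈ X, A.owner v ≠ σ → ∀ w ∈ X, A.Adj v w → (∀ w ∈ X, A.Adj v w → w ∈ Q) → v ∈ Q) :
    A.attr σ X B ⊆ Q := by
  intro v hv
  obtain ⟨k, hk⟩ := mem_attr.1 hv
  clear hv
  induction hk with
  | base h => exact hB h
  | own h1 h2 h3 h4 _ ih => exact hown _ h1 h2 _ h3 h4 ih
  | opp h1 h2 h3 h4 _ ih => exact hopp _ h1 h2 _ h3 h4 ih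

/-- Moving to a successor of least rank lowers the bound on the number of remaining moves, and each
move of the opponent within `X` lowers it anyway. No memory is needed. -/
theorem ensures_attr {σ : Fin 2} {X B : Finset V} (hX : A.Subarena X) :
    A.Ensures σ X (A.attr σ X B) (Hits B) := by
  classical
  have : ∀ v, ∃ w, v ∈ X → w ∈ X ∧ A.Adj v w ∧
      ∀ k w', w' ∈ X → A.Adj v w' → A.AttrN σ X B k w' → A.AttrN σ X B k w := by
    intro v
    by_cases h : ∃ k, ∃ w ∈ X, A.Adj v w ∧ A.AttrN σ X B k w
    · obtain ⟨w, h1, h2, h3⟩ := Nat.find_spec h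
      exact ⟨w, fun _ => ⟨h1, h2, fun k w' h4 h5 h6 =>
        h3.mono (Nat.find_min' h ⟨w', h4, h5, h6⟩)⟩⟩
    · by_cases hv : v ∈ X
      · obtain ⟨w, h1, h2⟩ := hX v hv
        exact ⟨w, fun _ => ⟨h1, h2, fun k w' h4 h5 h6 => absurd ⟨k, w', h4, h5, h6⟩ h⟩⟩
      · exact ⟨v, fun h => absurd h hv⟩
  choose f hf using this
  refine ⟨⟨Unit, (), fun _ _ => (), fun _ v => f v⟩, fun _ v hv _ => ⟨(hf v hv).2.1, (hf v hv).1⟩,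
    ?_⟩
  intro ρ hρ h0 hc
  obtain ⟨k, hk⟩ := mem_attr.1 h0
  suffices ∀ k i, A.AttrN σ X B k (ρ i) → Hits B ρ from this k 0 hk
  intro k
  induction k with
  | zero =>
    intro i h
    cases h with
    | base h => exact ⟨i, h⟩
  | succ k ih =>
    intro i h
    cases h with
    | base h => exact ⟨i, h⟩
    | own h1 h2 h3 h4 h5 =>
      apply ih (i + 1)
      rw [hc i h2]
      exact (hf _ (hρ i).1).2.2 _ _ h3 h4 h5
    | opp h1 h2 h3 h4 h5 => exact ih (i + 1) (h5 _ (hρ (i + 1)).1 (hρ i).2)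

variable (A) in
/-- The part of `X` from which Player `σ` cannot force a visit of `B` within `X`. -/
noncomputable def trap (σ : Fin 2) (X B : Finset V) : Finset V := X \ A.attr σ X B

theorem trap_subset {σ : Fin 2} {X B : Finset V} : A.trap σ X B ⊆ X := Finset.sdiff_subset

theorem notMem_trap {σ : Fin 2} {X B : Finset V} {v : V} (h : v ∈ B) : v ∉ A.trap σ X B :=
  fun h' => (Finset.mem_sdiff.1 h').2 (subset_attr h)

/-- Player `σ` cannot leave a trap for `σ`. -/
theorem mem_trap_of_adj {σ : Fin 2} {X B : Finset V} {v w : V} (hv : v ∈ A.trap σ X B)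
    (ho : A.owner v = σ) (hw : w ∈ X) (ha : A.Adj v w) : w ∈ A.trap σ X B := by
  obtain ⟨h1, h2⟩ := Finset.mem_sdiff.1 hv
  exact Finset.mem_sdiff.2 ⟨hw, fun h => h2 (mem_attr_of_own h1 ho hw ha h)⟩

/-- From a position of `σ` no edge leads into the attractor. A position of the opponent with all its
successors in the attractor would belong to it. -/
theorem subarena_trap {σ : Fin 2} {X B : Finset V} (hX : A.Subarena X) :
    A.Subarena (A.trap σ X B) := by
  intro v hv
  obtain ⟨h1, h2⟩ := Finset.mem_sdiff.1 hv
  obtain ⟨w, hw, ha⟩ := hX v h1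
  by_cases ho : A.owner v = σ
  · exact ⟨w, mem_trap_of_adj hv ho hw ha, ha⟩
  · by_contra hcon
    push Not at hcon
    refine h2 (mem_attr_of_opp h1 ho hw ha fun w hw ha => ?_)
    by_contra h
    exact hcon w (Finset.mem_sdiff.2 ⟨hw, h⟩) ha

/-! ### Playing in parts of an arena -/

/-- A strategy for `T` can be used in `X`, as long as the opponent does not leave `T`. -/
theorem Ensures.lift {σ : Fin 2} {X T Y : Finset V} {W : (ℕ → V) → Prop} (hX : A.Subarena X)
    (hT : T ⊆ X) (hY : Y ⊆ T) (h : A.Ensures σ T Y W) :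
    A.Ensures σ X Y fun ρ => W ρ ∨ ∃ i, ρ i ∈ T ∧ A.owner (ρ i) ≠ σ ∧ ρ (i + 1) ∉ T := by
  classical
  obtain ⟨S, hS, h⟩ := h
  have : ∀ v, ∃ w, v ∈ X → w ∈ X ∧ A.Adj v w := fun v => by
    by_cases hv : v ∈ X
    · obtain ⟨w, h1, h2⟩ := hX v hv
      exact ⟨w, fun _ => ⟨h1, h2⟩⟩
    · exact ⟨v, fun h => absurd h hv⟩
  choose f hf using this
  let U : MemStrategy V := { S with mv := fun m v => if v ∈ T then S.mv m v else f v }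
  have htr : ∀ ρ i, U.trace ρ i = S.trace ρ i := by
    intro ρ i
    induction i with
    | zero => rfl
    | succ i ih => simp only [MemStrategy.trace, ih]; rfl
  refine ⟨U, ?_, ?_⟩
  · intro m v hv ho
    by_cases hvT : v ∈ T
    · simpa [U, hvT] using ⟨(hS m v hvT ho).1, hT (hS m v hvT ho).2⟩
    · simpa [U, hvT] using (hf v hv).symm
  · intro ρ hρ h0 hc
    by_cases hex : ∃ i, ρ i ∈ T ∧ A.owner (ρ i) ≠ σ ∧ ρ (i + 1) ∉ T
    · exact .inr hex
    · left
      push Not at hex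
      have hin : ∀ i, ρ i ∈ T := by
        intro i
        induction i with
        | zero => exact hY h0
        | succ i ih =>
          by_cases ho : A.owner (ρ i) = σ
          · rw [hc i ho]
            simpa [U, ih] using (hS _ _ ih ho).2
          · exact hex i ih ho
      refine h ρ (fun i => ⟨hin i, (hρ i).2⟩) h0 fun i ho => ?_
      rw [hc i ho, htr]
      simp [U, hin i]

/-- The opponent `σ` of `τ` cannot leave the trap, and the strategy of `τ` does not. -/
theorem Ensures.lift_trap {σ τ : Fin 2} (hστ : σ ≠ τ) {X Y B : Finset V} {W : (ℕ → V) → Prop}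
    (hX : A.Subarena X) (hY : Y ⊆ A.trap σ X B) (h : A.Ensures τ (A.trap σ X B) Y W) :
    A.Ensures τ X Y W := by
  refine (h.lift hX trap_subset hY).mono subset_rfl fun ρ hρ _ h => h.resolve_right ?_
  rintro ⟨i, h1, h2, h3⟩
  exact h3 (mem_trap_of_adj h1 (by omega) (hρ _).1 (hρ i).2)

/-- A strategy for the part `T` of `X` extends to `X` if the rest is won. -/
theorem Ensures.lift_merge {σ : Fin 2} {X T Y Y' : Finset V} {W : (ℕ → V) → Prop}
    (hW : ∀ ρ k, W (shiftPlay k ρ) → W ρ) (hX : A.Subarena X) (hT : T ⊆ X) (hY : Y ⊆ T)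
    (h : A.Ensures σ T Y W) (h' : A.Ensures σ X (X \ T) W) (hY' : Y' ⊆ Y ∪ X \ T) :
    A.Ensures σ X Y' W := by
  have h1 : A.Ensures σ X Y W := by
    refine Ensures.merge hW h' ((h.lift hX hT hY).mono subset_rfl fun ρ hρ _ hh => ?_)
    rcases hh with hh | ⟨i, _, _, hi⟩
    · exact .inl hh
    · exact .inr ⟨i + 1, Finset.mem_sdiff.2 ⟨(hρ _).1, hi⟩⟩
  -- the starting position tells which of the two strategies to use
  obtain ⟨S, hS, h1⟩ := h1
  refine Ensures.merge hW h' ⟨S, hS, fun ρ hρ h0 hc => ?_⟩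
  rcases Finset.mem_union.1 (hY' h0) with h0 | h0
  · exact .inl (h1 ρ hρ h0 hc)
  · exact .inr ⟨0, h0⟩

/-- Since `σ` cannot leave the trap, the strategy for `X` is legal in it, and plays in the trap are
plays in `X`. -/
theorem Ensures.restrict_trap {σ : Fin 2} {X B : Finset V} {W : (ℕ → V) → Prop}
    (h : A.Ensures σ X X W) : A.Ensures σ (A.trap σ X B) (A.trap σ X B) W := by
  obtain ⟨S, hS, h⟩ := h
  refine ⟨S, fun m v hv ho => ?_, fun ρ hρ h0 hc =>
    h ρ (fun i => ⟨trap_subset (hρ i).1, (hρ i).2⟩) (trap_subset h0) hc⟩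
  have := hS m v (trap_subset hv) ho
  exact ⟨this.1, mem_trap_of_adj hv ho this.2 this.1⟩

/-- Strategies of the two players have a common play. -/
theorem Ensures.common_play {σ τ : Fin 2} (hστ : σ ≠ τ) {X Y Y' : Finset V}
    {W W' : (ℕ → V) → Prop} {v : V} (h : A.Ensures σ X Y W) (h' : A.Ensures τ X Y' W')
    (hX : v ∈ X) (hY : v ∈ Y) (hY' : v ∈ Y') : ∃ ρ, W ρ ∧ W' ρ := by
  obtain ⟨S, hS, h⟩ := h
  obtain ⟨T, hT, h'⟩ := h'
  let st : ℕ → S.M × T.M × V := fun i => Nat.rec (S.init, T.init, v)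
    (fun _ x => (S.upd x.1 x.2.2, T.upd x.2.1 x.2.2,
      if A.owner x.2.2 = σ then S.mv x.1 x.2.2 else T.mv x.2.1 x.2.2)) i
  let ρ : ℕ → V := fun i => (st i).2.2
  have hs : ∀ i, (st i).1 = S.trace ρ i := by
    intro i
    induction i with
    | zero => rfl
    | succ i ih => simp only [MemStrategy.trace, ← ih]; rfl
  have ht : ∀ i, (st i).2.1 = T.trace ρ i := by
    intro i
    induction i with
    | zero => rfl
    | succ i ih => simp only [MemStrategy.trace, ← ih]; rfl
  have hρ : ∀ i, ρ (i + 1) = if A.owner (ρ i) = σ then S.mv (S.trace ρ i) (ρ i)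
      else T.mv (T.trace ρ i) (ρ i) := by
    intro i
    rw [← hs, ← ht]
  have hstep : ∀ i, ρ i ∈ X → A.Adj (ρ i) (ρ (i + 1)) ∧ ρ (i + 1) ∈ X := by
    intro i hi
    rw [hρ]
    split_ifs with ho
    · exact hS _ _ hi ho
    · exact hT _ _ hi (by omega)
  have hin : ∀ i, ρ i ∈ X := by
    intro i
    induction i with
    | zero => exact hX
    | succ i ih => exact (hstep i ih).2
  have hplay : A.PlayIn X ρ := fun i => ⟨hin i, (hstep i (hin i)).1⟩
  refine ⟨ρ, h ρ hplay hY fun i ho => ?_, h' ρ hplay hY' fun i ho => ?_⟩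
  · rw [hρ, if_pos ho]
  · rw [hρ, if_neg (by omega)]

/-! ### Winning in subarenas -/

/-- The two conditions `C 0` and `C 1` are complementary. -/
def Complementary (C : Fin 2 → Finset V → Prop) : Prop :=
  ∀ σ τ, σ ≠ τ → ∀ X, C σ X ↔ ¬ C τ X

variable (A) in
/-- Player `σ` wins in the subarena `X` from all positions in `Y`. -/
def WinsOn (C : Fin 2 → Finset V → Prop) (σ : Fin 2) (X Y : Finset V) : Prop :=
  A.Ensures σ X Y fun ρ => C σ (infSet ρ)

variable {C : Fin 2 → Finset V → Prop} {σ τ : Fin 2}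

theorem sdiff_trap {X B : Finset V} : X \ A.trap σ X B ⊆ A.attr σ X B := by
  intro v hv
  simp only [trap, Finset.mem_sdiff, not_and, not_not] at hv
  exact hv.2 hv.1

theorem WinsOn.attr {X B : Finset V} (hX : A.Subarena X) (h : A.WinsOn C σ X B) :
    A.WinsOn C σ X (A.attr σ X B) :=
  Ensures.merge cond_shift h ((ensures_attr hX).mono subset_rfl fun _ _ _ h => .inr h)

theorem WinsOn.not_both (hC : Complementary C) (hστ : σ ≠ τ) {X Y Y' : Finset V} {v : V}
    (h : A.WinsOn C σ X Y) (h' : A.WinsOn C τ X Y') (hX : v ∈ X) (hY : v ∈ Y) : v ∉ Y' := by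
  intro hY'
  obtain ⟨ρ, h1, h2⟩ := Ensures.common_play hστ h h' hX hY hY'
  exact (hC σ τ hστ _).1 h1 h2

theorem winsOn_empty {X : Finset V} (hX : A.Subarena X) : A.WinsOn C σ X ∅ := by
  obtain ⟨S, hS, _⟩ := ensures_attr (σ := σ) (B := ∅) hX
  exact ⟨S, hS, fun ρ _ h0 => absurd h0 (Finset.notMem_empty _)⟩

/-- If `X` itself is good for Player `σ`, then `σ` wins from all positions in `X` if this holds in
the traps that belong to the positions of `X`. -/
theorem winsOn_of_cond {X : Finset V} (hX : A.Subarena X) (hc : C σ X)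
    (h : ∀ v ∈ X, A.WinsOn C σ (A.trap σ X {v}) (A.trap σ X {v})) : A.WinsOn C σ X X := by
  rcases X.eq_empty_or_nonempty with rfl | hne
  · exact winsOn_empty hX
  refine (Ensures.cycle (A := A) (σ := σ) (W := fun ρ => C σ (infSet ρ)) cond_shift hne
    fun v hv => ?_).mono subset_rfl fun ρ hρ _ hh => ?_
  -- Aiming at `v`: outside the trap of `v` the attractor strategy leads there; inside, the strategy
  -- of the trap wins unless the opponent leaves the trap and thereby enters the attractor.
  · have hW : ∀ (ρ : ℕ → V) k, (C σ (infSet (shiftPlay k ρ)) ∨ Hits {v} (shiftPlay k ρ)) →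
        C σ (infSet ρ) ∨ Hits {v} ρ := fun ρ k h => h.imp (cond_shift ρ k)
      fun ⟨i, hi⟩ => ⟨k + i, hi⟩
    refine Ensures.lift_merge hW hX trap_subset subset_rfl
      ((h v hv).mono subset_rfl fun _ _ _ h => .inl h)
      ((ensures_attr hX).mono sdiff_trap fun _ _ _ h => .inr h) ?_
    rw [Finset.union_sdiff_of_subset trap_subset]
  · rcases hh with hh | hh
    · exact hh
    -- All positions of `X` recur, and no others occur.
    · have : infSet ρ = X := by
        classical
        ext v
        simp only [infSet, Finset.mem_filter, Finset.mem_univ, true_and, Filter.frequently_atTop]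
        exact ⟨fun h => by obtain ⟨b, _, rfl⟩ := h 0; exact (hρ b).1, fun h => hh v h⟩
      rwa [this]

/-- A player who wins from some position `v` of `X` wins from all positions if this holds in the
trap that belongs to `v`. -/
theorem winsOn_of_mem {X Y : Finset V} (hX : A.Subarena X) (hY : A.WinsOn C σ X Y)
    (h : A.WinsOn C σ (A.trap σ X Y) (A.trap σ X Y)) : A.WinsOn C σ X X := by
  refine Ensures.lift_merge cond_shift hX trap_subset subset_rfl h
    ((hY.attr hX).mono sdiff_trap fun _ _ _ h => h) ?_
  rw [Finset.union_sdiff_of_subset trap_subset]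

theorem trap_ssubset {X B : Finset V} {v : V} (hv : v ∈ X) (hB : v ∈ B) :
    A.trap σ X B ⊂ X :=
  Finset.ssubset_iff_subset_ne.2 ⟨trap_subset, fun h => notMem_trap hB (h ▸ hv)⟩

variable (A) in
/-- The positions of `X` are partitioned into winning regions. -/
def Determined (C : Fin 2 → Finset V → Prop) (σ τ : Fin 2) (X : Finset V) : Prop :=
  ∃ P Q, P ∪ Q = X ∧ A.WinsOn C σ X P ∧ A.WinsOn C τ X Q

theorem Determined.symm {X : Finset V} (h : A.Determined C σ τ X) : A.Determined C τ σ X := by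
  obtain ⟨P, Q, h, hP, hQ⟩ := h
  exact ⟨Q, P, by rwa [Finset.union_comm], hQ, hP⟩

/-- Induction on `X`, where `σ` may be taken as the player for whom `X` is good. If `σ` does not win
everywhere, then in the trap of some `v` the opponent wins from a nonempty set `Q`, and also in `X`,
as `σ` cannot leave the trap. Removing the attractor of `Q` leaves a smaller subarena. There, the
region of `σ` stays won in `X` because `τ` cannot leave; the region of `τ` does because an exit of
`σ` leads into the attractor of `Q`. -/
theorem determined (hC : Complementary C) (hστ : σ ≠ τ) {X : Finset V} (hX : A.Subarena X) :
    A.Determined C σ τ X := by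
  induction X using Finset.strongInduction generalizing σ τ with
  | H X ih =>
    wlog hc : C σ X generalizing σ τ
    · exact (this hστ.symm ((hC τ σ hστ.symm X).2 hc)).symm
    by_cases h : ∀ v ∈ X, A.WinsOn C σ (A.trap σ X {v}) (A.trap σ X {v})
    · exact ⟨X, ∅, by simp, winsOn_of_cond hX hc h, winsOn_empty hX⟩
    push Not at h
    obtain ⟨v, hv, hnot⟩ := h
    obtain ⟨P, Q, hPQ, hP, hQ⟩ :=
      ih _ (trap_ssubset hv (Finset.mem_singleton_self v)) hστ (subarena_trap hX)
    have hQne : Q.Nonempty := by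
      rw [Finset.nonempty_iff_ne_empty]
      rintro rfl
      rw [Finset.union_empty] at hPQ
      subst hPQ
      exact hnot hP
    obtain ⟨q, hq⟩ := hQne
    have hQsub : Q ⊆ A.trap σ X {v} := hPQ ▸ Finset.subset_union_right
    have hQX : A.WinsOn C τ X Q := Ensures.lift_trap hστ hX hQsub hQ
    obtain ⟨P', Q', hPQ', hP', hQ'⟩ :=
      ih _ (trap_ssubset (trap_subset (hQsub hq)) hq : A.trap τ X Q ⊂ X) hστ (subarena_trap hX)
    refine ⟨P', Q' ∪ X \ A.trap τ X Q, ?_,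
      Ensures.lift_trap hστ.symm hX (hPQ' ▸ Finset.subset_union_left) hP', ?_⟩
    · rw [← Finset.union_assoc, hPQ', Finset.union_sdiff_of_subset trap_subset]
    · exact Ensures.lift_merge cond_shift hX trap_subset (hPQ' ▸ Finset.subset_union_right) hQ'
        ((hQX.attr hX).mono sdiff_trap fun _ _ _ h => h) subset_rfl

/-- The recurrence for the subarenas in which Player `σ` wins from everywhere. -/
theorem winsOn_iff (hC : Complementary C) (hστ : σ ≠ τ) {X : Finset V} (hX : A.Subarena X)
    (hne : X.Nonempty) :
    A.WinsOn C σ X X ↔ (∀ v ∈ X, A.WinsOn C σ (A.trap σ X {v}) (A.trap σ X {v})) ∧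
      (C σ X ∨ ¬ A.WinsOn C τ X X) := by
  constructor
  · intro h
    obtain ⟨v, hv⟩ := hne
    exact ⟨fun v _ => h.restrict_trap, .inr fun h' => h.not_both hC hστ h' hv hv hv⟩
  · rintro ⟨h, hc | hn⟩
    · exact winsOn_of_cond hX hc h
    -- By determinacy, if `τ` does not win everywhere, some position is won by `σ`; one such
    -- position suffices.
    · obtain ⟨P, Q, hPQ, hP, hQ⟩ := determined hC hστ hX
      have : P.Nonempty := by
        rw [Finset.nonempty_iff_ne_empty]
        rintro rfl
        rw [Finset.empty_union] at hPQ
        subst hPQ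
        exact hn hQ
      obtain ⟨v, hv⟩ := this
      have hvX : v ∈ X := hPQ ▸ Finset.mem_union_left _ hv
      exact winsOn_of_mem hX (hP.mono (Finset.singleton_subset_iff.2 hv) fun _ _ _ h => h)
        (h v hvX)

/-- The winning region of Player `σ` is the union of the traps for `τ` in which `σ` wins from
everywhere. -/
theorem exists_trap_iff (hC : Complementary C) (hστ : σ ≠ τ) {X : Finset V} (hX : A.Subarena X)
    {v : V} (hv : v ∈ X) :
    (A.WinsOn C σ X {v} ↔ ∃ B, v ∈ A.trap τ X B ∧ A.WinsOn C σ (A.trap τ X B) (A.trap τ X B)) ∧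
      (A.WinsOn C τ X {v} ↔ ¬ A.WinsOn C σ X {v}) := by
  obtain ⟨P, Q, hPQ, hP, hQ⟩ := determined hC hστ hX
  have hsing : ∀ {σ : Fin 2} {P : Finset V} {v : V}, A.WinsOn C σ X P → v ∈ P →
      A.WinsOn C σ X {v} := fun hP hv =>
    hP.mono (Finset.singleton_subset_iff.2 hv) fun _ _ _ h => h
  have hself := Finset.mem_singleton_self v
  constructor
  · constructor
    · intro hw
      have hP' : ∀ u ∈ A.trap τ X Q, u ∈ P := fun u hu => by
        have := trap_subset hu
        rw [← hPQ] at this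
        exact (Finset.mem_union.1 this).resolve_right fun h => notMem_trap h hu
      -- The witness is the winning region `Q` of `τ`. If `τ` won from a position of its trap, then
      -- `τ` would win from it in `X` too, because leaving the trap leads into the attractor of `Q`.
      -- But the trap lies in `P`, where `σ` wins.
      refine ⟨Q, Finset.mem_sdiff.2 ⟨hv, hw.not_both hC hστ (hQ.attr hX) hv hself⟩, ?_⟩
      obtain ⟨P₁, Q₁, h1, hP₁, hQ₁⟩ := determined hC hστ (subarena_trap (σ := τ) (B := Q) hX)
      have hQ₁X : A.WinsOn C τ X Q₁ :=
        Ensures.lift_merge cond_shift hX trap_subset (h1 ▸ Finset.subset_union_right) hQ₁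
          ((hQ.attr hX).mono sdiff_trap fun _ _ _ h => h) Finset.subset_union_left
      have : Q₁ = ∅ := by
        rw [Finset.eq_empty_iff_forall_notMem]
        intro u hu
        have hu' : u ∈ A.trap τ X Q := h1 ▸ Finset.mem_union_right _ hu
        exact hP.not_both hC hστ hQ₁X (trap_subset hu') (hP' u hu') hu
      rw [this, Finset.union_empty] at h1
      rwa [h1] at hP₁
    · rintro ⟨B, hvB, h⟩
      exact hsing (Ensures.lift_trap hστ.symm hX subset_rfl h) hvB
  · constructor
    · exact fun h h' => h.not_both hC hστ.symm h' hv hself hself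
    · intro h
      have := hPQ ▸ hv
      rcases Finset.mem_union.1 this with h' | h'
      · exact absurd (hsing hP h') h
      · exact hsing hQ h'

theorem subarena_univ (A : Arena V) : A.Subarena Finset.univ := fun v _ => by
  obtain ⟨w, hw⟩ := A.total v
  exact ⟨w, Finset.mem_univ w, hw⟩

/-- Strategies with memory are as good as strategies that depend on the whole history. -/
theorem canForce_iff {W : (ℕ → V) → Prop} {v : V} :
    A.CanForce σ {ρ | W ρ} v ↔ A.Ensures σ Finset.univ {v} W := by
  constructor
  · rintro ⟨f, hf⟩
    classical
    choose g hg using A.total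
    let U : MemStrategy V :=
      { M := List V
        init := []
        upd := fun h v => h ++ [v]
        -- At memories that are no paths `f` need not move along an edge; there `g` supplies a legal
        -- move.
        mv := fun h v => if A.Adj v (f.move (h ++ [v])) then f.move (h ++ [v]) else g v }
    have htr : ∀ ρ k, U.trace ρ k = (List.range k).map ρ := by
      intro ρ k
      induction k with
      | zero => rfl
      | succ k ih =>
        simp only [MemStrategy.trace, ih, List.range_succ, List.map_append]
        rfl
    refine ⟨U, fun m v _ _ => ⟨?_, Finset.mem_univ _⟩, fun ρ hρ h0 hc => ?_⟩
    · by_cases h : A.Adj v (f.move (m ++ [v]))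
      · simp only [U, if_pos h]; exact h
      · simp only [U, if_neg h]; exact hg v
    · refine hf ρ (fun i => (hρ i).2) (by simpa using h0) fun k ho => ?_
      have hchain : ((List.range k).map ρ ++ [ρ k]).IsChain A.Adj := by
        rw [← List.map_singleton, ← List.map_append, ← List.range_succ]
        rw [List.isChain_iff_getElem]
        intro i hi
        simpa using (hρ i).2
      have hl := f.legal _ _ hchain ho
      have := hc k ho
      rw [htr] at this
      rw [this, List.range_succ, List.map_append]
      simp only [U, List.map_singleton, if_pos hl]
  · rintro ⟨S, hS, h⟩
    refine ⟨⟨fun l => S.mv (l.dropLast.foldl S.upd S.init) (l.getLastD v), ?_⟩, ?_⟩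
    · intro l x _ ho
      have := (hS (l.foldl S.upd S.init) x (Finset.mem_univ _) ho).1
      simpa using this
    · intro ρ hρ h0 hfol
      refine h ρ (fun i => ⟨Finset.mem_univ _, hρ i⟩) (by simp [h0]) fun i ho => ?_
      have := hfol i ho
      have htr : ∀ k, S.trace ρ k = ((List.range k).map ρ).foldl S.upd S.init := by
        intro k
        induction k with
        | zero => rfl
        | succ k ih => simp [MemStrategy.trace, ih, List.range_succ]
      rw [this, htr, List.range_succ]
      simp

end Arena

/-! ### A language with named registers and arrays -/

/-- Programs with registers in `R` and arrays in `K`. -/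
inductive Cmd (R K : Type) where
  /-- `d := c` -/
  | const (d : R) (c : ℕ)
  /-- `d := a + b` -/
  | add (d a b : R)
  /-- `d := a - b` -/
  | sub (d a b : R)
  /-- `d := k[a]` -/
  | get (d : R) (k : K) (a : R)
  /-- `k[a] := b` -/
  | set (k : K) (a b : R)
  /-- `p; q` -/
  | seq (p q : Cmd R K)
  /-- if `a ≠ 0` then `p` else `q` -/
  | ite (a : R) (p q : Cmd R K)
  /-- while `a ≠ 0` do `p` -/
  | while (a : R) (p : Cmd R K)

infixr:60 " ;; " => Cmd.seq

/-- Registers, arrays, and the time that has passed. -/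
@[ext]
structure HState (R K : Type) where
  reg : R → ℕ
  arr : K → ℕ → ℕ
  time : ℕ

/-- Bounds for the numbers in registers and in arrays, and the lengths of the arrays. -/
structure Bounds (K : Type) where
  regMax : ℕ
  cellMax : ℕ
  len : K → ℕ

section Language

variable {R K : Type} [DecidableEq R] [DecidableEq K]

namespace HState

def setReg (s : HState R K) (d : R) (x : ℕ) : HState R K :=
  { s with reg := Function.update s.reg d x }

def setArr (s : HState R K) (k : K) (i x : ℕ) : HState R K :=
  { s with arr := Function.update s.arr k (Function.update (s.arr k) i x) }

def tick (s : HState R K) (t : ℕ) : HState R K := { s with time := s.time + t }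

variable (s : HState R K) (d r : R) (k l : K) (i x t : ℕ)

omit [DecidableEq K] in
@[simp] theorem setReg_reg : (s.setReg d x).reg r = if r = d then x else s.reg r :=
  Function.update_apply ..

omit [DecidableEq K] in
@[simp] theorem setReg_arr : (s.setReg d x).arr = s.arr := rfl

omit [DecidableEq K] in
@[simp] theorem setReg_time : (s.setReg d x).time = s.time := rfl

omit [DecidableEq R] in
@[simp] theorem setArr_reg : (s.setArr k i x).reg = s.reg := rfl

omit [DecidableEq R] in
@[simp] theorem setArr_arr :
    (s.setArr k i x).arr l = if l = k then Function.update (s.arr k) i x else s.arr l :=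
  Function.update_apply ..

omit [DecidableEq R] in
@[simp] theorem setArr_time : (s.setArr k i x).time = s.time := rfl

omit [DecidableEq R] [DecidableEq K] in
@[simp] theorem tick_reg : (s.tick t).reg = s.reg := rfl

omit [DecidableEq R] [DecidableEq K] in
@[simp] theorem tick_arr : (s.tick t).arr = s.arr := rfl

omit [DecidableEq R] [DecidableEq K] in
@[simp] theorem tick_time : (s.tick t).time = s.time + t := rfl

end HState

/-- `Run B p s s'`: the program `p` started in `s` halts in `s'`, within the bounds `B`. -/
inductive Run (B : Bounds K) : Cmd R K → HState R K → HState R K → Prop where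
  | const {d c s} (h : c ≤ B.regMax) : Run B (.const d c) s ((s.setReg d c).tick 1)
  | add {d a b s} (h : s.reg a + s.reg b ≤ B.regMax) :
      Run B (.add d a b) s ((s.setReg d (s.reg a + s.reg b)).tick 1)
  | sub {d a b s} (h : s.reg a - s.reg b ≤ B.regMax) :
      Run B (.sub d a b) s ((s.setReg d (s.reg a - s.reg b)).tick 1)
  -- Two steps, since the compiled access first adds the base address to the index.
  | get {d k a s} (h : s.reg a < B.len k) :
      Run B (.get d k a) s ((s.setReg d (s.arr k (s.reg a))).tick 2)
  | set {k a b s} (ha : s.reg a < B.len k) (hb : s.reg b ≤ B.cellMax) :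
      Run B (.set k a b) s ((s.setArr k (s.reg a) (s.reg b)).tick 2)
  | seq {p q s₁ s₂ s₃} (hp : Run B p s₁ s₂) (hq : Run B q s₂ s₃) : Run B (.seq p q) s₁ s₃
  | ite_true {a p q s s'} (ha : s.reg a ≠ 0) (hp : Run B p (s.tick 1) s') :
      Run B (.ite a p q) s s'
  | ite_false {a p q s s'} (ha : s.reg a = 0) (hq : Run B q (s.tick 1) s') :
      Run B (.ite a p q) s s'
  | while_done {a p s} (ha : s.reg a = 0) : Run B (.while a p) s (s.tick 1)
  | while_step {a p s₁ s₂ s₃} (ha : s₁.reg a ≠ 0) (hp : Run B p (s₁.tick 1) s₂)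
      (hw : Run B (.while a p) s₂ s₃) : Run B (.while a p) s₁ s₃

/-- The program `p` started in `s` halts in a state that satisfies `Q`. -/
def wp (B : Bounds K) (p : Cmd R K) (Q : HState R K → Prop) (s : HState R K) : Prop :=
  ∃ s', Run B p s s' ∧ Q s'

/-! ### Registers and arrays that a program leaves unchanged -/

namespace Cmd

def writesReg : Cmd R K → R → Bool
  | const d _, r | add d _ _, r | sub d _ _, r | get d _ _, r => decide (d = r)
  | set _ _ _, _ => false
  | seq p q, r | ite _ p q, r => p.writesReg r || q.writesReg r
  | .while _ p, r => p.writesReg r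

def writesArr : Cmd R K → K → Bool
  | const _ _, _ | add _ _ _, _ | sub _ _ _, _ | get _ _ _, _ => false
  | set k _ _, l => decide (k = l)
  | seq p q, r | ite _ p q, r => p.writesArr r || q.writesArr r
  | .while _ p, r => p.writesArr r

/-- The program writes none of the registers in `l`. -/
def keeps (p : Cmd R K) (l : List R) : Bool := l.all fun r => !p.writesReg r

/-- `s` and `s'` agree on all registers and arrays that `p` does not write. -/
def Same (p : Cmd R K) (s s' : HState R K) : Prop :=
  (∀ r, p.writesReg r = false → s'.reg r = s.reg r) ∧
    ∀ k, p.writesArr k = false → s'.arr k = s.arr k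

theorem Same.trans {p : Cmd R K} {s₁ s₂ s₃ : HState R K} (h : p.Same s₁ s₂) (h' : p.Same s₂ s₃) :
    p.Same s₁ s₃ :=
  ⟨fun r hr => (h'.1 r hr).trans (h.1 r hr), fun k hk => (h'.2 k hk).trans (h.2 k hk)⟩

theorem Same.mono {p q : Cmd R K} {s s' : HState R K} (h : p.Same s s')
    (hr : ∀ r, q.writesReg r = false → p.writesReg r = false)
    (hk : ∀ k, q.writesArr k = false → p.writesArr k = false) : q.Same s s' :=
  ⟨fun r h' => h.1 r (hr r h'), fun k h' => h.2 k (hk k h')⟩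

end Cmd

/-- The syntactic write sets contain everything that a run changes. For concrete programs the
premises of `Same` hold by `rfl`, so loop invariants need not mention what the loop does not touch.
-/
theorem Run.same {B : Bounds K} {p : Cmd R K} {s s' : HState R K} (h : Run B p s s') :
    p.Same s s' := by
  induction h with
  | const h | add h | sub h | get h =>
    exact ⟨fun r hr => by
      simp only [Cmd.writesReg, decide_eq_false_iff_not] at hr
      simp [Ne.symm hr], fun _ _ => rfl⟩
  | set ha hb => exact ⟨fun _ _ => rfl, fun k hk => by
      simp only [Cmd.writesArr, decide_eq_false_iff_not] at hk
      simp [Ne.symm hk]⟩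
  | seq hp hq ihp ihq =>
    refine (ihp.mono ?_ ?_).trans (ihq.mono ?_ ?_) <;>
      simp +contextual [Cmd.writesReg, Cmd.writesArr]
  | ite_true ha hp ih | ite_false ha hp ih =>
    refine Cmd.Same.mono (p := _) (s := _) ih ?_ ?_ <;>
      simp +contextual [Cmd.writesReg, Cmd.writesArr]
  | while_done ha => exact ⟨fun _ _ => rfl, fun _ _ => rfl⟩
  | while_step ha hp hw ihp ihw =>
    exact Cmd.Same.trans (ihp.mono (fun _ h => h) fun _ h => h) ihw

/-! ### Proof rules for total correctness and running time -/

section Rules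

variable {B : Bounds K} {p q : Cmd R K} {Q Q' : HState R K → Prop} {s : HState R K} {d a b : R}
  {k : K}

theorem wp_const {c : ℕ} :
    wp B (.const d c) Q s ↔ c ≤ B.regMax ∧ Q ((s.setReg d c).tick 1) :=
  ⟨fun ⟨_, h, hq⟩ => by cases h with | const h => exact ⟨h, hq⟩,
    fun ⟨h, hq⟩ => ⟨_, .const h, hq⟩⟩

theorem wp_add : wp B (.add d a b) Q s ↔
    s.reg a + s.reg b ≤ B.regMax ∧ Q ((s.setReg d (s.reg a + s.reg b)).tick 1) :=
  ⟨fun ⟨_, h, hq⟩ => by cases h with | add h => exact ⟨h, hq⟩,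
    fun ⟨h, hq⟩ => ⟨_, .add h, hq⟩⟩

theorem wp_sub : wp B (.sub d a b) Q s ↔
    s.reg a - s.reg b ≤ B.regMax ∧ Q ((s.setReg d (s.reg a - s.reg b)).tick 1) :=
  ⟨fun ⟨_, h, hq⟩ => by cases h with | sub h => exact ⟨h, hq⟩,
    fun ⟨h, hq⟩ => ⟨_, .sub h, hq⟩⟩

theorem wp_get : wp B (.get d k a) Q s ↔
    s.reg a < B.len k ∧ Q ((s.setReg d (s.arr k (s.reg a))).tick 2) :=
  ⟨fun ⟨_, h, hq⟩ => by cases h with | get h => exact ⟨h, hq⟩,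
    fun ⟨h, hq⟩ => ⟨_, .get h, hq⟩⟩

theorem wp_set : wp B (.set k a b) Q s ↔ s.reg a < B.len k ∧ s.reg b ≤ B.cellMax ∧
    Q ((s.setArr k (s.reg a) (s.reg b)).tick 2) :=
  ⟨fun ⟨_, h, hq⟩ => by cases h with | set h h' => exact ⟨h, h', hq⟩,
    fun ⟨h, h', hq⟩ => ⟨_, .set h h', hq⟩⟩

theorem wp_seq : wp B (p ;; q) Q s ↔ wp B p (wp B q Q) s :=
  ⟨fun ⟨_, h, hq⟩ => by cases h with | seq h h' => exact ⟨_, h, _, h', hq⟩,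
    fun ⟨_, h, _, h', hq⟩ => ⟨_, .seq h h', hq⟩⟩

theorem wp_ite : wp B (.ite a p q) Q s ↔
    if s.reg a ≠ 0 then wp B p Q (s.tick 1) else wp B q Q (s.tick 1) := by
  constructor
  · rintro ⟨_, h, hq⟩
    cases h with
    | ite_true ha h => rw [if_pos ha]; exact ⟨_, h, hq⟩
    | ite_false ha h => rw [if_neg (not_not.2 ha)]; exact ⟨_, h, hq⟩
  · split_ifs with ha
    · exact fun ⟨_, h, hq⟩ => ⟨_, .ite_true ha h, hq⟩
    · exact fun ⟨_, h, hq⟩ => ⟨_, .ite_false (not_not.1 ha) h, hq⟩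

/-- Besides weakening the postcondition, this supplies the frame `p.Same s s'`, by which facts about
untouched data pass through a sequence of programs. -/
theorem wp.mono (h : wp B p Q s) (hQ : ∀ s', p.Same s s' → Q s' → Q' s') : wp B p Q' s := by
  obtain ⟨s', hr, hq⟩ := h
  exact ⟨s', hr, hQ s' hr.same hq⟩

/-- for `i := 0` to `lim - 1` do `body`, with `tmp` as auxiliary register and `one = 1` -/
def Cmd.forUp (one i lim tmp : R) (body : Cmd R K) : Cmd R K :=
  .const i 0 ;; .sub tmp lim i ;; .while tmp (body ;; .add i i one ;; .sub tmp lim i)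

/-- Induction on the number of remaining iterations, which `tmp` holds. `Inv` refers to the moment
after the loop test; the three ticks are the assignments to `i` and `tmp` and this test. -/
theorem wp_forUp {one i lim tmp : R} {body : Cmd R K} (Inv : ℕ → HState R K → Prop)
    (hd : [one, i, lim, tmp].Nodup)
    (hw : body.keeps [one, i, lim] = true)
    (hone : s.reg one = 1) (hlim : s.reg lim ≤ B.regMax)
    (h0 : Inv 0 (((s.setReg i 0).setReg tmp (s.reg lim)).tick 3))
    (hstep : ∀ k < s.reg lim, ∀ s', (Cmd.forUp one i lim tmp body).Same s s' → s'.reg i = k →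
      Inv k s' → wp B body (fun s'' =>
        Inv (k + 1) (((s''.setReg i (k + 1)).setReg tmp (s.reg lim - (k + 1))).tick 3)) s')
    (hQ : ∀ s', (Cmd.forUp one i lim tmp body).Same s s' → Inv (s.reg lim) s' → Q s') :
    wp B (Cmd.forUp one i lim tmp body) Q s := by
  simp only [List.nodup_cons, List.mem_cons, List.not_mem_nil, or_false, not_or, not_false_eq_true,
    List.nodup_nil, and_true] at hd
  obtain ⟨⟨h1, h2, h3⟩, ⟨h4, h5⟩, h6⟩ := hd
  simp only [Cmd.keeps, List.all_cons, List.all_nil, Bool.and_true, Bool.and_eq_true,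
    Bool.not_eq_true'] at hw
  obtain ⟨hw1, hw2, hw3⟩ := hw
  set m := s.reg lim with hm
  have hsl : ∀ s', (Cmd.forUp one i lim tmp body).Same s s' → s'.reg lim = m := fun s' h =>
    h.1 lim (by simp [Cmd.forUp, Cmd.writesReg, hw3, h4, Ne.symm h6])
  have hso : ∀ s', (Cmd.forUp one i lim tmp body).Same s s' → s'.reg one = 1 := fun s' h =>
    (h.1 one (by simp [Cmd.forUp, Cmd.writesReg, hw1, Ne.symm h1, Ne.symm h3])).trans hone
  have key : ∀ j k, j + k = m → ∀ s', (Cmd.forUp one i lim tmp body).Same s s' → s'.reg i = k →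
      s'.reg tmp = j → Inv k (s'.tick 1) →
      wp B (.while tmp (body ;; .add i i one ;; .sub tmp lim i)) Q s' := by
    intro j
    induction j with
    | zero =>
      intro k hk s' hs hi ht hI
      obtain rfl : k = m := by omega
      exact ⟨_, .while_done ht, hQ _ hs hI⟩
    | succ j ih =>
      intro k hk s' hs hi ht hI
      obtain ⟨s'', hr, hI'⟩ := hstep k (by omega) (s'.tick 1) hs hi hI
      have hi' : s''.reg i = k := (hr.same.1 i hw2).trans hi
      have hs' : (Cmd.forUp one i lim tmp body).Same s s'' := by
        refine hs.trans (hr.same.mono ?_ ?_) <;>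
          simp +contextual [Cmd.forUp, Cmd.writesReg, Cmd.writesArr]
      have hl' := hsl s'' hs'
      have ho' := hso s'' hs'
      set s₃ := ((s''.setReg i (k + 1)).setReg tmp (m - (k + 1))).tick 2 with h₃
      have hr' : Run B (body ;; .add i i one ;; .sub tmp lim i) (s'.tick 1) s₃ := by
        have e : s₃ = ((((s''.setReg i (s''.reg i + s''.reg one)).tick 1).setReg tmp
            (((s''.setReg i (s''.reg i + s''.reg one)).tick 1).reg lim -
              ((s''.setReg i (s''.reg i + s''.reg one)).tick 1).reg i)).tick 1) := by
          simp only [h₃, HState.tick_reg, HState.setReg_reg, if_neg (Ne.symm h4), hi', ho', hl']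
          rfl
        rw [e]
        refine .seq hr (.seq (.add ?_) (.sub ?_))
        · rw [hi', ho']; omega
        · simp only [HState.tick_reg, HState.setReg_reg, if_neg (Ne.symm h4), hl']
          omega
      have hs₃ : (Cmd.forUp one i lim tmp body).Same s s₃ := by
        refine hs'.trans ⟨fun r hr => ?_, fun k hk => rfl⟩
        simp only [Cmd.forUp, Cmd.writesReg, Bool.or_eq_false_iff, decide_eq_false_iff_not] at hr
        simp [h₃, Ne.symm hr.1, Ne.symm hr.2.1]
      obtain ⟨s₄, hr₄, hQ₄⟩ := ih (k + 1) (by omega) s₃ hs₃ (by simp [h₃, h5])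
        (by simp [h₃]; omega) hI'
      exact ⟨s₄, .while_step (by omega) hr' hr₄, hQ₄⟩
  set s₁ := ((s.setReg i 0).setReg tmp m).tick 2 with h₁
  have e : Run B (.const i 0 ;; .sub tmp lim i ;; .while tmp (body ;; .add i i one ;;
      .sub tmp lim i)) s = Run B (Cmd.forUp one i lim tmp body) s := rfl
  have hs₁ : (Cmd.forUp one i lim tmp body).Same s s₁ := by
    refine ⟨fun r hr => ?_, fun k hk => rfl⟩
    simp only [Cmd.forUp, Cmd.writesReg, Bool.or_eq_false_iff, decide_eq_false_iff_not] at hr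
    simp [h₁, Ne.symm hr.1, Ne.symm hr.2.1]
  obtain ⟨s₂, hr, hq⟩ := key m 0 (by omega) s₁ hs₁ (by simp [h₁, h5]) (by simp [h₁]) h0
  refine ⟨s₂, .seq (.const (Nat.zero_le _)) (.seq (.sub ?_) ?_), hq⟩
  · simpa [Ne.symm h4] using hlim
  · convert hr using 1
    ext <;> simp [h₁, Ne.symm h4, ← hm]

/-- The rule for loops whose iterations take time at most `C`. -/
theorem wp_forUp_time {one i lim tmp : R} {body : Cmd R K} (Inv : ℕ → HState R K → Prop) (C : ℕ)
    (hd : [one, i, lim, tmp].Nodup)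
    (hw : body.keeps [one, i, lim] = true)
    (hone : s.reg one = 1) (hlim : s.reg lim ≤ B.regMax)
    (h0 : ∀ t, Inv 0 (((s.setReg i 0).setReg tmp (s.reg lim)).tick t))
    (hstep : ∀ k < s.reg lim, ∀ s', (Cmd.forUp one i lim tmp body).Same s s' → s'.reg i = k →
      Inv k s' → wp B body (fun s'' => s''.time + 3 ≤ s'.time + C ∧
        ∀ x t, Inv (k + 1) (((s''.setReg i (k + 1)).setReg tmp x).tick t)) s')
    (hQ : ∀ s', (Cmd.forUp one i lim tmp body).Same s s' → s'.time ≤ s.time + s.reg lim * C + 3 →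
      Inv (s.reg lim) s' → Q s') :
    wp B (Cmd.forUp one i lim tmp body) Q s := by
  refine wp_forUp (fun k s' => s'.time ≤ s.time + k * C + 3 ∧ Inv k s') hd hw hone hlim
    ⟨by simp, h0 3⟩ ?_ fun s' h h' => hQ s' h h'.1 h'.2
  rintro k hk s' hs hi ⟨ht, hI⟩
  refine (hstep k hk s' hs hi hI).mono fun s'' _ h => ⟨?_, h.2 _ _⟩
  have := h.1
  simp only [HState.tick_time, HState.setReg_time, Nat.add_mul]
  omega

end Rules

/-! ### Compilation -/

/-- The registers of the machine that represent named registers, the base addresses of arrays, and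
an auxiliary register. -/
structure RegMap (R K : Type) where
  reg : R → ℕ
  base : K → ℕ
  aux : ℕ
  reg_injective : Function.Injective reg
  reg_ne_base : ∀ r k, reg r ≠ base k
  reg_ne_aux : ∀ r, reg r ≠ aux
  base_ne_aux : ∀ k, base k ≠ aux

def Cmd.compile (ρ : RegMap R K) : Cmd R K → Prog
  | const d c => .const (ρ.reg d) c
  | add d a b => .add (ρ.reg d) (ρ.reg a) (ρ.reg b)
  | sub d a b => .sub (ρ.reg d) (ρ.reg a) (ρ.reg b)
  | get d k a => .seq (.add ρ.aux (ρ.base k) (ρ.reg a)) (.load (ρ.reg d) ρ.aux)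
  | set k a b => .seq (.add ρ.aux (ρ.base k) (ρ.reg a)) (.store ρ.aux (ρ.reg b))
  | seq p q => .seq (p.compile ρ) (q.compile ρ)
  | ite a p q => .ite (ρ.reg a) (p.compile ρ) (q.compile ρ)
  | .while a p => .while (ρ.reg a) (p.compile ρ)

/-- Base addresses and lengths of arrays that fit into a machine and do not overlap. -/
structure Layout (K : Type) (L : Limits) where
  base : K → ℕ
  len : K → ℕ
  base_add_len_le : ∀ k, base k + len k ≤ L.space
  disjoint : ∀ k l, k ≠ l → base k + len k ≤ base l ∨ base l + len l ≤ base k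

/-- The machine state `m` represents `s`. -/
structure Represents (ρ : RegMap R K) {L : Limits} (ℓ : Layout K L) (s : HState R K)
    (m : MState) : Prop where
  reg : ∀ r, m.reg (ρ.reg r) = s.reg r
  base : ∀ k, m.reg (ρ.base k) = ℓ.base k
  arr : ∀ k i, i < ℓ.len k → m.mem (ℓ.base k + i) = s.arr k i
  -- This ensures that every loaded number fits into a register.
  le : ∀ k i, i < ℓ.len k → s.arr k i ≤ L.regMax

def Layout.bounds {L : Limits} (ℓ : Layout K L) : Bounds K := ⟨L.regMax, L.cellMax, ℓ.len⟩

omit [DecidableEq K] in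
theorem Represents.setReg {ρ : RegMap R K} {L : Limits} {ℓ : Layout K L} {s : HState R K}
    {m : MState} (h : Represents ρ ℓ s m) (d : R) (x t : ℕ) :
    Represents ρ ℓ ((s.setReg d x).tick t) ⟨Function.update m.reg (ρ.reg d) x, m.mem⟩ where
  reg r := by
    by_cases hr : r = d
    · simp [hr]
    · simp [hr, h.reg, ρ.reg_injective.ne hr]
  base k := by simp [h.base, (ρ.reg_ne_base d k).symm]
  arr := h.arr
  le := h.le

omit [DecidableEq R] [DecidableEq K] in
theorem Represents.aux {ρ : RegMap R K} {L : Limits} {ℓ : Layout K L} {s : HState R K}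
    {m : MState} (h : Represents ρ ℓ s m) (x : ℕ) :
    Represents ρ ℓ s ⟨Function.update m.reg ρ.aux x, m.mem⟩ where
  reg r := by simp [h.reg, ρ.reg_ne_aux]
  base k := by simp [h.base, ρ.base_ne_aux]
  arr := h.arr
  le := h.le

omit [DecidableEq R] in
theorem Represents.setArr {ρ : RegMap R K} {L : Limits} {ℓ : Layout K L} {s : HState R K}
    {m : MState} (h : Represents ρ ℓ s m) {k : K} {i x : ℕ} (t : ℕ) (hi : i < ℓ.len k)
    (hx : x ≤ L.regMax) :
    Represents ρ ℓ ((s.setArr k i x).tick t)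
      ⟨m.reg, Function.update m.mem (ℓ.base k + i) x⟩ where
  reg := h.reg
  base := h.base
  arr l j hj := by
    by_cases hl : l = k
    · subst hl
      simp [Function.update_apply, h.arr l j hj]
    · have := ℓ.disjoint l k hl
      simp only [HState.tick_arr, HState.setArr_arr, if_neg hl, Function.update_apply]
      rw [if_neg (by omega), h.arr l j hj]
  le l j hj := by
    by_cases hl : l = k
    · subst hl
      simp only [HState.tick_arr, HState.setArr_arr, if_true, Function.update_apply]
      split_ifs
      · exact hx
      · exact h.le l j hj
    · simpa [hl] using h.le l j hj

/-- Simulation by induction on the run. The costs of `Run` are those of the compiled code, so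
running times agree exactly. Stores stay within one array because the layout is disjoint. -/
theorem Run.compile {ρ : RegMap R K} {L : Limits} {ℓ : Layout K L} (hs : L.space ≤ L.regMax)
    (hc : L.cellMax ≤ L.regMax) {p : Cmd R K} {s s' : HState R K} (h : Run ℓ.bounds p s s')
    {m : MState} (hm : Represents ρ ℓ s m) :
    ∃ m' t, Exec L (p.compile ρ) m m' t ∧ s'.time = s.time + t ∧ Represents ρ ℓ s' m' := by
  induction h generalizing m with
  | const h => exact ⟨_, _, .const h, rfl, hm.setReg _ _ _⟩
  | @add d a b s h =>
    refine ⟨_, _, .add ?_, rfl, ?_⟩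
    · rwa [hm.reg, hm.reg]
    · rw [hm.reg, hm.reg]; exact hm.setReg _ _ _
  | @sub d a b s h =>
    refine ⟨_, _, .sub ?_, rfl, ?_⟩
    · rwa [hm.reg, hm.reg]
    · rw [hm.reg, hm.reg]; exact hm.setReg _ _ _
  | @get d k a s h =>
    change s.reg a < ℓ.len k at h
    have h1 := ℓ.base_add_len_le k
    have h2 := hm.aux (ℓ.base k + s.reg a)
    have h3 := hm.arr k _ h
    refine ⟨_, _, .seq (.add ?_) (.load ?_ ?_), rfl, ?_⟩
    · rw [hm.base, hm.reg]; omega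
    · simp only [hm.base, hm.reg, Function.update_self]; omega
    · simp only [hm.base, hm.reg, Function.update_self, h3]
      exact hm.le k _ h
    · simp only [hm.base, hm.reg, Function.update_self, h3]
      exact h2.setReg _ _ _
  | @set k a b s ha hb =>
    change s.reg a < ℓ.len k at ha
    change s.reg b ≤ L.cellMax at hb
    have h1 := ℓ.base_add_len_le k
    have h2 := hm.aux (ℓ.base k + s.reg a)
    refine ⟨_, _, .seq (.add ?_) (.store ?_ ?_), rfl, ?_⟩
    · rw [hm.base, hm.reg]; omega
    · simp only [hm.base, hm.reg, Function.update_self]; omega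
    · rw [(hm.aux _).reg]; exact hb
    · simp only [hm.base, hm.reg, Function.update_self, ne_eq, ρ.reg_ne_aux, not_false_eq_true,
        Function.update_of_ne]
      exact h2.setArr _ ha (hb.trans hc)
  | seq _ _ ih ih' =>
    obtain ⟨m', t, he, ht, hm'⟩ := ih hm
    obtain ⟨m'', t', he', ht', hm''⟩ := ih' hm'
    exact ⟨m'', t + t', .seq he he', by omega, hm''⟩
  | ite_true ha _ ih =>
    obtain ⟨m', t, he, ht, hm'⟩ := ih (m := m) ⟨hm.reg, hm.base, hm.arr, hm.le⟩
    exact ⟨m', t + 1, .ite_true (by rwa [hm.reg]) he, by simp at ht; omega, hm'⟩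
  | ite_false ha _ ih =>
    obtain ⟨m', t, he, ht, hm'⟩ := ih (m := m) ⟨hm.reg, hm.base, hm.arr, hm.le⟩
    exact ⟨m', t + 1, .ite_false (by rwa [hm.reg]) he, by simp at ht; omega, hm'⟩
  | while_done ha =>
    exact ⟨m, 1, .while_done (by rwa [hm.reg]), rfl, ⟨hm.reg, hm.base, hm.arr, hm.le⟩⟩
  | while_step ha _ _ ih ih' =>
    obtain ⟨m', t, he, ht, hm'⟩ := ih (m := m) ⟨hm.reg, hm.base, hm.arr, hm.le⟩
    obtain ⟨m'', t', he', ht', hm''⟩ := ih' hm'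
    exact ⟨m'', t + t' + 1, .while_step (by rwa [hm.reg]) he he', by simp at ht; omega, hm''⟩

end Language

/-! ### Sets and numbers -/

/-- The set of positions whose digit in `m` is `1`. -/
def decodeSet (n m : ℕ) : Finset (Fin n) := {v | m.testBit v}

theorem testBit_setCode {n : ℕ} (X : Finset (Fin n)) (v : Fin n) :
    (setCode X).testBit v = decide (v ∈ X) := by
  have h : setCode X = ∑ i ∈ X.map Fin.valEmbedding, 2 ^ i := by simp [setCode]
  rw [Bool.eq_iff_iff, decide_eq_true_iff, ← Nat.mem_bitIndices, ← List.mem_toFinset, h,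
    Finset.toFinset_bitIndices_sum_two_pow]
  simp [Fin.val_inj]

theorem setCode_lt {n : ℕ} (X : Finset (Fin n)) : setCode X < 2 ^ n := by
  have h : setCode X = ∑ i ∈ X.map Fin.valEmbedding, 2 ^ i := by simp [setCode]
  rw [h]
  exact Nat.geomSum_lt le_rfl fun k hk => by
    obtain ⟨v, -, rfl⟩ := Finset.mem_map.1 hk
    exact v.2

theorem decodeSet_setCode {n : ℕ} (X : Finset (Fin n)) : decodeSet n (setCode X) = X := by
  ext v
  simp [decodeSet, testBit_setCode]

theorem setCode_decodeSet {n m : ℕ} (h : m < 2 ^ n) : setCode (decodeSet n m) = m := by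
  apply Nat.eq_of_testBit_eq
  intro i
  by_cases hi : i < n
  · have := testBit_setCode (decodeSet n m) ⟨i, hi⟩
    simp only [decodeSet, Finset.mem_filter_univ, Bool.decide_eq_true] at this
    exact this
  · rw [Nat.testBit_lt_two_pow ((setCode_lt _).trans_le (Nat.pow_le_pow_right two_pos (by omega))),
      Nat.testBit_lt_two_pow (h.trans_le (Nat.pow_le_pow_right two_pos (by omega)))]

theorem setCode_injective {n : ℕ} : Function.Injective (setCode (n := n)) :=
  Function.LeftInverse.injective decodeSet_setCode

/-- Hence a pass through the numbers in increasing order meets proper subsets first; this is what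
the dynamic programming relies on. -/
theorem setCode_lt_of_ssubset {n : ℕ} {X Y : Finset (Fin n)} (h : X ⊂ Y) :
    setCode X < setCode Y :=
  lt_of_le_of_ne (Finset.sum_le_sum_of_subset h.1) fun e => h.ne (setCode_injective e)

theorem setCode_insert {n : ℕ} {X : Finset (Fin n)} {v : Fin n} (h : v ∉ X) :
    setCode (insert v X) = setCode X + 2 ^ (v : ℕ) := by
  rw [setCode, Finset.sum_insert h, add_comm, setCode]

theorem setCode_empty {n : ℕ} : setCode (∅ : Finset (Fin n)) = 0 := rfl

/-- One step of Horner's rule from the leading digit downwards, as in `pack`. -/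
theorem setCode_div {n : ℕ} (X : Finset (Fin n)) (v : Fin n) :
    setCode X / 2 ^ (v : ℕ) = 2 * (setCode X / 2 ^ ((v : ℕ) + 1)) + if v ∈ X then 1 else 0 := by
  have h := testBit_setCode X v
  rw [Nat.testBit_eq_decide_div_mod_eq, decide_eq_decide] at h
  rw [pow_succ, ← Nat.div_div_eq_div_mul]
  split_ifs with hv
  · have := h.2 hv; omega
  · have := mt h.1 hv; omega

/-- Splits off the leading digit of a remainder, as in `unpack`. -/
theorem mod_two_pow_succ {n m : ℕ} (v : Fin n) : m % 2 ^ ((v : ℕ) + 1) =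
    m % 2 ^ (v : ℕ) + if v ∈ decodeSet n m then 2 ^ (v : ℕ) else 0 := by
  have h : v ∈ decodeSet n m ↔ m / 2 ^ (v : ℕ) % 2 = 1 := by
    simp [decodeSet, Nat.testBit_eq_decide_div_mod_eq]
  rw [pow_succ, Nat.mod_mul]
  split_ifs with hv
  · rw [h.1 hv, mul_one]
  · have : m / 2 ^ (v : ℕ) % 2 = 0 := by have := mt h.2 hv; omega
    rw [this, mul_zero]

/-! ### Registers and arrays of the programs -/

/-- Besides `n = |V|`, `e = |E|`, the number `t` of winning pairs, the constants `one` and `zero`,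
`N = 2^n`, and the addresses `ps` and `fin` of the start and the end of the winning pairs, there are
loop counters with auxiliary registers, and registers for intermediate results. -/
inductive Reg where
  | n | e | t | one | zero | N | ps | fin
  | x | tx | u | tu | q | tq | v | tv | i | ti | j | tj
  | sg | row | tail | code | good | first | h | hu | c
  | a | d | l | m | o | p | w | y | z
  deriving DecidableEq

/-- The input; the lists of predecessors (`src`), where those of `w` start at `start[w]`; bits of
sets; degrees; a queue; marks for the winning positions; the Muller condition; and a table with
two entries for each set. -/
inductive Arr where
  | inp | start | src | inX | inB | rest | deg | queue | mark | cond | table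
  deriving DecidableEq

abbrev St := HState Reg Arr
abbrev Cd := Cmd Reg Arr

/-- The registers that are not changed after initialization have the right values. -/
structure Consts (nV nE nP : ℕ) (s : St) : Prop where
  n : s.reg .n = nV
  e : s.reg .e = nE
  t : s.reg .t = nP
  one : s.reg .one = 1
  zero : s.reg .zero = 0
  N : s.reg .N = 2 ^ nV

def Cmd.keepsConsts (p : Cd) : Bool := p.keeps [.n, .e, .t, .one, .zero, .N]

theorem Consts.of_same {n e t : ℕ} {s s' : St} {p : Cd} (h : Consts n e t s) (hs : p.Same s s')
    (hp : p.keepsConsts = true) : Consts n e t s' := by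
  simp only [Cmd.keepsConsts, Cmd.keeps, List.all_cons, List.all_nil, Bool.and_eq_true,
    Bool.not_eq_true'] at hp
  obtain ⟨h1, h2, h3, h4, h5, h6, -⟩ := hp
  exact ⟨(hs.1 _ h1).trans h.n, (hs.1 _ h2).trans h.e, (hs.1 _ h3).trans h.t,
    (hs.1 _ h4).trans h.one, (hs.1 _ h5).trans h.zero, (hs.1 _ h6).trans h.N⟩

/-- The bounds suffice for games with `n` positions, `e` edges, and listings of length `len`. -/
structure Fits (B : Bounds Arr) (n e len : ℕ) : Prop where
  n_pos : 0 < n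
  n_le_e : n ≤ e
  n_le : n ≤ B.cellMax
  e_le : e ≤ B.cellMax
  cell_le : B.cellMax ≤ B.regMax
  pow_le : 4 * 2 ^ n ≤ B.regMax
  len_le : len + 2 ≤ B.regMax
  inp : B.len .inp = len
  start : B.len .start = n + 1
  src : B.len .src = e
  inX : B.len .inX = n
  inB : B.len .inB = n
  rest : B.len .rest = n
  deg : B.len .deg = n
  queue : B.len .queue = n
  mark : B.len .mark = n
  cond : B.len .cond = 2 ^ n
  table : B.len .table = 2 * 2 ^ n

/-- The array `k` holds the characteristic function of `X`. -/
def IsBits {n : ℕ} (s : St) (k : Arr) (X : Finset (Fin n)) : Prop :=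
  ∀ v : Fin n, s.arr k v = if v ∈ X then 1 else 0

/-- A copy of a register. -/
def mov (r r' : Reg) : Cd := .add r r' .zero

/-- The loop with counter `i`. -/
abbrev forI (lim : Reg) (body : Cd) : Cd := .forUp .one .i lim .ti body

/-- `code` becomes the number of the set with bits `k`. -/
def pack (k : Arr) : Cd :=
  .const .code 0 ;; mov .y .n ;;
  forI .n (.sub .y .y .one ;; .add .code .code .code ;; .get .z k .y ;; .add .code .code .z)

/-- `k` becomes the bits of the set with number `x`. -/
def unpack (k : Arr) : Cd :=
  mov .a .x ;; mov .y .n ;;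
  forI .n (.sub .y .y .one ;; .add .a .a .a ;; .add .z .a .one ;; .sub .z .z .N ;;
    .ite .z (.sub .a .a .N ;; .set k .y .one) (.set k .y .zero))

section

variable {n e t len : ℕ} {B : Bounds Arr} {s : St}

theorem wp_pack (hB : Fits B n e len) (hs : Consts n e t s) {k : Arr} (hk : B.len k = n)
    {X : Finset (Fin n)} (hX : IsBits s k X) :
    wp B (pack k) (fun s' => s'.reg .code = setCode X ∧ s'.time ≤ s.time + 8 * n + 5) s := by
  have h1 := hB.n_le.trans hB.cell_le
  have h2 := hB.pow_le
  have h3 := setCode_lt X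
  simp only [pack, mov, wp_seq, wp_const, wp_add, HState.tick_reg, HState.setReg_reg, reduceCtorEq,
    if_false, hs.n, hs.zero]
  refine ⟨by omega, by omega, ?_⟩
  -- After `j` iterations `code` consists of the `j` leading digits.
  refine wp_forUp_time (fun j s' => s'.reg .y = n - j ∧ s'.reg .code = setCode X / 2 ^ (n - j)) 8
    (by decide) rfl ?_ ?_ ?_ ?_ ?_
  · simp [hs.one]
  · simp [hs.n, h1]
  · intro t
    simp [Nat.div_eq_of_lt h3]
  · intro j hj s' hs' hi ⟨hy, hc⟩
    simp only [HState.tick_reg, HState.setReg_reg, reduceCtorEq, if_false, hs.n] at hj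
    have ho : s'.reg .one = 1 := by rw [hs'.1 _ rfl]; simp [hs.one]
    have ha : s'.arr k = s.arr k := by rw [hs'.2 _ rfl]; simp
    have hlt : n - (j + 1) < n := by omega
    have hdiv := setCode_div X ⟨n - (j + 1), hlt⟩
    have hle := Nat.div_le_self (setCode X) (2 ^ (n - (j + 1)))
    have hb := hX ⟨n - (j + 1), hlt⟩
    simp only [show n - (j + 1) + 1 = n - j by omega] at hdiv hb
    simp only [wp_seq, wp_add, wp_sub, wp_get, HState.tick_reg, HState.setReg_reg, reduceCtorEq,
      if_false, if_true, hy, hc, ho, ha, HState.tick_arr, HState.setReg_arr, hk, hb,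
      show n - j - 1 = n - (j + 1) by omega, HState.tick_time, HState.setReg_time]
    refine ⟨by omega, by omega, by omega, by omega, by omega, fun x t => ⟨trivial, by omega⟩⟩
  · intro s' _ ht ⟨_, hc⟩
    simp only [HState.tick_reg, HState.setReg_reg, reduceCtorEq, if_false, hs.n, HState.tick_time,
      HState.setReg_time] at ht hc
    refine ⟨by simpa using hc, by omega⟩

theorem wp_unpack (hB : Fits B n e len) (hs : Consts n e t s) {k : Arr} (hk : B.len k = n)
    {m : ℕ} (hx : s.reg .x = m) (hm : m < 2 ^ n) :
    wp B (unpack k) (fun s' => IsBits s' k (decodeSet n m) ∧ s'.time ≤ s.time + 11 * n + 5) s := by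
  have h1 := hB.n_le.trans hB.cell_le
  have h0 := hB.n_le
  have hn := hB.n_pos
  have h2 := hB.pow_le
  simp only [unpack, mov, wp_seq, wp_add, HState.tick_reg, HState.setReg_reg, reduceCtorEq,
    if_false, hs.n, hs.zero, hx]
  refine ⟨by omega, by omega, ?_⟩
  -- The machine cannot halve numbers. The digits still to be read are kept shifted to the left by
  -- `j` places, so that doubling carries the next one to the place of `2 ^ n`, where a comparison
  -- with `N` detects it.
  refine wp_forUp_time (fun j s' => s'.reg .y = n - j ∧ s'.reg .a = m % 2 ^ (n - j) * 2 ^ j ∧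
    ∀ v : Fin n, n - j ≤ v → s'.arr k v = if v ∈ decodeSet n m then 1 else 0) 11
    (by decide) rfl ?_ ?_ ?_ ?_ ?_
  · simp [hs.one]
  · simp [hs.n, h1]
  · intro t
    refine ⟨by simp, by simp [Nat.mod_eq_of_lt hm], fun v hv => ?_⟩
    have := v.2
    omega
  · intro j hj s' hs' hi ⟨hy, hc, hb⟩
    simp only [HState.tick_reg, HState.setReg_reg, reduceCtorEq, if_false, hs.n] at hj
    have ho : s'.reg .one = 1 := by rw [hs'.1 _ rfl]; simp [hs.one]
    have hz : s'.reg .zero = 0 := by rw [hs'.1 _ rfl]; simp [hs.zero]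
    have hN : s'.reg .N = 2 ^ n := by rw [hs'.1 _ rfl]; simp [hs.N]
    have hlt : n - (j + 1) < n := by omega
    obtain ⟨w, hw⟩ : ∃ w : Fin n, (w : ℕ) = n - (j + 1) := ⟨⟨_, hlt⟩, rfl⟩
    have hmod := mod_two_pow_succ (m := m) w
    have hpow : 2 ^ (w : ℕ) * 2 ^ (j + 1) = 2 ^ n := by
      rw [← pow_add]; congr 1; omega
    have hltw : m % 2 ^ (w : ℕ) * 2 ^ (j + 1) < 2 ^ n := by
      rw [← hpow]
      exact Nat.mul_lt_mul_of_pos_right (Nat.mod_lt _ (by positivity)) (by positivity)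
    have hdouble : m % 2 ^ (n - j) * 2 ^ j + m % 2 ^ (n - j) * 2 ^ j =
        m % 2 ^ (w : ℕ) * 2 ^ (j + 1) + if w ∈ decodeSet n m then 2 ^ n else 0 := by
      rw [show n - j = w + 1 by omega, hmod, ← hpow]
      split_ifs <;> ring
    simp only [wp_seq, wp_add, wp_sub, wp_ite, wp_set, HState.tick_reg, HState.setReg_reg,
      reduceCtorEq, if_false, if_true, hy, hc, ho, hz, hN, HState.tick_arr, HState.setReg_arr, hk,
      show n - j - 1 = w by omega, HState.tick_time, HState.setReg_time, HState.setArr_time,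
      HState.setArr_arr, HState.setArr_reg, hdouble]
    have hset : ∀ x, x = (if w ∈ decodeSet n m then 1 else 0) → ∀ v : Fin n, n - (j + 1) ≤ v →
        Function.update (s'.arr k) w x v = if v ∈ decodeSet n m then 1 else 0 := by
      intro x hx v hv
      by_cases hvw : v = w
      · rw [hvw, Function.update_self, hx]
      · rw [Function.update_of_ne (by rwa [Ne, Fin.val_inj])]
        exact hb v (by have := mt Fin.val_inj.1 hvw; omega)
    by_cases hwm : w ∈ decodeSet n m
    · simp only [hwm, if_true] at hset ⊢
      refine ⟨by omega, by omega, by omega, by omega, ?_⟩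
      rw [if_pos (by omega)]
      refine ⟨by omega, by omega, by omega, by omega, fun x t => ⟨hw, ?_, hset _ rfl⟩⟩
      rw [← hw]; omega
    · simp only [hwm, if_false] at hset ⊢
      refine ⟨by omega, by omega, by omega, by omega, ?_⟩
      rw [if_neg (by omega)]
      refine ⟨by omega, by omega, by omega, fun x t => ⟨hw, ?_, hset _ rfl⟩⟩
      rw [← hw]; omega
  · intro s' _ ht ⟨_, _, hb⟩
    simp only [HState.tick_reg, HState.setReg_reg, reduceCtorEq, if_false, hs.n, HState.tick_time,
      HState.setReg_time, Nat.sub_self] at ht hb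
    exact ⟨fun v => hb v (Nat.zero_le _), by omega⟩

end

/-! ### Lists of edges -/

/-- The sources of the edges with target `w`. -/
def preds {n : ℕ} (es : List (Fin n × Fin n)) (w : ℕ) : List (Fin n) :=
  (es.filter fun x => x.2 = w).map Prod.fst

/-- The number of edges with target less than `w`. -/
def offset {n : ℕ} (es : List (Fin n × Fin n)) (w : ℕ) : ℕ :=
  es.countP fun x => x.2 < w

/-- If the lists of predecessors are stored one after the other, that of `w` starts at `offset es
w`. -/
theorem offset_succ {n : ℕ} (es : List (Fin n × Fin n)) (w : ℕ) :
    offset es (w + 1) = offset es w + (preds es w).length := by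
  induction es with
  | nil => rfl
  | cons x es ih =>
    simp only [offset, preds, List.countP_cons, List.filter_cons, List.length_map,
      decide_eq_true_eq] at ih ⊢
    rw [ih]
    by_cases h1 : (x.2 : ℕ) < w
    · rw [if_pos h1, if_pos (by omega), if_neg (by omega)]; omega
    · by_cases h2 : (x.2 : ℕ) = w
      · rw [if_neg h1, if_pos (by omega), if_pos h2, List.length_cons]; omega
      · rw [if_neg h1, if_neg (by omega), if_neg h2]; omega

theorem offset_zero {n : ℕ} (es : List (Fin n × Fin n)) : offset es 0 = 0 := by
  simp [offset]

theorem offset_le {n : ℕ} (es : List (Fin n × Fin n)) (w : ℕ) : offset es w ≤ es.length :=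
  List.countP_le_length

theorem offset_eq {n : ℕ} (es : List (Fin n × Fin n)) : offset es n = es.length := by
  simp [offset]

/-- This makes the time for all predecessor lists together linear in the number of edges. -/
theorem sum_length_preds {n : ℕ} (es : List (Fin n × Fin n)) :
    ∑ w : Fin n, (preds es w).length = es.length := by
  rw [← offset_eq, Fin.sum_univ_eq_sum_range (fun w => (preds es w).length)]
  suffices ∀ m, ∑ w ∈ Finset.range m, (preds es w).length = offset es m from this n
  intro m
  induction m with
  | zero => rw [offset_zero, Finset.sum_range_zero]
  | succ m ih => rw [Finset.sum_range_succ, ih, offset_succ]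

namespace Arena.ListedBy

variable {n : ℕ} {A : Arena (Fin n)} {es : List (Fin n × Fin n)} (h : A.ListedBy es)
include h

theorem nodup : es.Nodup := by
  have := A.edges.nodup
  rw [← h] at this
  exact this

theorem mem_iff {v w : Fin n} : (v, w) ∈ es ↔ A.Adj v w := by
  rw [Arena.Adj, ← Finset.mem_val, ← h, Multiset.mem_coe]

theorem length : es.length = A.edges.card := by
  rw [Finset.card, ← h, Multiset.coe_card]

theorem mem_preds {v w : Fin n} : v ∈ preds es w ↔ A.Adj v w := by
  simp only [preds, List.mem_map, List.mem_filter, decide_eq_true_eq, Fin.val_inj, ← h.mem_iff]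
  constructor
  · rintro ⟨⟨a, b⟩, ⟨h1, rfl⟩, rfl⟩; exact h1
  · exact fun h1 => ⟨_, ⟨h1, rfl⟩, rfl⟩

theorem nodup_preds (w : Fin n) : (preds es w).Nodup := by
  refine (h.nodup.filter _).map_on ?_
  rintro ⟨a, b⟩ hx ⟨c, d⟩ hy rfl
  simp only [List.mem_filter, decide_eq_true_eq] at hx hy
  rw [Prod.mk.injEq]
  exact ⟨rfl, Fin.ext (hx.2.trans hy.2.symm)⟩

open Classical in
theorem countP_eq (X : Finset (Fin n)) (u : Fin n) :
    (es.countP fun x => x.1 = u ∧ x.2 ∈ X) = ({w ∈ X | A.Adj u w} : Finset (Fin n)).card := by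
  rw [List.countP_eq_length_filter, ← List.toFinset_card_of_nodup (h.nodup.filter _)]
  refine Finset.card_bij (fun x _ => x.2) ?_ ?_ ?_
  · rintro ⟨a, b⟩ hx
    simp only [List.mem_toFinset, List.mem_filter, decide_eq_true_eq] at hx
    obtain ⟨h1, rfl, h2⟩ := hx
    simp [h2, ← h.mem_iff, h1]
  · rintro ⟨a, b⟩ hx ⟨c, d⟩ hy
    simp only [List.mem_toFinset, List.mem_filter, decide_eq_true_eq] at hx hy
    rintro rfl
    rw [hx.2.1, hy.2.1]
  · intro w hw
    simp only [Finset.mem_filter, ← h.mem_iff] at hw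
    exact ⟨(u, w), by simp [hw], rfl⟩

/-- Each position has an outgoing edge. Time `O(|V| + |E|)` is therefore `O(|E|)`. -/
theorem card_le_length : n ≤ es.length := by
  choose f hf using A.total
  have := Finset.card_le_card_of_injOn (s := Finset.univ) (t := A.edges) (fun v => (v, f v))
    (fun v _ => hf v) fun v _ w _ e => (Prod.mk.inj e).1
  rwa [Finset.card_univ, Fintype.card_fin, ← h.length] at this

end Arena.ListedBy

/-- The input array holds the listing of the arena. -/
structure HoldsArena {n : ℕ} (A : Arena (Fin n)) (es : List (Fin n × Fin n)) (s : St) : Prop where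
  owner : ∀ v : Fin n, s.arr .inp v = A.owner v
  source : ∀ k (hk : k < es.length), s.arr .inp (n + 2 * k) = (es[k]).1
  target : ∀ k (hk : k < es.length), s.arr .inp (n + 2 * k + 1) = (es[k]).2

/-- The arrays `start` and `src` hold the lists of predecessors. -/
structure HoldsPreds {n : ℕ} (es : List (Fin n × Fin n)) (s : St) : Prop where
  start : ∀ w ≤ n, s.arr .start w = offset es w
  src : ∀ w < n, ∀ j (hj : j < (preds es w).length),
    s.arr .src (offset es w + j) = (preds es w)[j]

/-! ### Attractors -/

/-- The language has no empty command; a write to the scratch register `o` replaces it. -/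
def skip : Cd := .const .o 0

/-- Removes position `a`. -/
def removePos : Cd := .set .rest .a .zero ;; .set .queue .tail .a ;; .add .tail .tail .one

/-- Treats the edge from `a := src[l + j]` to a removed position. -/
def edgeStep : Cd :=
  .add .z .l .j ;; .get .a .src .z ;; .get .z .rest .a ;;
  .ite .z
    -- Subtraction is truncated, so the sum of both differences vanishes exactly if the owner is
    -- `sg`.
    (.get .o .inp .a ;; .sub .z .o .sg ;; .sub .o .sg .o ;; .add .z .z .o ;;
      .ite .z
        (.get .d .deg .a ;; .sub .d .d .one ;; .set .deg .a .d ;; .ite .d skip removePos)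
        removePos)
    skip

/-- The attractor is computed backwards along edges, starting from the set in `inB`. The array
`rest` marks what is left of `X`, `queue` lists the removed positions in the order of their removal,
and `deg` will count the untreated edges into `X` of the remaining positions of the opponent. -/
def attrInit : Cd :=
  .const .tail 0 ;;
  forI .n (.set .deg .i .zero ;; .get .z .inB .i ;;
    .ite .z
      (.set .rest .i .zero ;; .set .queue .tail .i ;; .add .tail .tail .one)
      (.get .z .inX .i ;; .set .rest .i .z))

def attrDegrees : Cd :=
  mov .a .n ;;
  forI .e (.add .z .a .one ;; .get .y .inp .z ;; .get .z .inX .y ;;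
    .ite .z (.get .y .inp .a ;; .get .d .deg .y ;; .add .d .d .one ;; .set .deg .y .d) skip ;;
    .add .a .a .one ;; .add .a .a .one)

/-- Iteration `i` treats all edges into the `i`-th removed position. Each position is removed at
most once, so `n` iterations suffice; those beyond the end of the queue are idle. -/
def attrLoop : Cd :=
  forI .n (.sub .z .tail .i ;;
    .ite .z
      (.get .w .queue .i ;; .get .l .start .w ;; .add .w .w .one ;; .get .m .start .w ;;
        .sub .m .m .l ;; .forUp .one .j .m .tj edgeStep)
      skip)

open Classical in
/-- The successors `w` of `u` in `X` for which `T u w` does not hold. -/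
noncomputable def openSuccs {n : ℕ} (A : Arena (Fin n)) (X : Finset (Fin n))
    (T : Fin n → Fin n → Prop) (u : Fin n) : Finset (Fin n) := {w ∈ X | A.Adj u w ∧ ¬ T u w}

theorem mem_openSuccs {n : ℕ} {A : Arena (Fin n)} {X : Finset (Fin n)}
    {T : Fin n → Fin n → Prop} {u w : Fin n} :
    w ∈ openSuccs A X T u ↔ w ∈ X ∧ A.Adj u w ∧ ¬ T u w := by
  simp [openSuccs]

/-- The state during the computation of an attractor: `q` lists the positions that have been
removed, and `T u w` holds if the edge from `u` to `w` has been treated. -/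
structure AttrInv {n : ℕ} (A : Arena (Fin n)) (σ : Fin 2) (X B : Finset (Fin n)) (s : St)
    (q : List (Fin n)) (T : Fin n → Fin n → Prop) : Prop where
  nodup : q.Nodup
  tail : s.reg .tail = q.length
  queue : ∀ i (h : i < q.length), s.arr .queue i = q[i]
  rest : ∀ v : Fin n, s.arr .rest v = if v ∈ X ∧ v ∉ q then 1 else 0
  subset : ∀ v ∈ q, v ∈ X
  base : ∀ v ∈ B, v ∈ q
  attr : ∀ v ∈ q, v ∈ A.attr σ X B
  -- A treated edge would have removed `u`.
  own : ∀ u ∈ X, u ∉ q → A.owner u = σ → ∀ w, ¬ T u w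
  opp : ∀ u ∈ X, u ∉ q → A.owner u ≠ σ →
    s.arr .deg u = (openSuccs A X T u).card ∧
      -- A remaining position of the opponent has a zero counter only if it never had a successor in
      -- `X`.
      (s.arr .deg u = 0 → ∀ w ∈ X, ¬ A.Adj u w)

section

variable {n e t len : ℕ} {B : Bounds Arr} {s : St} {A : Arena (Fin n)}
  {es : List (Fin n × Fin n)} {σ : Fin 2} {X Y : Finset (Fin n)}

theorem nodup_length_le {q : List (Fin n)} (h : q.Nodup) : q.length ≤ n := by
  simpa using h.length_le_card

theorem wp_removePos (hB : Fits B n e len) (hone : s.reg .one = 1) (hzero : s.reg .zero = 0) {q : List (Fin n)}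
    (hq : q.Nodup) {u : Fin n} (hu : u ∉ q) (ha : s.reg .a = u) (ht : s.reg .tail = q.length)
    {Q : St → Prop}
    (hQ : Q ((((((s.setArr .rest u 0).tick 2).setArr .queue q.length u).tick 2).setReg .tail
      (q.length + 1)).tick 1)) : wp B removePos Q s := by
  have hlen := nodup_length_le (List.nodup_cons.2 ⟨hu, hq⟩)
  have h1 := hB.n_le.trans hB.cell_le
  have h2 := hB.n_le
  have h3 := u.2
  simp only [List.length_cons] at hlen
  simp only [removePos, wp_seq, wp_set, wp_add, HState.tick_reg, HState.setArr_reg, ha, ht, hone,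
    hzero, hB.rest, hB.queue]
  exact ⟨h3, by omega, by omega, by omega, by omega, hQ⟩

/-- The edge has not been treated before, so the counter of `u` is lowered once per edge. A position
of `σ` is removed at once, one of the opponent when its counter reaches zero. The conclusion `q <+:
q'` lets the caller go through the queue while it grows. -/
theorem wp_edgeStep (hB : Fits B n e len) (hs : Consts n e t s) (hA : HoldsArena A es s)
    (hσ : s.reg .sg = σ) (hlen : n ≤ len) {q : List (Fin n)} {T T' : Fin n → Fin n → Prop}
    (hI : AttrInv A σ X Y s q T) {u w : Fin n} (hlj : s.reg .l + s.reg .j < e)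
    (hsrc : s.arr .src (s.reg .l + s.reg .j) = u) (hw : w ∈ q) (huw : A.Adj u w) (hT : ¬ T u w)
    (hT' : ∀ u' w', T' u' w' ↔ T u' w' ∨ u' = u ∧ w' = w) (hTq : ∀ u v, T u v → v ∈ q) :
    wp B edgeStep (fun s' => s'.time ≤ s.time + 25 ∧
      ∃ q', q <+: q' ∧ AttrInv A σ X Y s' q' T') s := by
  have h1 := hB.n_le
  have h2 := hB.e_le
  have h3 := u.2
  have h4 := hB.pow_le
  have h5 : 0 < 2 ^ n := by positivity
  have h6 := hB.cell_le
  have hwX := hI.subset w hw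
  have hwA := hI.attr w hw
  have hqA : ∀ v ∈ q, v ∈ A.attr σ X Y := hI.attr
  have hcard : ∀ v, (openSuccs A X T v).card ≤ n := fun v =>
    (Finset.card_le_univ _).trans (by simp)
  -- the state after the removal of `u`
  have hrem : ∀ s' : St, s'.reg .tail = s.reg .tail → s'.arr .queue = s.arr .queue →
      s'.arr .rest = s.arr .rest → (∀ v : Fin n, v ≠ u → s'.arr .deg v = s.arr .deg v) →
      u ∈ X → u ∉ q → u ∈ A.attr σ X Y →
      AttrInv A σ X Y ((((((s'.setArr .rest u 0).tick 2).setArr .queue q.length u).tick 2).setReg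
        .tail (q.length + 1)).tick 1) (q ++ [u]) T' := by
    intro s' e1 e2 e3 e4 huX huq huA
    refine ⟨?_, by simp, ?_, ?_, ?_, ?_, ?_, ?_, ?_⟩
    · rw [List.nodup_append]
      exact ⟨hI.nodup, by simp, by simpa using fun a ha (h : a = u) => huq (h ▸ ha)⟩
    · intro i hi
      simp only [HState.tick_arr, HState.setReg_arr, HState.setArr_arr, if_true, reduceCtorEq,
        if_false, e2]
      rw [List.length_append, List.length_singleton] at hi
      by_cases hiq : i = q.length
      · subst hiq; simp
      · rw [Function.update_of_ne hiq, hI.queue i (by omega), List.getElem_append_left (by omega)]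
    · intro v
      simp only [HState.tick_arr, HState.setReg_arr, HState.setArr_arr, if_true, reduceCtorEq,
        if_false, e3]
      by_cases hvu : v = u
      · subst hvu; simp
      · rw [Function.update_of_ne (by rwa [Ne, Fin.val_inj]), hI.rest v]
        simp [hvu]
    · intro v hv
      rcases List.mem_append.1 hv with hv | hv
      · exact hI.subset v hv
      · rw [List.mem_singleton.1 hv]; exact huX
    · exact fun v hv => List.mem_append_left _ (hI.base v hv)
    · intro v hv
      rcases List.mem_append.1 hv with hv | hv
      · exact hI.attr v hv
      · rw [List.mem_singleton.1 hv]; exact huA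
    · intro v hv hvq ho w' hT
      rw [List.mem_append, not_or, List.mem_singleton] at hvq
      rcases (hT' _ _).1 hT with h | h
      · exact hI.own v hv hvq.1 ho w' h
      · exact hvq.2 h.1
    · intro v hv hvq ho
      rw [List.mem_append, not_or, List.mem_singleton] at hvq
      have := hI.opp v hv hvq.1 ho
      simp only [HState.tick_arr, HState.setReg_arr, HState.setArr_arr, reduceCtorEq, if_false,
        e4 v hvq.2]
      refine ⟨this.1.trans ?_, this.2⟩
      congr 1
      ext w'
      simp [mem_openSuccs, hT', hvq.2]
  simp only [edgeStep, wp_seq, wp_add, wp_get, wp_ite, HState.tick_reg, HState.setReg_reg,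
    reduceCtorEq, if_false, if_true, HState.tick_arr, HState.setReg_arr, hsrc, hB.src, hB.rest]
  refine ⟨by omega, hlj, h3, ?_⟩
  have hr := hI.rest u
  by_cases huq : u ∈ X ∧ u ∉ q
  · rw [if_pos huq] at hr
    simp only [hr]
    rw [if_pos one_ne_zero]
    have ho2 := (A.owner u).2
    have hσ2 := σ.2
    simp only [wp_sub, wp_seq, wp_get, wp_add, wp_ite, HState.tick_reg, HState.setReg_reg,
      reduceCtorEq, if_false, if_true, HState.tick_arr, HState.setReg_arr, hB.inp, hA.owner, hσ]
    refine ⟨by omega, by omega, by omega, by omega, ?_⟩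
    by_cases ho : A.owner u = σ
    · rw [if_neg (by simp [ho])]
      refine wp_removePos hB (by simpa using hs.one) (by simpa using hs.zero) hI.nodup huq.2
          (by simp) (by simpa using hI.tail) ?_
      · refine ⟨by simp, _, List.prefix_append _ _, hrem _ (by simp) (by simp) (by simp) (by simp)
          huq.1 huq.2 (Arena.mem_attr_of_own huq.1 ho hwX huw hwA)⟩
    · have hne : ((A.owner u : ℕ) - σ + (σ - A.owner u)) ≠ 0 := by
        intro h
        exact ho (Fin.ext (by omega))
      rw [if_pos hne]
      obtain ⟨hd1, hd2⟩ := hI.opp u huq.1 huq.2 ho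
      have hdn := hcard u
      have hmem : w ∈ (openSuccs A X T u) := by
        simp [mem_openSuccs, hwX, huw, hT]
      have hcd := Finset.card_erase_of_mem hmem
      have hpos : 0 < s.arr .deg u := by
        rw [hd1]; exact Finset.card_pos.2 ⟨w, hmem⟩
      have hers : (openSuccs A X T' u) =
          (openSuccs A X T u).erase w := by
        ext w'
        simp only [mem_openSuccs, Finset.mem_erase, hT', true_and]
        tauto
      rw [← hers, ← hd1] at hcd
      simp only [wp_set, wp_ite, HState.tick_reg, HState.setReg_reg, HState.setArr_reg,
        reduceCtorEq, if_false, if_true, hB.deg, hs.one]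
      refine ⟨h3, by omega, h3, by omega, ?_⟩
      by_cases hz : s.arr .deg u - 1 = 0
      · rw [if_neg (not_not.2 hz)]
        refine wp_removePos hB (by simpa using hs.one) (by simpa using hs.zero) hI.nodup huq.2
          (by simp) (by simpa using hI.tail) ?_
        · refine ⟨by simp, _, List.prefix_append _ _, hrem _ (by simp) (by simp) (by simp) ?_
            huq.1 huq.2 (Arena.mem_attr_of_opp huq.1 ho hwX huw ?_)⟩
          · intro v hv
            simp [Fin.val_inj, hv]
          · intro w' hw' ha
            -- The counter has reached zero, so all edges from `u` into `X` have been treated.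
            -- Treated edges lead to removed positions, and these lie in the attractor.
            rw [hz, Finset.card_eq_zero] at hcd
            by_contra hcon
            have : w' ∈ (openSuccs A X T' u) := by
              refine mem_openSuccs.2 ⟨hw', ha, fun hh => ?_⟩
              rcases (hT' _ _).1 hh with h | h
              · exact hcon (hqA w' (hTq _ _ h))
              · exact hcon (h.2 ▸ hwA)
            rw [hcd] at this
            exact absurd this (Finset.notMem_empty _)
      · rw [if_pos hz, skip, wp_const]
        refine ⟨Nat.zero_le _, by simp, q, List.prefix_rfl, ?_⟩
        refine ⟨hI.nodup, by simpa using hI.tail, by simpa using hI.queue, by simpa using hI.rest,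
          hI.subset, hI.base, hI.attr, ?_, ?_⟩
        · intro v hv hvq hov w' hh
          rcases (hT' _ _).1 hh with h | h
          · exact hI.own v hv hvq hov w' h
          · exact ho (h.1 ▸ hov)
        · intro v hv hvq hov
          by_cases hvu : v = u
          · subst hvu
            simp only [HState.tick_arr, HState.setReg_arr, HState.setArr_arr, if_true,
              Function.update_self]
            exact ⟨hcd.symm, fun h => absurd h hz⟩
          · simp only [HState.tick_arr, HState.setReg_arr, HState.setArr_arr, if_true,
              Function.update_of_ne (Fin.val_injective.ne hvu)]
            obtain ⟨h6, h7⟩ := hI.opp v hv hvq hov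
            refine ⟨h6.trans ?_, h7⟩
            congr 1
            ext w'
            simp [mem_openSuccs, hT', hvu]
  · rw [if_neg huq] at hr
    simp only [hr]
    rw [if_neg (by simp), skip, wp_const]
    refine ⟨Nat.zero_le _, by simp, q, List.prefix_rfl, ?_⟩
    refine ⟨hI.nodup, by simpa using hI.tail, by simpa using hI.queue, by simpa using hI.rest,
      hI.subset, hI.base, hI.attr, ?_, ?_⟩
    · intro v hv hvq hov w' hh
      rcases (hT' _ _).1 hh with h | h
      · exact hI.own v hv hvq hov w' h
      · exact huq ⟨h.1 ▸ hv, h.1 ▸ hvq⟩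
    · intro v hv hvq hov
      have hvu : v ≠ u := fun h => huq ⟨h ▸ hv, h ▸ hvq⟩
      obtain ⟨h6, h7⟩ := hI.opp v hv hvq hov
      simp only [HState.tick_arr, HState.setReg_arr]
      refine ⟨h6.trans ?_, h7⟩
      congr 1
      ext w'
      simp [mem_openSuccs, hT', hvu]

theorem wp_attrInit (hB : Fits B n e len) (hs : Consts n e t s) (hX : IsBits s .inX X)
    (hY : IsBits s .inB Y) :
    wp B attrInit (fun s' => s'.time ≤ s.time + 15 * n + 4 ∧ ∃ q : List (Fin n), q.Nodup ∧
      s'.reg .tail = q.length ∧ (∀ i (h : i < q.length), s'.arr .queue i = q[i]) ∧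
      (∀ v, v ∈ q ↔ v ∈ Y) ∧ ∀ v : Fin n, s'.arr .rest v = (if v ∈ X ∧ v ∉ Y then 1 else 0) ∧
        s'.arr .deg v = 0) s := by
  have h1 := hB.n_le
  have h2 := hB.cell_le
  have h3 := hB.n_pos
  simp only [attrInit, wp_seq, wp_const]
  refine ⟨Nat.zero_le _, ?_⟩
  refine wp_forUp_time (fun k s' => ∃ q : List (Fin n), q.Nodup ∧
      s'.reg .tail = q.length ∧ (∀ i (h : i < q.length), s'.arr .queue i = q[i]) ∧
      (∀ v, v ∈ q ↔ v ∈ Y ∧ (v : ℕ) < k) ∧ ∀ v : Fin n, (v : ℕ) < k →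
        s'.arr .rest v = (if v ∈ X ∧ v ∉ Y then 1 else 0) ∧ s'.arr .deg v = 0) 15
    (by decide) rfl ?_ ?_ ?_ ?_ ?_
  · simp [hs.one]
  · simp [hs.n, h1.trans h2]
  · intro t
    exact ⟨[], by simp⟩
  · rintro k hk s' hs' hi ⟨q, hq1, hq2, hq3, hq4, hq5⟩
    simp only [HState.tick_reg, HState.setReg_reg, reduceCtorEq, if_false, hs.n] at hk
    have ho : s'.reg .one = 1 := by rw [hs'.1 _ rfl]; simp [hs.one]
    have hz : s'.reg .zero = 0 := by rw [hs'.1 _ rfl]; simp [hs.zero]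
    have hX' := hX ⟨k, hk⟩
    have hY' := hY ⟨k, hk⟩
    have eX : s'.arr .inX = s.arr .inX := by rw [hs'.2 _ rfl]; simp
    have eY : s'.arr .inB = s.arr .inB := by rw [hs'.2 _ rfl]; simp
    have hkq : (⟨k, hk⟩ : Fin n) ∉ q := by simp [hq4]
    have hlen := nodup_length_le (List.nodup_cons.2 ⟨hkq, hq1⟩)
    rw [List.length_cons] at hlen
    simp only [wp_seq, wp_set, wp_get, wp_ite, wp_add, HState.tick_reg, HState.setReg_reg,
      HState.setArr_reg, reduceCtorEq, if_false, if_true, hi, ho, hz, hB.deg, hB.inB, hB.rest,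
      hB.queue, hB.inX, HState.tick_arr, HState.setReg_arr, HState.setArr_arr, eX, eY, hX', hY',
      hq2, HState.tick_time, HState.setReg_time, HState.setArr_time]
    refine ⟨hk, Nat.zero_le _, hk, ?_⟩
    by_cases hkY : (⟨k, hk⟩ : Fin n) ∈ Y
    · rw [if_pos (by simp [hkY])]
      refine ⟨hk, Nat.zero_le _, by omega, by omega, by omega, by omega, fun x t =>
        ⟨q ++ [⟨k, hk⟩], ?_, by simp, ?_, ?_, ?_⟩⟩
      · rw [List.nodup_append]
        exact ⟨hq1, by simp, fun a ha b hb h => hkq (List.mem_singleton.1 hb ▸ h ▸ ha)⟩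
      · intro i hi
        rw [List.length_append, List.length_singleton] at hi
        by_cases hiq : i = q.length
        · subst hiq; simp
        · rw [Function.update_of_ne hiq, hq3 i (by omega), List.getElem_append_left (by omega)]
      · intro v
        rw [List.mem_append, hq4, List.mem_singleton, Fin.ext_iff]
        constructor
        · rintro (h | h)
          · exact ⟨h.1, by omega⟩
          · obtain rfl : v = ⟨k, hk⟩ := Fin.ext h
            exact ⟨hkY, by simp⟩
        · rintro ⟨h4, h5⟩
          dsimp only
          by_cases h : (v : ℕ) = k
          · exact .inr h
          · exact .inl ⟨h4, by omega⟩
      · intro v hv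
        by_cases h : (v : ℕ) = k
        · obtain rfl : v = ⟨k, hk⟩ := Fin.ext h
          simp [hkY]
        · rw [Function.update_of_ne h, Function.update_of_ne h]
          exact hq5 v (by omega)
    · rw [if_neg (by simp [hkY])]
      refine ⟨hk, hk, by split_ifs <;> omega, by omega, fun x t =>
        ⟨q, hq1, rfl, hq3, ?_, ?_⟩⟩
      · intro v
        rw [hq4]
        constructor
        · exact fun h => ⟨h.1, by omega⟩
        · rintro ⟨h4, h5⟩
          have : (v : ℕ) ≠ k := by
            rintro rfl
            exact hkY h4
          exact ⟨h4, by omega⟩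
      · intro v hv
        by_cases h : (v : ℕ) = k
        · obtain rfl : v = ⟨k, hk⟩ := Fin.ext h
          simp [hkY]
        · rw [Function.update_of_ne h, Function.update_of_ne h]
          exact hq5 v (by omega)
  · rintro s' hs' ht ⟨q, hq1, hq2, hq3, hq4, hq5⟩
    simp only [HState.tick_reg, HState.setReg_reg, reduceCtorEq, if_false, hs.n, HState.tick_time,
      HState.setReg_time] at ht hq4 hq5
    exact ⟨by omega, q, hq1, hq2, hq3, fun v => by simp [hq4], fun v => hq5 v v.2⟩

theorem wp_attrDegrees (hB : Fits B n e len) (hs : Consts n e t s) (hA : HoldsArena A es s)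
    (he : es.length = e) (hlen : n + 2 * e ≤ len) (hX : IsBits s .inX X)
    (hdeg : ∀ v : Fin n, s.arr .deg v = 0) :
    wp B attrDegrees (fun s' => s'.time ≤ s.time + 18 * e + 4 ∧
      ∀ u : Fin n, s'.arr .deg u = es.countP fun x => x.1 = u ∧ x.2 ∈ X) s := by
  have h1 := hB.e_le
  have h2 := hB.cell_le
  have h3 := hB.len_le
  have h4 := hB.n_pos
  simp only [attrDegrees, mov, wp_seq, wp_add, hs.n, hs.zero]
  refine ⟨by omega, ?_⟩
  refine wp_forUp_time (fun k s' => s'.reg .a = n + 2 * k ∧ ∀ u : Fin n, s'.arr .deg u =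
    (es.take k).countP fun x => x.1 = u ∧ x.2 ∈ X) 18 (by decide) rfl ?_ ?_ ?_ ?_ ?_
  · simp [hs.one]
  · simp [hs.e, h1.trans h2]
  · intro t
    simpa using hdeg
  · rintro k hk s' hs' hi ⟨ha, hd⟩
    simp only [HState.tick_reg, HState.setReg_reg, reduceCtorEq, if_false, hs.e] at hk
    have hke : k < es.length := by omega
    have ho : s'.reg .one = 1 := by rw [hs'.1 _ rfl]; simp [hs.one]
    have eX : s'.arr .inX = s.arr .inX := by rw [hs'.2 _ rfl]; simp
    have eI : s'.arr .inp = s.arr .inp := by rw [hs'.2 _ rfl]; simp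
    have hX' := hX (es[k]).2
    have hle : (es.take k).countP (fun x => x.1 = (es[k]).1 ∧ x.2 ∈ X) ≤ k :=
      List.countP_le_length.trans (by simp)
    have hsucc : ∀ u, (es.take (k + 1)).countP (fun x => x.1 = u ∧ x.2 ∈ X) =
        (es.take k).countP (fun x => x.1 = u ∧ x.2 ∈ X) +
          if (es[k]).1 = u ∧ (es[k]).2 ∈ X then 1 else 0 := by
      intro u
      rw [List.take_succ_eq_append_getElem hke, List.countP_append]
      simp [List.countP_cons]
    simp only [wp_seq, wp_set, wp_get, wp_ite, wp_add, HState.tick_reg, HState.setReg_reg,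
      HState.setArr_reg, reduceCtorEq, if_false, if_true, ho, hB.deg, hB.inX, hB.inp, ha,
      HState.tick_arr, HState.setReg_arr, HState.setArr_arr, eX, eI, hX', hA.target k hke,
      hA.source k hke, hd, HState.tick_time, HState.setReg_time, HState.setArr_time, skip, wp_const]
    refine ⟨by omega, by omega, (es[k]).2.2, ?_⟩
    by_cases hkX : (es[k]).2 ∈ X
    · rw [if_pos (by simp [hkX])]
      refine ⟨by omega, (es[k]).1.2, by omega, (es[k]).1.2, by omega, by omega, by omega, by omega,
        fun x t => ⟨by omega, fun u => ?_⟩⟩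
      rw [hsucc]
      by_cases hu : (es[k]).1 = u
      · simp [hu, hkX]
      · rw [Function.update_of_ne (by rw [Ne, Fin.val_inj]; exact Ne.symm hu), hd]
        simp [hu]
    · rw [if_neg (by simp [hkX])]
      refine ⟨by omega, by omega, by omega, by omega, fun x t => ⟨by omega, fun u => ?_⟩⟩
      rw [hsucc]
      simp [hkX]
  · rintro s' hs' ht ⟨_, hd⟩
    simp only [HState.tick_reg, HState.setReg_reg, reduceCtorEq, if_false, hs.e, HState.tick_time,
      HState.setReg_time] at ht hd
    refine ⟨by omega, fun u => ?_⟩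
    rw [hd, List.take_of_length_le (by omega)]

theorem wp_attrLoop (hB : Fits B n e len) (hs : Consts n e t s) (hA : HoldsArena A es s)
    (hes : A.ListedBy es) (hP : HoldsPreds es s) (he : es.length = e) (hlen : n ≤ len)
    (hσ : s.reg .sg = σ) {q : List (Fin n)} (hI : AttrInv A σ X Y s q fun _ _ => False) :
    wp B attrLoop (fun s' => s'.time ≤ s.time + 20 * n + 28 * e + 3 ∧ ∃ q : List (Fin n),
      AttrInv A σ X Y s' q fun u w => A.Adj u w ∧ w ∈ q) s := by
  have h1 := hB.n_le
  have h2 := hB.cell_le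
  have h3 := hB.n_pos
  have h4 := hB.e_le
  have h5 := hB.len_le
  -- The treated edges are those into the first `k` removed positions. The time is constant per
  -- iteration plus `28` per treated predecessor; a uniform bound per iteration would be too large.
  refine wp_forUp (fun k s' => ∃ q : List (Fin n),
    s'.time ≤ s.time + 20 * k + 28 * ((q.take k).map fun w : Fin n => (preds es w).length).sum + 3 ∧
    AttrInv A σ X Y s' q fun u w => A.Adj u w ∧ w ∈ q.take k) (by decide) rfl hs.one
    (by rw [hs.n]; omega) ?_ ?_ ?_
  · refine ⟨q, by simp, ?_⟩
    obtain ⟨i1, i2, i3, i4, i5, i6, i7, i8, i9⟩ := hI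
    refine ⟨i1, by simpa using i2, by simpa using i3, by simpa using i4, i5, i6, i7, ?_, ?_⟩
    · simp
    · simpa using i9
  · rintro k hk s' hs' hi ⟨q, ht, hI⟩
    rw [hs.n] at hk
    have hs₁ := hs.of_same hs' rfl
    have eS : s'.arr .start = s.arr .start := hs'.2 _ rfl
    have eC : s'.arr .src = s.arr .src := hs'.2 _ rfl
    have eP : s'.arr .inp = s.arr .inp := hs'.2 _ rfl
    have eG : s'.reg .sg = s.reg .sg := hs'.1 _ rfl
    simp only [wp_seq, wp_sub, wp_ite, HState.tick_reg, HState.setReg_reg, if_true, hI.tail, hi]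
    refine ⟨by have := nodup_length_le hI.nodup; omega, ?_⟩
    by_cases hkq : k < q.length
    · rw [if_pos (by omega)]
      have hq := hI.queue k hkq
      have hoff := offset_le es (q[k] : ℕ)
      have hoff' := offset_le es ((q[k] : ℕ) + 1)
      have hsucc := offset_succ es (q[k] : ℕ)
      have hqk := (q[k]).2
      simp only [wp_seq, wp_get, wp_add, wp_sub, HState.tick_reg, HState.setReg_reg, reduceCtorEq,
        if_false, if_true, HState.tick_arr, HState.setReg_arr, hB.queue, hB.start, hi, hq, hs₁.one,
        eS, hP.start (q[k]) (by omega), hP.start ((q[k] : ℕ) + 1) (by omega)]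
      refine ⟨hk, by omega, by omega, by omega, by omega, ?_⟩
      set w := q[k] with hw
      set s₁ := ((((((((((((HState.setReg s' .z (q.length - k)).tick 1).tick 1).setReg .w w).tick
        2).setReg .l (offset es w)).tick 2).setReg .w (w + 1)).tick 1).setReg .m
        (offset es (w + 1))).tick 2).setReg .m (offset es (w + 1) - offset es w)).tick 1 with hs₁'
      have hm : s₁.reg .m = (preds es w).length := by
        simp [hs₁', hsucc]
      have hpl : (preds es w).length ≤ n := nodup_length_le (hes.nodup_preds w)
      have hst : s₁.time = s'.time + 10 := by simp [hs₁']
      have hIs : AttrInv A σ X Y s₁ q fun u w => A.Adj u w ∧ w ∈ q.take k := by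
        obtain ⟨i1, i2, i3, i4, i5, i6, i7, i8, i9⟩ := hI
        exact ⟨i1, by simpa [hs₁'] using i2, i3, i4, i5, i6, i7, i8, i9⟩
      have hwk : w ∉ q.take k := by
        rw [List.mem_take_iff_getElem]
        rintro ⟨i, hi, e⟩
        have := (List.Nodup.getElem_inj_iff hI.nodup).1 e
        omega
      have hwq : w ∈ q := List.getElem_mem hkq
      -- Appending to the queue does not affect its first `k + 1` entries.
      have hfin : ∀ q' : List (Fin n), q <+: q' → q'.take (k + 1) = q.take k ++ [w] := by
        intro q' hq'
        rw [← List.take_succ_eq_append_getElem hkq]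
        obtain ⟨r, rfl⟩ := hq'
        rw [List.take_append_of_le_length (by omega)]
      refine wp_forUp_time (fun j s' => ∃ q', q <+: q' ∧ AttrInv A σ X Y s' q' fun u v =>
        (A.Adj u v ∧ v ∈ q.take k) ∨ v = w ∧ u ∈ (preds es w).take j) 28
        (by decide) rfl ?_ ?_ ?_ ?_ ?_
      · simp [hs₁', hs₁.one]
      · rw [hm]; omega
      · intro t
        refine ⟨q, List.prefix_rfl, ?_⟩
        obtain ⟨i1, i2, i3, i4, i5, i6, i7, i8, i9⟩ := hIs
        exact ⟨i1, by simpa using i2, by simpa using i3, by simpa using i4, i5, i6, i7,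
          by simpa using i8, by simpa using i9⟩
      · rintro j hj s₂ hs₂ hij ⟨q', hqq', hI'⟩
        rw [hm] at hj
        have e1 : s₂.arr .src = s.arr .src := by rw [hs₂.2 _ rfl]; simp [hs₁', eC]
        have e2 : s₂.arr .inp = s.arr .inp := by rw [hs₂.2 _ rfl]; simp [hs₁', eP]
        have e3 : s₂.reg .sg = s.reg .sg := by rw [hs₂.1 _ rfl]; simp [hs₁', eG]
        have e4 : s₂.reg .l = offset es w := by rw [hs₂.1 _ rfl]; simp [hs₁']
        have hc₂ : Consts n e t s₂ := by
          refine Consts.of_same ?_ hs₂ rfl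
          exact ⟨by simp [hs₁', hs₁.n], by simp [hs₁', hs₁.e], by simp [hs₁', hs₁.t],
            by simp [hs₁', hs₁.one], by simp [hs₁', hs₁.zero], by simp [hs₁', hs₁.N]⟩
        refine (wp_edgeStep hB hc₂ ⟨by simpa [e2] using hA.owner, by simpa [e2] using hA.source,
          by simpa [e2] using hA.target⟩ (e3.trans hσ) hlen hI' (u := (preds es w)[j]) (w := w)
          (T' := fun u v => (A.Adj u v ∧ v ∈ q.take k) ∨ v = w ∧ u ∈ (preds es w).take (j + 1))
          ?_ ?_ (hqq'.subset hwq) (hes.mem_preds.1 (List.getElem_mem hj)) ?_ ?_ ?_).mono ?_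
        · rw [e4, hij]; omega
        · rw [e4, hij, e1, hP.src w w.2 j hj]
        · rintro (⟨-, h⟩ | ⟨-, h⟩)
          · exact hwk h
          · rw [List.mem_take_iff_getElem] at h
            obtain ⟨i, hi, e⟩ := h
            have := (List.Nodup.getElem_inj_iff (hes.nodup_preds w)).1 e
            omega
        · intro u' w'
          rw [List.take_succ_eq_append_getElem hj, List.mem_append, List.mem_singleton]
          tauto
        · rintro u v (⟨-, h⟩ | ⟨rfl, -⟩)
          · exact hqq'.subset (List.mem_of_mem_take h)
          · exact hqq'.subset hwq
        · rintro s₃ _ ⟨ht₃, q'', hq'', hI''⟩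
          refine ⟨by omega, fun x t => ⟨q'', hqq'.trans hq'', ?_⟩⟩
          obtain ⟨i1, i2, i3, i4, i5, i6, i7, i8, i9⟩ := hI''
          exact ⟨i1, by simpa using i2, by simpa using i3, by simpa using i4, i5, i6, i7,
            by simpa using i8, by simpa using i9⟩
      · rintro s₂ hs₂ ht₂ ⟨q', hqq', hI'⟩
        rw [hm] at ht₂
        refine ⟨q', ?_, ?_⟩
        · rw [hfin q' hqq']
          have : (q'.take k) = q.take k := by
            obtain ⟨r, rfl⟩ := hqq'
            rw [List.take_append_of_le_length (by omega)]
          simp only [HState.tick_time, HState.setReg_time, List.map_append, List.sum_append,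
            List.map_cons, List.map_nil, List.sum_cons, List.sum_nil]
          omega
        · have hT : (fun u v => A.Adj u v ∧ v ∈ q'.take (k + 1)) = fun u v =>
              (A.Adj u v ∧ v ∈ q.take k) ∨ v = w ∧ u ∈ (preds es w).take (s₁.reg .m) := by
            funext u v
            rw [hfin q' hqq', hm, List.take_length, hes.mem_preds, List.mem_append,
              List.mem_singleton, eq_iff_iff]
            constructor
            · rintro ⟨ha, h | rfl⟩
              · exact .inl ⟨ha, h⟩
              · exact .inr ⟨rfl, ha⟩
            · rintro (h | ⟨rfl, h⟩)
              · exact ⟨h.1, .inl h.2⟩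
              · exact ⟨h, .inr rfl⟩
          rw [hT]
          obtain ⟨i1, i2, i3, i4, i5, i6, i7, i8, i9⟩ := hI'
          exact ⟨i1, by simpa using i2, by simpa using i3, by simpa using i4, i5, i6, i7,
            by simpa using i8, by simpa using i9⟩
    · rw [if_neg (by omega), skip, wp_const]
      rw [List.take_of_length_le (by omega)] at hI ht
      refine ⟨Nat.zero_le _, q, ?_, ?_⟩
      · rw [List.take_of_length_le (by omega)]
        simp only [HState.tick_time, HState.setReg_time]
        omega
      · rw [List.take_of_length_le (by omega)]
        obtain ⟨i1, i2, i3, i4, i5, i6, i7, i8, i9⟩ := hI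
        exact ⟨i1, by simpa using i2, by simpa using i3, by simpa using i4, i5, i6, i7,
          by simpa using i8, by simpa using i9⟩
  · rintro s' hs' ⟨q, ht, hI⟩
    rw [hs.n] at ht hI
    have := nodup_length_le hI.nodup
    rw [List.take_of_length_le (by omega)] at hI ht
    refine ⟨?_, q, hI⟩
    -- The queue has no repetitions, so each edge is counted at most once.
    have hsum : (q.map fun w : Fin n => (preds es w).length).sum ≤ e := by
      rw [← List.sum_toFinset _ hI.nodup, ← he, ← sum_length_preds es]
      exact Finset.sum_le_sum_of_subset (Finset.subset_univ _)
    omega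

/-- `rest` becomes the trap for Player `sg` in `inX` that belongs to `inB`. -/
def trapProg : Cd := attrInit ;; attrDegrees ;; attrLoop

theorem HoldsArena.of_eq {s s' : St} (h : HoldsArena A es s) (e : s'.arr .inp = s.arr .inp) :
    HoldsArena A es s' :=
  ⟨fun v => e ▸ h.owner v, fun k hk => e ▸ h.source k hk, fun k hk => e ▸ h.target k hk⟩

theorem HoldsPreds.of_eq {s s' : St} (h : HoldsPreds es s) (e : s'.arr .start = s.arr .start)
    (e' : s'.arr .src = s.arr .src) : HoldsPreds es s' :=
  ⟨fun w hw => e ▸ h.start w hw, fun w hw j hj => e' ▸ h.src w hw j hj⟩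

theorem IsBits.of_eq {s s' : St} {k : Arr} (h : IsBits s k X) (e : s'.arr k = s.arr k) :
    IsBits s' k X := fun v => e ▸ h v

theorem wp_trapProg (hB : Fits B n e len) (hs : Consts n e t s) (hA : HoldsArena A es s)
    (hes : A.ListedBy es) (hP : HoldsPreds es s) (he : es.length = e) (hlen : n + 2 * e ≤ len)
    (hσ : s.reg .sg = σ) (hX : IsBits s .inX X) (hY : IsBits s .inB Y) (hYX : Y ⊆ X) :
    wp B trapProg (fun s' => s'.time ≤ s.time + 92 * e ∧ IsBits s' .rest (A.trap σ X Y)) s := by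
  rw [trapProg, wp_seq]
  refine (wp_attrInit hB hs hX hY).mono ?_
  rintro s₁ hs₁ ⟨ht₁, q, i1, i2, i3, i4, i5⟩
  have hc₁ := hs.of_same hs₁ rfl
  have hA₁ := hA.of_eq (hs₁.2 _ rfl)
  rw [wp_seq]
  refine (wp_attrDegrees hB hc₁ hA₁ he hlen (hX.of_eq (hs₁.2 _ rfl)) fun v => (i5 v).2).mono ?_
  rintro s₂ hs₂ ⟨ht₂, hd⟩
  have hc₂ := hc₁.of_same hs₂ rfl
  have hT : ∀ u, openSuccs A X (fun _ _ => False) u =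
      @Finset.filter _ (fun w => A.Adj u w) (Classical.decPred _) X := by
    intro u
    ext w
    simp [mem_openSuccs]
  have hI : AttrInv A σ X Y s₂ q fun _ _ => False := by
    refine ⟨i1, ?_, ?_, ?_, fun v hv => hYX ((i4 v).1 hv), fun v hv => (i4 v).2 hv,
      fun v hv => Arena.subset_attr ((i4 v).1 hv), fun _ _ _ _ _ h => h, ?_⟩
    · rw [hs₂.1 _ rfl, i2]
    · rw [hs₂.2 _ rfl]; exact i3
    · rw [hs₂.2 _ rfl]
      intro v
      rw [(i5 v).1]
      simp only [i4]
    · intro u hu huq ho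
      have hdu : s₂.arr .deg u = (openSuccs A X (fun _ _ => False) u).card := by
        rw [hd, hes.countP_eq, hT]
      refine ⟨hdu, fun h w hw ha => ?_⟩
      rw [hdu, Finset.card_eq_zero] at h
      have : w ∈ openSuccs A X (fun _ _ => False) u := mem_openSuccs.2 ⟨hw, ha, fun h => h⟩
      rw [h] at this
      exact Finset.notMem_empty _ this
  refine (wp_attrLoop hB hc₂ (hA₁.of_eq (hs₂.2 _ rfl)) hes
    ((hP.of_eq (hs₁.2 _ rfl) (hs₁.2 _ rfl)).of_eq (hs₂.2 _ rfl) (hs₂.2 _ rfl)) he (by omega) ?_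
    hI).mono ?_
  · rw [hs₂.1 _ rfl, hs₁.1 _ rfl, hσ]
  rintro s₃ hs₃ ⟨ht₃, q', hI'⟩
  have h1 := hB.n_le_e
  have h2 := hB.n_pos
  -- The three parts take at most `35 n + 46 e + 11` steps, and `1 ≤ n ≤ e`.
  refine ⟨by omega, ?_⟩
  -- Removed positions lie in the attractor by the invariant. Conversely, all edges into them have
  -- been treated, so `own` and `opp` show that they are closed under the rules of the attractor.
  have hq : ∀ v, v ∈ q' ↔ v ∈ A.attr σ X Y := by
    intro v
    refine ⟨hI'.attr v, fun h => ?_⟩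
    have := Arena.attr_subset (A := A) (σ := σ) (X := X) (B := Y) (Q := q'.toFinset) ?_ ?_ ?_ h
    · exact List.mem_toFinset.1 this
    · exact fun v hv => List.mem_toFinset.2 (hI'.base v hv)
    · intro v hv ho w hw ha hwq
      rw [List.mem_toFinset] at hwq ⊢
      by_contra hcon
      exact hI'.own v hv hcon ho w ⟨ha, hwq⟩
    · intro v hv ho w hw ha hall
      rw [List.mem_toFinset]
      by_contra hcon
      obtain ⟨h3, h4⟩ := hI'.opp v hv hcon ho
      refine h4 ?_ w hw ha
      rw [h3, Finset.card_eq_zero, Finset.eq_empty_iff_forall_notMem]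
      intro x hx
      obtain ⟨hx1, hx2, hx3⟩ := mem_openSuccs.1 hx
      exact hx3 ⟨hx2, List.mem_toFinset.1 (hall x hx1 hx2)⟩
  intro v
  rw [hI'.rest v]
  simp only [Arena.trap, Finset.mem_sdiff, hq]

end

/-! ### Lists of predecessors -/

def predsBody : Cd :=
  .add .z .a .one ;; .get .y .inp .z ;; .sub .z .y .v ;; .sub .y .v .y ;; .add .z .z .y ;;
  .ite .z skip (.get .y .inp .a ;; .set .src .p .y ;; .add .p .p .one) ;;
  .add .a .a .one ;; .add .a .a .one

/-- Computes the lists of predecessors. -/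
def predsProg : Cd :=
  .const .p 0 ;;
  .forUp .one .v .n .tv (.set .start .v .p ;; mov .a .n ;; forI .e predsBody) ;;
  .set .start .n .p

theorem offset_mono {n : ℕ} (es : List (Fin n × Fin n)) : Monotone (offset es) :=
  monotone_nat_of_le_succ fun w => by rw [offset_succ]; omega

theorem preds_take_succ {n : ℕ} (es : List (Fin n × Fin n)) (w : ℕ) {j : ℕ} (hj : j < es.length) :
    preds (es.take (j + 1)) w =
      preds (es.take j) w ++ if ((es[j]).2 : ℕ) = w then [(es[j]).1] else [] := by
  rw [List.take_succ_eq_append_getElem hj]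
  simp only [preds, List.filter_append, List.map_append]
  congr 1
  by_cases h : ((es[j]).2 : ℕ) = w <;> simp [h]

theorem length_preds_take_le {n : ℕ} (es : List (Fin n × Fin n)) (w j : ℕ) :
    (preds (es.take j) w).length ≤ (preds es w).length := by
  simp only [preds, List.length_map]
  exact ((List.take_sublist j es).filter _).length_le

section

variable {n e t len : ℕ} {B : Bounds Arr} {s : St} {A : Arena (Fin n)}
  {es : List (Fin n × Fin n)} {σ : Fin 2} {X Y : Finset (Fin n)}

/-- The edge list is scanned once for each target. The resulting `O(n e)` is harmless, because the
lists are computed only once. -/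
theorem wp_predsProg (hB : Fits B n e len) (hs : Consts n e t s) (hA : HoldsArena A es s)
    (he : es.length = e) (hlen : n + 2 * e ≤ len) :
    wp B predsProg (fun s' => s'.time ≤ s.time + 40 * (n * e) ∧ HoldsPreds es s') s := by
  have h1 := hB.n_le
  have h2 := hB.cell_le
  have h3 := hB.n_pos
  have h4 := hB.e_le
  have h5 := hB.len_le
  have h6 := hB.n_le_e
  simp only [predsProg, wp_seq, wp_const]
  refine ⟨Nat.zero_le _, ?_⟩
  refine wp_forUp_time (fun k s' => s'.reg .p = offset es k ∧
    (∀ w < k, s'.arr .start w = offset es w) ∧ ∀ w < k, ∀ j (hj : j < (preds es w).length),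
      s'.arr .src (offset es w + j) = (preds es w)[j]) (17 * e + 9) (by decide) rfl ?_ ?_ ?_ ?_ ?_
  · simp [hs.one]
  · simp [hs.n, h1.trans h2]
  · intro t
    refine ⟨by simp [offset_zero], fun w hw => absurd hw (Nat.not_lt_zero w),
      fun w hw => absurd hw (Nat.not_lt_zero w)⟩
  · rintro k hk s₁ hs₁ hi ⟨hp, hst, hsr⟩
    have hc₁ : Consts n e t s₁ :=
      Consts.of_same (s := (s.setReg .p 0).tick 1) ⟨by simp [hs.n], by simp [hs.e], by simp [hs.t],
        by simp [hs.one], by simp [hs.zero], by simp [hs.N]⟩ hs₁ rfl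
    have eI : s₁.arr .inp = s.arr .inp := by rw [hs₁.2 _ rfl]; simp
    simp only [HState.tick_reg, HState.setReg_reg, reduceCtorEq, if_false, hs.n] at hk
    have hoff := offset_le es k
    simp only [mov, wp_seq, wp_set, wp_add, HState.tick_reg, HState.setArr_reg, hi, hp, hc₁.n,
      hc₁.zero, hB.start]
    refine ⟨by omega, by omega, by omega, ?_⟩
    refine wp_forUp_time (fun j s' => s'.reg .a = n + 2 * j ∧
      s'.reg .p = offset es k + (preds (es.take j) k).length ∧
      (∀ w < k, ∀ j (hj : j < (preds es w).length),
        s'.arr .src (offset es w + j) = (preds es w)[j]) ∧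
      ∀ i (hi : i < (preds (es.take j) k).length),
        s'.arr .src (offset es k + i) = (preds (es.take j) k)[i]) 17 (by decide) rfl ?_ ?_ ?_ ?_ ?_
    · simp [hc₁.one]
    · simp [hc₁.e, h4.trans h2]
    · intro t
      refine ⟨by simp, by simp [preds, hp], by simpa using hsr, by simp [preds]⟩
    · rintro j hj s₂ hs₂ hij ⟨ha, hp₂, hold, hnew⟩
      simp only [HState.tick_reg, HState.setReg_reg, HState.setArr_reg, reduceCtorEq, if_false,
        hc₁.e] at hj
      have hje : j < es.length := by omega
      have eI₂ : s₂.arr .inp = s.arr .inp := by rw [hs₂.2 _ rfl]; simp [eI]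
      have ho : s₂.reg .one = 1 := by rw [hs₂.1 _ rfl]; simp [hc₁.one]
      have hv : s₂.reg .v = k := by rw [hs₂.1 _ rfl]; simp [hi]
      have hle := length_preds_take_le es k (j + 1)
      have hsucc := offset_succ es k
      have hoff' := offset_le es (k + 1)
      have htk := preds_take_succ es k hje
      have h7 := (es[j]).1.2
      have h8 := (es[j]).2.2
      simp only [predsBody, wp_seq, wp_add, wp_get, wp_sub, wp_ite, wp_set, skip, wp_const,
        HState.tick_reg, HState.setReg_reg, HState.setArr_reg, reduceCtorEq, if_false, if_true,
        HState.tick_arr, HState.setReg_arr, HState.setArr_arr, HState.tick_time,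
        HState.setReg_time, HState.setArr_time, ha, ho, hv, hp₂, eI₂, hA.target j hje,
        hA.source j hje, hB.inp, hB.src]
      refine ⟨by omega, by omega, by omega, by omega, by omega, ?_⟩
      by_cases hjk : ((es[j]).2 : ℕ) = k
      · rw [if_pos hjk] at htk
        rw [if_neg (by omega)]
        have hl : (preds (es.take (j + 1)) k).length = (preds (es.take j) k).length + 1 := by
          rw [htk]; simp
        refine ⟨by omega, by omega, by omega, by omega, by omega, by omega, by omega,
          fun x t => ⟨by omega, by omega, ?_, ?_⟩⟩
        · intro w hw i hi'
          have := offset_succ es w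
          have := offset_mono es (show w + 1 ≤ k from hw)
          rw [Function.update_of_ne (by omega)]
          exact hold w hw i hi'
        · intro i hi'
          by_cases hil : i = (preds (es.take j) k).length
          · subst hil
            simp [htk]
          · rw [Function.update_of_ne (by omega), hnew i (by omega)]
            simp only [htk]
            rw [List.getElem_append_left]
      · rw [if_neg hjk, List.append_nil] at htk
        rw [if_pos (by omega)]
        exact ⟨by omega, by omega, by omega, by omega, fun x t => ⟨by omega, by rw [htk], hold,
          by simpa only [htk] using hnew⟩⟩
    · rintro s₂ hs₂ ht₂ ⟨-, hp₂, hold, hnew⟩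
      simp only [HState.tick_reg, HState.setReg_reg, HState.setArr_reg, reduceCtorEq, if_false,
        hc₁.e, HState.tick_time, HState.setReg_time, HState.setArr_time] at ht₂ hp₂ hnew
      simp only [← he, List.take_length] at hp₂ hnew
      have eS : s₂.arr .start = Function.update (s₁.arr .start) k (offset es k) := by
        rw [hs₂.2 _ rfl]; simp
      refine ⟨by omega, fun x t => ⟨?_, ?_, ?_⟩⟩
      · simp [hp₂, offset_succ]
      · intro w hw
        simp only [HState.tick_arr, HState.setReg_arr, eS]
        by_cases hwk : w = k
        · rw [hwk, Function.update_self]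
        · rw [Function.update_of_ne hwk, hst w (by omega)]
      · intro w hw
        by_cases hwk : w = k
        · subst hwk; exact hnew
        · exact hold w (by omega)
  · rintro s₁ hs₁ ht₁ ⟨hp, hst, hsr⟩
    simp only [HState.tick_reg, HState.setReg_reg, reduceCtorEq, if_false, hs.n,
      HState.tick_time, HState.setReg_time] at ht₁ hp hst hsr
    have hn₁ : s₁.reg .n = n := by rw [hs₁.1 _ rfl]; simp [hs.n]
    have hoff := offset_le es n
    simp only [wp_set, hn₁, hp, hB.start, HState.tick_time, HState.setArr_time]
    have h7 : n ≤ n * e := Nat.le_mul_of_pos_right n (by omega)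
    refine ⟨by omega, by omega, by linarith, ?_, ?_⟩
    · intro w hw
      simp only [HState.tick_arr, HState.setArr_arr, if_true]
      by_cases hwn : w = n
      · rw [hwn, Function.update_self]
      · rw [Function.update_of_ne hwn, hst w (by omega)]
    · simpa using hsr

/-! ### Dynamic programming -/

/-- Looks up the trap for Player `sg` in `inX` that belongs to the position `v`. -/
def lookupProg : Cd :=
  -- Between lookups `inB` is zero, so a single bit is set and cleared again.
  .set .inB .v .one ;; trapProg ;; .set .inB .v .zero ;; pack .rest ;;
    .add .code .code .row ;; .get .z .table .code

/-- Tests whether the table contains all traps for Player `sg` in `inX` that belong to single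
positions. -/
def checkProg : Cd :=
  .const .good 1 ;;
  .forUp .one .v .n .tv (.get .z .inX .v ;;
    .ite .z (lookupProg ;; .ite .z skip (.const .good 0)) skip)

theorem Consts.congr {s s' : St} (h : Consts n e t s) (h' : ∀ r ∈ [Reg.n, .e, .t, .one, .zero, .N],
    s'.reg r = s.reg r) : Consts n e t s' := by
  simp only [List.mem_cons, List.not_mem_nil, or_false, forall_eq_or_imp, forall_eq] at h'
  obtain ⟨h1, h2, h3, h4, h5, h6⟩ := h'
  exact ⟨h1.trans h.n, h2.trans h.e, h3.trans h.t, h4.trans h.one, h5.trans h.zero, h6.trans h.N⟩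

theorem wp_lookupProg (hB : Fits B n e len) (hs : Consts n e t s) (hA : HoldsArena A es s)
    (hes : A.ListedBy es) (hP : HoldsPreds es s) (he : es.length = e) (hlen : n + 2 * e ≤ len)
    (hσ : s.reg .sg = σ) (hX : IsBits s .inX X) (h0 : IsBits (n := n) s .inB ∅)
    (hrow : s.reg .row ≤ 2 ^ n) {v : Fin n} (hv : s.reg .v = v) (hvX : v ∈ X) :
    wp B lookupProg (fun s' => s'.time ≤ s.time + 100 * e + 12 ∧ IsBits (n := n) s' .inB ∅ ∧
      s'.reg .z = s.arr .table (s.reg .row + setCode (A.trap σ X {v}))) s := by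
  have h1 := hB.n_le
  have h2 := hB.n_pos
  have h3 := hB.n_le_e
  have h4 := hB.pow_le
  have h5 := v.2
  rw [lookupProg, wp_seq, wp_set, hv, hB.inB, hs.one]
  refine ⟨h5, by omega, ?_⟩
  set s₁ := (s.setArr .inB v 1).tick 2 with hs₁
  have hc₁ : Consts n e t s₁ := hs.congr fun _ _ => rfl
  have hb₁ : IsBits s₁ .inB {v} := by
    intro u
    simp only [hs₁, HState.tick_arr, HState.setArr_arr, if_true]
    by_cases hu : u = v
    · subst hu; simp
    · rw [Function.update_of_ne (Fin.val_injective.ne hu), h0 u]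
      simp [hu]
  rw [wp_seq]
  refine (wp_trapProg hB hc₁ (hA.of_eq rfl) hes (hP.of_eq rfl rfl) he hlen hσ (hX.of_eq rfl) hb₁
    (by simpa using hvX)).mono ?_
  rintro s₂ hs₂ ⟨ht₂, hr₂⟩
  have hc₂ := hc₁.of_same hs₂ rfl
  have hv₂ : s₂.reg .v = v := (hs₂.1 _ rfl).trans hv
  have hrow₂ : s₂.reg .row = s.reg .row := hs₂.1 _ rfl
  have hT₂ : s₂.arr .table = s.arr .table := hs₂.2 _ rfl
  have hb₂ : s₂.arr .inB = s₁.arr .inB := hs₂.2 _ rfl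
  rw [wp_seq, wp_set, hv₂, hc₂.zero, hB.inB]
  refine ⟨h5, Nat.zero_le _, ?_⟩
  set s₃ := (s₂.setArr .inB v 0).tick 2 with hs₃
  have hc₃ : Consts n e t s₃ := hc₂.congr fun _ _ => rfl
  have hb₃ : IsBits (n := n) s₃ .inB ∅ := by
    intro u
    simp only [hs₃, HState.tick_arr, HState.setArr_arr, if_true, hb₂]
    by_cases hu : u = v
    · subst hu; simp
    · rw [Function.update_of_ne (Fin.val_injective.ne hu), hb₁ u]
      simp [hu]
  rw [wp_seq]
  refine (wp_pack hB hc₃ hB.rest (X := A.trap σ X {v}) (hr₂.of_eq rfl)).mono ?_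
  rintro s₄ hs₄ ⟨hcode, ht₄⟩
  have hrow₄ : s₄.reg .row = s.reg .row := (hs₄.1 _ rfl).trans hrow₂
  have hT₄ : s₄.arr .table = s.arr .table := (hs₄.2 _ rfl).trans hT₂
  have hb₄ : s₄.arr .inB = s₃.arr .inB := hs₄.2 _ rfl
  have hlt := setCode_lt (A.trap σ X {v})
  simp only [wp_seq, wp_add, wp_get, HState.tick_reg, HState.setReg_reg, if_true, HState.tick_arr,
    HState.setReg_arr, HState.tick_time, HState.setReg_time, hcode, hrow₄, hT₄, hB.table]
  have e1 : s₃.time = s₂.time + 2 := rfl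
  have e2 : s₁.time = s.time + 2 := rfl
  rw [add_comm (setCode _)]
  exact ⟨by omega, by omega, by omega, hb₃.of_eq hb₄, rfl⟩

theorem wp_checkProg (hB : Fits B n e len) (hs : Consts n e t s) (hA : HoldsArena A es s)
    (hes : A.ListedBy es) (hP : HoldsPreds es s) (he : es.length = e) (hlen : n + 2 * e ≤ len)
    (hσ : s.reg .sg = σ) (hX : IsBits s .inX X) (h0 : IsBits (n := n) s .inB ∅)
    (hrow : s.reg .row ≤ 2 ^ n) :
    wp B checkProg (fun s' => s'.time ≤ s.time + 130 * (n * e) ∧ IsBits (n := n) s' .inB ∅ ∧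
      s'.reg .good ≤ 1 ∧ (s'.reg .good ≠ 0 ↔
        ∀ v ∈ X, s.arr .table (s.reg .row + setCode (A.trap σ X {v})) ≠ 0)) s := by
  have h1 := hB.n_le
  have h2 := hB.cell_le
  have h3 := hB.n_pos
  have h4 := hB.e_le
  have h5 := hB.len_le
  have h6 := hB.n_le_e
  have h7 := hB.pow_le
  simp only [checkProg, wp_seq, wp_const]
  refine ⟨by omega, ?_⟩
  refine wp_forUp_time (fun k s' => IsBits (n := n) s' .inB ∅ ∧ s'.reg .good ≤ 1 ∧
    (s'.reg .good ≠ 0 ↔ ∀ v ∈ X, (v : ℕ) < k →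
      s.arr .table (s.reg .row + setCode (A.trap σ X {v})) ≠ 0)) (100 * e + 24)
    (by decide) rfl ?_ ?_ ?_ ?_ ?_
  · simp [hs.one]
  · simp [hs.n, h1.trans h2]
  · intro t
    exact ⟨h0, by simp, by simp⟩
  · rintro k hk s₁ hs₁ hi ⟨hb, hg, hall⟩
    have hc₁ : Consts n e t s₁ :=
      Consts.of_same (s := (s.setReg .good 1).tick 1) ⟨by simp [hs.n], by simp [hs.e],
        by simp [hs.t], by simp [hs.one], by simp [hs.zero], by simp [hs.N]⟩ hs₁ rfl
    have hA₁ : HoldsArena A es s₁ := hA.of_eq (by rw [hs₁.2 _ rfl]; simp)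
    have hP₁ : HoldsPreds es s₁ :=
      hP.of_eq (by rw [hs₁.2 _ rfl]; simp) (by rw [hs₁.2 _ rfl]; simp)
    have hX₁ : IsBits s₁ .inX X := hX.of_eq (by rw [hs₁.2 _ rfl]; simp)
    have hσ₁ : s₁.reg .sg = σ := by rw [hs₁.1 _ rfl]; simp [hσ]
    have hr₁ : s₁.reg .row = s.reg .row := by rw [hs₁.1 _ rfl]; simp
    have hT₁ : s₁.arr .table = s.arr .table := by rw [hs₁.2 _ rfl]; simp
    simp only [HState.tick_reg, HState.setReg_reg, reduceCtorEq, if_false, hs.n] at hk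
    have hXk := hX₁ ⟨k, hk⟩
    have hfin : ∀ P : Fin n → Prop, (∀ v ∈ X, (v : ℕ) < k + 1 → P v) ↔
        (∀ v ∈ X, (v : ℕ) < k → P v) ∧ (⟨k, hk⟩ ∈ X → P ⟨k, hk⟩) := by
      intro P
      constructor
      · exact fun h => ⟨fun v hv hvk => h v hv (by omega), fun hv => h _ hv (Nat.lt_succ_self k)⟩
      · rintro ⟨h, h'⟩ v hv hvk
        by_cases hvk' : (v : ℕ) = k
        · obtain rfl : v = ⟨k, hk⟩ := Fin.ext hvk'
          exact h' hv
        · exact h v hv (by omega)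
    simp only [wp_seq, wp_get, wp_ite, HState.tick_reg, HState.setReg_reg, hi, if_true, hB.inX,
      hXk]
    refine ⟨hk, ?_⟩
    by_cases hkX : (⟨k, hk⟩ : Fin n) ∈ X
    · rw [if_pos (by simp [hkX])]
      set s₂ := ((s₁.setReg .z (if (⟨k, hk⟩ : Fin n) ∈ X then 1 else 0)).tick 2).tick 1 with hs₂
      refine (wp_lookupProg (s := s₂) (v := ⟨k, hk⟩) hB (hc₁.congr (by simp [hs₂]))
        (hA₁.of_eq rfl) hes (hP₁.of_eq rfl rfl) he hlen hσ₁ (hX₁.of_eq rfl) (hb.of_eq rfl)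
        (hr₁.le.trans hrow) hi hkX).mono ?_
      rintro s₃ hs₃ ⟨ht₃, hb₃, hz₃⟩
      have hg₃ : s₃.reg .good = s₁.reg .good := hs₃.1 _ rfl
      have e1 : s₂.time = s₁.time + 3 := rfl
      have e2 : s₂.arr .table = s.arr .table := hT₁
      have e3 : s₂.reg .row = s.reg .row := hr₁
      rw [e2, e3] at hz₃
      simp only [wp_ite, skip, wp_const, HState.tick_reg, HState.setReg_reg, reduceCtorEq,
        if_false, if_true, HState.tick_time, HState.setReg_time, hz₃, hg₃]
      have hempty : ∀ v : Fin n, s₃.arr .inB v = if v ∈ (∅ : Finset (Fin n)) then 1 else 0 := hb₃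
      by_cases hz : s.arr .table (s.reg .row + setCode (A.trap σ X {⟨k, hk⟩})) = 0
      · rw [if_neg (not_not.2 hz)]
        refine ⟨Nat.zero_le _, by omega, fun x t => ⟨hempty, Nat.zero_le _, ?_⟩⟩
        rw [hfin]
        refine ⟨fun h => absurd rfl h, fun h => absurd hz (h.2 hkX)⟩
      · rw [if_pos hz]
        refine ⟨Nat.zero_le _, by omega, fun x t => ⟨hempty, hg, ?_⟩⟩
        rw [hfin, hall]
        exact ⟨fun h => ⟨h, fun _ => hz⟩, fun h => h.1⟩
    · rw [if_neg (by simp [hkX])]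
      simp only [skip, wp_const, HState.tick_time, HState.setReg_time]
      refine ⟨Nat.zero_le _, by omega, fun x t => ⟨hb.of_eq (by simp), by simpa using hg, ?_⟩⟩
      rw [hfin, ← hall]
      simp [hkX]
  · rintro s₁ hs₁ ht₁ ⟨hb, hg, hall⟩
    simp only [HState.tick_reg, HState.setReg_reg, reduceCtorEq, if_false, hs.n,
      HState.tick_time, HState.setReg_time] at ht₁ hall
    have h8 : n ≤ n * e := Nat.le_mul_of_pos_right n (by omega)
    refine ⟨by linarith, hb, hg, ?_⟩
    rw [hall]
    exact ⟨fun h v hv => h v hv v.2, fun h v hv _ => h v hv⟩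

end

/-- Computes the entry for Player `sg` and the set `inX` with number `x`; if `first ≠ 0`, the other
player wins from everywhere. -/
def entryProg : Cd :=
  .ite .sg (mov .row .N) (mov .row .zero) ;; checkProg ;;
  -- The test of `x` exempts the empty set, which both players win.
  .ite .first (.ite .x (.const .good 0) skip) skip ;; .add .z .row .x ;; .set .table .z .good

/-- Fills the table. -/
def tableProg : Cd :=
  .forUp .one .x .N .tx
    (unpack .inX ;; .get .sg .cond .x ;; .const .first 0 ;; entryProg ;;
      mov .first .good ;; .sub .sg .one .sg ;; entryProg)

/-- The array `cond` tells for each set which player wins if it is the infinity set. -/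
def HoldsCond {n : ℕ} (C : Fin 2 → Finset (Fin n) → Prop) (s : St) : Prop :=
  ∀ X, ∃ σ : Fin 2, s.arr .cond (setCode X) = σ ∧ C σ X

/-- The table entry tells whether the player wins in `X` from everywhere. -/
def EntryCorrect {n : ℕ} (A : Arena (Fin n)) (C : Fin 2 → Finset (Fin n) → Prop) (s : St)
    (σ : Fin 2) (X : Finset (Fin n)) : Prop :=
  s.arr .table (σ * 2 ^ n + setCode X) ≠ 0 ↔ A.WinsOn C σ X X

theorem entry_ne {N x y : ℕ} (hx : x < N) (hy : y < N) {σ τ : Fin 2} (h : σ ≠ τ ∨ x ≠ y) :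
    (σ : ℕ) * N + x ≠ τ * N + y := by
  by_cases hστ : σ = τ
  · subst hστ
    have := h.resolve_left (fun h => h rfl)
    omega
  · have h1 := σ.2
    have h2 := τ.2
    have h3 : (σ : ℕ) ≠ τ := fun h => hστ (Fin.ext h)
    have : ((σ : ℕ) = 0 ∧ (τ : ℕ) = 1) ∨ ((σ : ℕ) = 1 ∧ (τ : ℕ) = 0) := by omega
    rcases this with ⟨h4, h5⟩ | ⟨h4, h5⟩ <;> rw [h4, h5] <;> omega

namespace Arena

variable {n : ℕ} {A : Arena (Fin n)} {C : Fin 2 → Finset (Fin n) → Prop} {σ τ : Fin 2}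
  {X : Finset (Fin n)}

/-- The recurrence for the player treated first: only entries of proper subsets occur. -/
theorem winsOn_iff_of_cond (hX : A.Subarena X) (hc : C σ X) : A.WinsOn C σ X X ↔
    ∀ v ∈ X, A.WinsOn C σ (A.trap σ X {v}) (A.trap σ X {v}) :=
  ⟨fun h _ _ => h.restrict_trap, winsOn_of_cond hX hc⟩

/-- The recurrence for the other player, `τ`. It also uses the entry of `σ` for the same set, except
for `X = ∅`, which is won by both. -/
theorem winsOn_iff_of_not_cond (hC : Complementary C) (hστ : σ ≠ τ) (hX : A.Subarena X)
    (hc : C σ X) : A.WinsOn C τ X X ↔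
    (∀ v ∈ X, A.WinsOn C τ (A.trap τ X {v}) (A.trap τ X {v})) ∧
      (¬ A.WinsOn C σ X X ∨ X = ∅) := by
  rcases X.eq_empty_or_nonempty with rfl | hne
  · exact iff_of_true (winsOn_empty hX) (by simp)
  · rw [winsOn_iff hC hστ.symm hX hne, or_iff_right (fun h => (hC σ τ hστ X).1 hc h),
      or_iff_left hne.ne_empty]

end Arena

section

variable {n e t len : ℕ} {B : Bounds Arr} {s : St} {A : Arena (Fin n)}
  {es : List (Fin n × Fin n)} {σ τ : Fin 2} {X Y : Finset (Fin n)}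
  {C : Fin 2 → Finset (Fin n) → Prop}

theorem setCode_eq_zero : setCode X = 0 ↔ X = ∅ :=
  ⟨fun h => setCode_injective (h.trans setCode_empty.symm), fun h => h ▸ setCode_empty⟩

theorem wp_entryProg (hB : Fits B n e len) (hs : Consts n e t s) (hA : HoldsArena A es s)
    (hes : A.ListedBy es) (hP : HoldsPreds es s) (he : es.length = e) (hlen : n + 2 * e ≤ len)
    (hσ : s.reg .sg = σ) (hX : IsBits s .inX X) (h0 : IsBits (n := n) s .inB ∅)
    (hx : s.reg .x = setCode X) :
    wp B entryProg (fun s' => s'.time ≤ s.time + 138 * (n * e) ∧ IsBits (n := n) s' .inB ∅ ∧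
      s'.reg .good ≤ 1 ∧ s'.arr .table = Function.update (s.arr .table) (σ * 2 ^ n + setCode X) (s'.reg .good) ∧
      (s'.reg .good ≠ 0 ↔
        (∀ v ∈ X, s.arr .table (σ * 2 ^ n + setCode (A.trap σ X {v})) ≠ 0) ∧
          (s.reg .first = 0 ∨ X = ∅))) s := by
  have h1 := hB.n_le
  have h2 := hB.n_pos
  have h3 := hB.n_le_e
  have h4 := hB.pow_le
  have h6 : 1 ≤ n * e := Nat.mul_pos h2 (by omega)
  have hlt := setCode_lt X
  have hσ2 : (σ : ℕ) = 0 ∨ (σ : ℕ) = 1 := by have := σ.2; omega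
  rw [entryProg, wp_seq]
  have hrow : wp B (.ite .sg (mov .row .N) (mov .row .zero)) (fun s' => s'.time = s.time + 2 ∧
      s'.reg .row = σ * 2 ^ n) s := by
    rcases hσ2 with h | h
    · rw [wp_ite, hσ, h]
      simp [mov, wp_add, hs.zero]
    · rw [wp_ite, hσ, h]
      simp [mov, wp_add, hs.zero, hs.N]
      omega
  refine hrow.mono ?_
  rintro s₁ hs₁ ⟨ht₁, hr₁⟩
  have hr₁' : s₁.reg .row ≤ 2 ^ n := by
    rw [hr₁]
    rcases hσ2 with h | h <;> rw [h] <;> omega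
  have hT₁ : s₁.arr .table = s.arr .table := hs₁.2 _ rfl
  have hx₁ : s₁.reg .x = setCode X := (hs₁.1 _ rfl).trans hx
  have hf₁ : s₁.reg .first = s.reg .first := hs₁.1 _ rfl
  rw [wp_seq]
  refine (wp_checkProg hB (hs.of_same hs₁ rfl) (hA.of_eq (hs₁.2 _ rfl)) hes
    (hP.of_eq (hs₁.2 _ rfl) (hs₁.2 _ rfl)) he hlen ((hs₁.1 _ rfl).trans hσ)
    (hX.of_eq (hs₁.2 _ rfl)) (h0.of_eq (hs₁.2 _ rfl)) hr₁').mono ?_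
  rintro s₂ hs₂ ⟨ht₂, hb₂, hg₂, hall⟩
  have hr₂ : s₂.reg .row = s₁.reg .row := hs₂.1 _ rfl
  have hT₂ : s₂.arr .table = s.arr .table := (hs₂.2 _ rfl).trans hT₁
  have hx₂ : s₂.reg .x = setCode X := (hs₂.1 _ rfl).trans hx₁
  have hf₂ : s₂.reg .first = s.reg .first := (hs₂.1 _ rfl).trans hf₁
  rw [hr₁, hT₁] at hall
  rw [wp_seq]
  have hadj : wp B (.ite .first (.ite .x (.const .good 0) skip) skip) (fun s' =>
      s'.time ≤ s₂.time + 3 ∧ s'.reg .good ≤ 1 ∧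
        (s'.reg .good ≠ 0 ↔ s₂.reg .good ≠ 0 ∧ (s.reg .first = 0 ∨ X = ∅))) s₂ := by
    rw [wp_ite, wp_ite, HState.tick_reg, hf₂, hx₂]
    by_cases hf : s.reg .first = 0
    · simp [hf, skip, wp_const, hg₂]
    · by_cases hX0 : X = ∅
      · simp [hf, hX0, skip, wp_const, hg₂, setCode_empty]
      · have : setCode X ≠ 0 := fun h => hX0 (setCode_eq_zero.1 h)
        simp [hf, hX0, wp_const, this]
  refine hadj.mono ?_
  rintro s₃ hs₃ ⟨ht₃, hg₃, hall₃⟩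
  have hr₃ : s₃.reg .row = σ * 2 ^ n := ((hs₃.1 _ rfl).trans hr₂).trans hr₁
  have hT₃ : s₃.arr .table = s.arr .table := (hs₃.2 _ rfl).trans hT₂
  have hx₃ : s₃.reg .x = setCode X := (hs₃.1 _ rfl).trans hx₂
  have hle : (σ : ℕ) * 2 ^ n ≤ 2 ^ n := by rw [hr₁] at hr₁'; exact hr₁'
  simp only [wp_seq, wp_add, wp_set, HState.tick_reg, HState.setReg_reg, reduceCtorEq, if_false,
    if_true, HState.tick_arr, HState.setReg_arr, HState.setArr_arr, HState.setArr_reg,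
    HState.tick_time, HState.setReg_time, HState.setArr_time, hr₃, hx₃, hT₃, hB.table]
  refine ⟨by omega, by omega, by omega, by omega, ?_, hg₃, trivial, ?_⟩
  · exact (hb₂.of_eq (hs₃.2 _ rfl)).of_eq (by simp)
  · rw [hall₃, hall]

theorem wp_tableProg (hB : Fits B n e len) (hs : Consts n e t s) (hA : HoldsArena A es s)
    (hes : A.ListedBy es) (hP : HoldsPreds es s) (he : es.length = e) (hlen : n + 2 * e ≤ len)
    (h0 : IsBits (n := n) s .inB ∅) (hC : Arena.Complementary C) (hF : HoldsCond C s) :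
    wp B tableProg (fun s' => s'.time ≤ s.time + 310 * (2 ^ n * (n * e)) + 3 ∧
      ∀ X, A.Subarena X → ∀ σ, EntryCorrect A C s' σ X) s := by
  have h1 := hB.n_le
  have h2 := hB.n_pos
  have h3 := hB.n_le_e
  have h4 := hB.pow_le
  have h6 : 1 ≤ n * e := Nat.mul_pos h2 (by omega)
  have h7 : n ≤ n * e := Nat.le_mul_of_pos_right n (by omega)
  -- Nothing is claimed about entries of sets that are no subarenas. They are never needed, because
  -- traps in subarenas are subarenas.
  refine wp_forUp_time (fun k s' => IsBits (n := n) s' .inB ∅ ∧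
    ∀ X, setCode X < k → A.Subarena X → ∀ σ, EntryCorrect A C s' σ X) (310 * (n * e))
    (by decide) rfl hs.one (by rw [hs.N]; omega) ?_ ?_ ?_
  · intro t
    exact ⟨h0.of_eq (by simp), fun X h => absurd h (Nat.not_lt_zero _)⟩
  · rintro k hk s₁ hs₁ hi ⟨hb, hall⟩
    rw [hs.N] at hk
    have hc₁ := hs.of_same hs₁ rfl
    have hA₁ := hA.of_eq (hs₁.2 _ rfl)
    have hP₁ := hP.of_eq (hs₁.2 _ rfl) (hs₁.2 _ rfl)
    have hF₁ : s₁.arr .cond = s.arr .cond := hs₁.2 _ rfl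
    rw [wp_seq]
    refine (wp_unpack hB hc₁ hB.inX hi hk).mono ?_
    rintro s₂ hs₂ ⟨hX₂, ht₂⟩
    set X := decodeSet n k with hXdef
    have hXk : setCode X = k := setCode_decodeSet hk
    have hc₂ := hc₁.of_same hs₂ rfl
    have hF₂ : s₂.arr .cond = s.arr .cond := (hs₂.2 _ rfl).trans hF₁
    have hx₂ : s₂.reg .x = k := (hs₂.1 _ rfl).trans hi
    have hT₂ : s₂.arr .table = s₁.arr .table := hs₂.2 _ rfl
    obtain ⟨σ, hσ, hcσ⟩ := hF X
    rw [hXk] at hσ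
    rw [wp_seq, wp_get, wp_seq, wp_const, hx₂, hB.cond, hF₂, hσ]
    refine ⟨hk, Nat.zero_le _, ?_⟩
    set s₃ := ((((s₂.setReg .sg σ).tick 2).setReg .first 0).tick 1) with hs₃
    rw [wp_seq]
    refine (wp_entryProg (s := s₃) (X := X) (σ := σ) hB (hc₂.congr (by simp [hs₃]))
      ((hA₁.of_eq (hs₂.2 _ rfl)).of_eq rfl) hes ((hP₁.of_eq (hs₂.2 _ rfl) (hs₂.2 _ rfl)).of_eq
      rfl rfl) he hlen rfl (hX₂.of_eq rfl) ((hb.of_eq (hs₂.2 _ rfl)).of_eq rfl)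
      (by rw [hXk]; exact hx₂)).mono ?_
    rintro s₄ hs₄ ⟨ht₄, hb₄, hle₄, hT₄, hg₄⟩
    have hc₄ : Consts n e t s₄ := (hc₂.congr (s' := s₃) (by simp [hs₃])).of_same hs₄ rfl
    have hsg₄ : s₄.reg .sg = σ := hs₄.1 _ rfl
    have hx₄ : s₄.reg .x = k := (hs₄.1 _ rfl).trans hx₂
    have ht₃ : s₃.time = s₂.time + 3 := rfl
    have hσ2 := σ.2
    obtain ⟨τ, hτ⟩ : ∃ τ : Fin 2, (τ : ℕ) = 1 - σ := ⟨⟨1 - σ, by omega⟩, rfl⟩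
    have hστ : σ ≠ τ := fun h => by rw [h] at hτ; omega
    have e₃ : s₃.arr .table = s₁.arr .table := hT₂
    rw [e₃] at hg₄ hT₄
    have hr₄ : s₃.reg .first = 0 := rfl
    simp only [hr₄, true_or, and_true] at hg₄
    simp only [mov, wp_seq, wp_add, wp_sub, HState.tick_reg, HState.setReg_reg, reduceCtorEq,
      if_false, hc₄.zero, hc₄.one, hsg₄]
    refine ⟨by omega, by omega, ?_⟩
    set s₅ := (((s₄.setReg .first (s₄.reg .good + 0)).tick 1).setReg .sg (1 - σ)).tick 1 with hs₅
    have ht₅ : s₅.time = s₄.time + 2 := rfl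
    have hA₃ : HoldsArena A es s₃ := (hA₁.of_eq (hs₂.2 _ rfl)).of_eq rfl
    have hP₃ : HoldsPreds es s₃ := (hP₁.of_eq (hs₂.2 _ rfl) (hs₂.2 _ rfl)).of_eq rfl rfl
    have hlt := fun Y : Finset (Fin n) => setCode_lt Y
    refine (wp_entryProg (s := s₅) (X := X) (σ := τ) hB (hc₄.congr (by simp [hs₅]))
      ((hA₃.of_eq (hs₄.2 _ rfl)).of_eq rfl) hes
      ((hP₃.of_eq (hs₄.2 _ rfl) (hs₄.2 _ rfl)).of_eq rfl rfl) he hlen hτ.symm (((hX₂.of_eq (s' := s₃) rfl).of_eq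
      (hs₄.2 _ rfl)).of_eq rfl) (hb₄.of_eq rfl) (by rw [hXk]; exact hx₄)).mono ?_
    rintro s₆ hs₆ ⟨ht₆, hb₆, hle₆, hT₆, hg₆⟩
    have e₅ : s₅.arr .table = s₄.arr .table := rfl
    have hr₅ : s₅.reg .first = s₄.reg .good := rfl
    rw [e₅, hT₄] at hT₆ hg₆
    rw [hr₅] at hg₆
    -- the entries of smaller sets are correct
    have hold : ∀ Y, setCode Y < k → A.Subarena Y → ∀ ρ, EntryCorrect A C s₁ ρ Y := hall
    have hsub : A.Subarena X → ∀ ρ : Fin 2, ∀ v ∈ X,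
        (s₁.arr .table (ρ * 2 ^ n + setCode (A.trap ρ X {v})) ≠ 0 ↔
          A.WinsOn C ρ (A.trap ρ X {v}) (A.trap ρ X {v})) := fun hX ρ v hv =>
      hold _ (hXk ▸ setCode_lt_of_ssubset (Arena.trap_ssubset hv (Finset.mem_singleton_self v)))
        (Arena.subarena_trap hX) ρ
    have hfirst : A.Subarena X → (s₄.reg .good ≠ 0 ↔ A.WinsOn C σ X X) := fun hX => by
      rw [hg₄, Arena.winsOn_iff_of_cond hX hcσ]
      exact forall₂_congr fun v hv => hsub hX σ v hv
    -- Register `first` holds the entry just computed for `σ`; writing it into the table has left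
    -- the row of `τ` unchanged.
    have hsecond : A.Subarena X → (s₆.reg .good ≠ 0 ↔ A.WinsOn C τ X X) := fun hX => by
      rw [hg₆, Arena.winsOn_iff_of_not_cond hC hστ hX hcσ, ← hfirst hX, not_not]
      refine and_congr_left fun _ => forall₂_congr fun v hv => ?_
      rw [Function.update_of_ne (entry_ne (hlt _) (hlt _) (.inl hστ.symm)), hsub hX τ v hv]
    have hρ : ∀ ρ, ρ = σ ∨ ρ = τ := fun ρ => by omega
    refine ⟨by omega, fun x t => ⟨hb₆.of_eq (by simp), fun Y hY hYA ρ => ?_⟩⟩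
    simp only [EntryCorrect, HState.tick_arr, HState.setReg_arr, hT₆]
    by_cases hYX : Y = X
    · rw [hYX] at hYA ⊢
      rcases hρ ρ with rfl | rfl
      · rw [Function.update_of_ne (entry_ne (hlt _) (hlt _) (.inl hστ)), Function.update_self]
        exact hfirst hYA
      · rw [Function.update_self]
        exact hsecond hYA
    · have hne : setCode Y ≠ setCode X := fun h => hYX (setCode_injective h)
      rw [Function.update_of_ne (entry_ne (hlt _) (hlt _) (.inr hne)),
        Function.update_of_ne (entry_ne (hlt _) (hlt _) (.inr hne))]
      exact hold Y (by omega) hYA ρ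
  · rintro s' hs' ht ⟨-, h⟩
    rw [hs.N] at ht h
    refine ⟨by linarith, fun X hX σ => h X (setCode_lt X) hX σ⟩

/-! ### Extraction of the winning regions -/

/-- Marks the positions in `rest`. -/
def markProg : Cd := forI .n (.get .z .rest .i ;; .ite .z (.set .mark .i .one) skip)

/-- Marks the traps for Player `1` in which Player `0` wins from everywhere. -/
def regionProg : Cd :=
  forI .n (.set .inX .i .one) ;; .const .sg 1 ;;
  -- The row of Player `0` starts at the beginning of the table, so the number of the trap is its
  -- index.
  .forUp .one .x .N .tx (unpack .inB ;; trapProg ;; pack .rest ;; .get .z .table .code ;;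
    .ite .z markProg skip)

/-- Writes the winners of the positions. -/
def outputProg : Cd := forI .n (.get .z .mark .i ;; .sub .z .one .z ;; .set .inp .i .z)

theorem wp_markProg (hB : Fits B n e len) (hs : Consts n e t s) (hX : IsBits s .rest X)
    (hY : IsBits s .mark Y) :
    wp B markProg (fun s' => s'.time ≤ s.time + 8 * n + 3 ∧ IsBits s' .mark (Y ∪ X)) s := by
  have h1 := hB.n_le
  have h2 := hB.n_pos
  have h3 := hB.cell_le
  refine wp_forUp_time (fun k s' => ∀ v : Fin n,
    s'.arr .mark v = if v ∈ Y ∨ (v ∈ X ∧ (v : ℕ) < k) then 1 else 0) 8 (by decide) rfl hs.one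
    (by rw [hs.n]; omega) ?_ ?_ ?_
  · intro t v
    simpa using hY v
  · intro k hk s₁ hs₁ hi hm
    rw [hs.n] at hk
    have hc₁ := hs.of_same hs₁ rfl
    have hX₁ := hX.of_eq (hs₁.2 _ rfl) ⟨k, hk⟩
    dsimp only at hX₁
    simp only [wp_seq, wp_get, wp_ite, wp_set, skip, wp_const, HState.tick_reg, HState.setReg_reg,
      reduceCtorEq, if_false, if_true, HState.tick_arr, HState.setReg_arr, HState.setArr_arr,
      HState.tick_time, HState.setReg_time, HState.setArr_time, hi, hX₁, hc₁.one, hB.rest, hB.mark]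
    refine ⟨hk, ?_⟩
    by_cases hkX : (⟨k, hk⟩ : Fin n) ∈ X
    · rw [if_pos (by simp [hkX])]
      refine ⟨hk, by omega, by omega, fun x t v => ?_⟩
      by_cases hvk : (v : ℕ) = k
      · obtain rfl : v = ⟨k, hk⟩ := Fin.ext hvk
        simp [hkX]
      · rw [Function.update_of_ne hvk, hm v]
        simp only [show (v : ℕ) < k ↔ (v : ℕ) < k + 1 by omega]
    · rw [if_neg (by simp [hkX])]
      refine ⟨by omega, by omega, fun x t v => ?_⟩
      rw [hm v]
      by_cases hvk : (v : ℕ) = k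
      · obtain rfl : v = ⟨k, hk⟩ := Fin.ext hvk
        simp [hkX]
      · simp only [show (v : ℕ) < k ↔ (v : ℕ) < k + 1 by omega]
  · intro s₁ _ ht hm
    rw [hs.n] at ht hm
    exact ⟨by omega, fun v => by simp [hm v]⟩

theorem wp_regionProg (hB : Fits B n e len) (hs : Consts n e t s) (hA : HoldsArena A es s)
    (hes : A.ListedBy es) (hP : HoldsPreds es s) (he : es.length = e) (hlen : n + 2 * e ≤ len)
    (h0 : IsBits (n := n) s .mark ∅)
    (hT : ∀ X, A.Subarena X → ∀ σ, EntryCorrect A C s σ X) :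
    wp B regionProg (fun s' => s'.time ≤ s.time + 150 * (2 ^ n * (n * e)) ∧
      ∃ W : Finset (Fin n), IsBits s' .mark W ∧ ∀ v, v ∈ W ↔ ∃ Y, v ∈ A.trap 1 Finset.univ Y ∧
        A.WinsOn C 0 (A.trap 1 Finset.univ Y) (A.trap 1 Finset.univ Y)) s := by
  have h1 := hB.n_le
  have h2 := hB.n_pos
  have h3 := hB.n_le_e
  have h4 := hB.pow_le
  have h5 := hB.cell_le
  have h6 : 1 ≤ n * e := Nat.mul_pos h2 (by omega)
  have h7 : e ≤ n * e := Nat.le_mul_of_pos_left e h2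
  rw [regionProg, wp_seq]
  refine wp_forUp_time (fun k s' => ∀ v < k, s'.arr .inX v = 1) 5 (by decide) rfl hs.one
    (by rw [hs.n]; omega) (fun t v hv => absurd hv (Nat.not_lt_zero v)) ?_ ?_
  · intro k hk s₁ hs₁ hi hm
    rw [hs.n] at hk
    have hc₁ := hs.of_same hs₁ rfl
    simp only [wp_set, HState.tick_arr, HState.setReg_arr, HState.setArr_arr,
      HState.tick_time, HState.setArr_time, if_true, hi, hc₁.one, hB.inX]
    refine ⟨hk, by omega, by omega, fun x t v hv => ?_⟩
    by_cases hvk : v = k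
    · simp [hvk]
    · rw [Function.update_of_ne hvk, hm v (by omega)]
  intro s₁ hs₁ ht₁ hX₁
  rw [hs.n] at ht₁ hX₁
  have hc₁ := hs.of_same hs₁ rfl
  rw [wp_seq, wp_const]
  refine ⟨by omega, ?_⟩
  set s₂ := (s₁.setReg .sg 1).tick 1 with hs₂
  have hc₂ : Consts n e t s₂ := hc₁.congr (by simp [hs₂])
  have hA₂ : HoldsArena A es s₂ := (hA.of_eq (s' := s₁) (hs₁.2 _ rfl)).of_eq rfl
  have hP₂ : HoldsPreds es s₂ := (hP.of_eq (s' := s₁) (hs₁.2 _ rfl) (hs₁.2 _ rfl)).of_eq rfl rfl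
  have hT₂ : s₂.arr .table = s.arr .table := hs₁.2 _ rfl
  have hm₂ : s₂.arr .mark = s.arr .mark := hs₁.2 _ rfl
  have ht₂ : s₂.time = s₁.time + 1 := rfl
  refine wp_forUp_time (fun k s' => ∃ W : Finset (Fin n), IsBits s' .mark W ∧
    ∀ v, v ∈ W ↔ ∃ Y, setCode Y < k ∧ v ∈ A.trap 1 Finset.univ Y ∧
        A.WinsOn C 0 (A.trap 1 Finset.univ Y) (A.trap 1 Finset.univ Y)) (141 * (n * e))
    (by decide) rfl hc₂.one (by rw [hc₂.N]; omega) ?_ ?_ ?_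
  · intro t
    exact ⟨∅, (h0.of_eq hm₂).of_eq (by simp), fun v => by simp⟩
  · rintro k hk s₃ hs₃ hi ⟨W, hW, hWY⟩
    rw [hc₂.N] at hk
    have hc₃ := hc₂.of_same hs₃ rfl
    rw [wp_seq]
    refine (wp_unpack hB hc₃ hB.inB hi hk).mono ?_
    rintro s₄ hs₄ ⟨hY₄, ht₄⟩
    set Y := decodeSet n k with hYdef
    have hYk : setCode Y = k := setCode_decodeSet hk
    have hc₄ := hc₃.of_same hs₄ rfl
    have hX₄ : IsBits s₄ .inX (Finset.univ : Finset (Fin n)) := fun v => by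
      rw [hs₄.2 _ rfl, hs₃.2 _ rfl, if_pos (Finset.mem_univ v)]
      exact hX₁ v v.2
    have hsg : s₄.reg .sg = (1 : Fin 2) := by
      rw [hs₄.1 _ rfl, hs₃.1 _ rfl]; rfl
    rw [wp_seq]
    refine (wp_trapProg hB hc₄ ((hA₂.of_eq (hs₃.2 _ rfl)).of_eq (hs₄.2 _ rfl)) hes
      ((hP₂.of_eq (hs₃.2 _ rfl) (hs₃.2 _ rfl)).of_eq (hs₄.2 _ rfl) (hs₄.2 _ rfl)) he hlen hsg
      hX₄ hY₄ (Finset.subset_univ _)).mono ?_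
    rintro s₅ hs₅ ⟨ht₅, hr₅⟩
    have hc₅ := hc₄.of_same hs₅ rfl
    rw [wp_seq]
    refine (wp_pack hB hc₅ hB.rest hr₅).mono ?_
    rintro s₆ hs₆ ⟨hcode, ht₆⟩
    have hc₆ := hc₅.of_same hs₆ rfl
    have hT₆ : s₆.arr .table = s.arr .table := by
      rw [hs₆.2 _ rfl, hs₅.2 _ rfl, hs₄.2 _ rfl, hs₃.2 _ rfl, hT₂]
    have hW₆ : IsBits s₆ .mark W :=
      ((hW.of_eq (hs₄.2 _ rfl)).of_eq (hs₅.2 _ rfl)).of_eq (hs₆.2 _ rfl)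
    have hr₆ := hr₅.of_eq (hs₆.2 _ rfl)
    have hlt := setCode_lt (A.trap 1 Finset.univ Y)
    have hent := hT _ (Arena.subarena_trap (σ := 1) (B := Y) A.subarena_univ) 0
    simp only [EntryCorrect, Fin.val_zero, zero_mul, zero_add] at hent
    rw [wp_seq, wp_get, wp_ite, hcode, hB.table, hT₆]
    simp only [HState.tick_reg, HState.setReg_reg, if_true]
    refine ⟨by omega, ?_⟩
    have hcode' : ∀ Z : Finset (Fin n), setCode Z < k + 1 ↔ setCode Z < k ∨ Z = Y := by
      intro Z
      rw [Nat.lt_succ_iff_lt_or_eq, ← hYk, setCode_injective.eq_iff]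
    split_ifs with hz
    · have hw := hent.1 hz
      refine wp.mono (wp_markProg hB (hc₆.congr (by simp)) (hr₆.of_eq rfl) (hW₆.of_eq rfl)) ?_
      rintro s₇ hs₇ ⟨ht₇, hW₇⟩
      simp only [HState.tick_time, HState.setReg_time] at ht₇
      refine ⟨by omega, fun x t => ⟨_, hW₇.of_eq (by simp), fun v => ?_⟩⟩
      rw [Finset.mem_union, hWY]
      simp only [hcode']
      constructor
      · rintro (⟨Z, hZ, h⟩ | h)
        · exact ⟨Z, .inl hZ, h⟩
        · exact ⟨Y, .inr rfl, h, hw⟩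
      · rintro ⟨Z, hZ | rfl, h⟩
        · exact .inl ⟨Z, hZ, h⟩
        · exact .inr h.1
    · have hw := mt hent.2 hz
      rw [skip, wp_const]
      refine ⟨by omega, ?_, fun x t => ⟨W, hW₆.of_eq (by simp), fun v => ?_⟩⟩
      · simp only [HState.tick_time, HState.setReg_time]
        omega
      rw [hWY]
      simp only [hcode']
      constructor
      · rintro ⟨Z, hZ, h⟩
        exact ⟨Z, .inl hZ, h⟩
      · rintro ⟨Z, hZ | rfl, h⟩
        · exact ⟨Z, hZ, h⟩
        · exact absurd h.2 hw
  · rintro s₃ hs₃ ht₃ ⟨W, hW, hWY⟩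
    rw [hc₂.N] at ht₃ hWY
    have h8 : n * e ≤ 2 ^ n * (n * e) := Nat.le_mul_of_pos_left _ (by positivity)
    refine ⟨?_, W, hW, fun v => by simp only [hWY, setCode_lt, true_and]⟩
    have h9 : 2 ^ n * (141 * (n * e)) = 141 * (2 ^ n * (n * e)) := by ring
    rw [h9] at ht₃
    have h10 : 2 * 1 ≤ 2 ^ n * (n * e) := Nat.mul_le_mul
      (by calc 2 = 2 ^ 1 := rfl
            _ ≤ 2 ^ n := Nat.pow_le_pow_right two_pos h2) h6
    omega

theorem wp_outputProg (hB : Fits B n e len) (hs : Consts n e t s) (hX : IsBits s .mark X)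
    (hlen : n ≤ len) :
    wp B outputProg (fun s' => s'.time ≤ s.time + 8 * n + 3 ∧
      ∀ v : Fin n, s'.arr .inp v = if v ∈ X then 0 else 1) s := by
  have h1 := hB.n_le
  have h2 := hB.n_pos
  have h3 := hB.cell_le
  refine wp_forUp_time (fun k s' => ∀ v : Fin n, (v : ℕ) < k →
    s'.arr .inp v = if v ∈ X then 0 else 1) 8 (by decide) rfl hs.one
    (by rw [hs.n]; omega) (fun t v hv => absurd hv (Nat.not_lt_zero v)) ?_ ?_
  · intro k hk s₁ hs₁ hi hm
    rw [hs.n] at hk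
    have hc₁ := hs.of_same hs₁ rfl
    have hX₁ := hX.of_eq (hs₁.2 _ rfl) ⟨k, hk⟩
    dsimp only at hX₁
    simp only [wp_seq, wp_get, wp_sub, wp_set, HState.tick_reg, HState.setReg_reg, reduceCtorEq,
      if_false, if_true, HState.tick_arr, HState.setReg_arr, HState.setArr_arr, HState.tick_time,
      HState.setReg_time, HState.setArr_time, hi, hX₁, hc₁.one, hB.inp, hB.mark]
    refine ⟨hk, by omega, by omega, by omega, by omega, fun x t v hv => ?_⟩
    by_cases hvk : (v : ℕ) = k
    · obtain rfl : v = ⟨k, hk⟩ := Fin.ext hvk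
      rw [Function.update_self]
      split_ifs <;> rfl
    · rw [Function.update_of_ne hvk, hm v (by omega)]
  · intro s₁ _ ht hm
    rw [hs.n] at ht hm
    exact ⟨by omega, fun v => hm v v.2⟩

end

/-! ### The Muller condition of a KL game -/

/-- The list `l` stands in the array `a` from address `b` on. -/
def HoldsAt (a : ℕ → ℕ) (b : ℕ) (l : List ℕ) : Prop := ∀ i (hi : i < l.length), a (b + i) = l[i]

theorem holdsAt_cons {a : ℕ → ℕ} {b x : ℕ} {l : List ℕ} :
    HoldsAt a b (x :: l) ↔ a b = x ∧ HoldsAt a (b + 1) l := by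
  constructor
  · intro h
    refine ⟨h 0 (by simp), fun i hi => ?_⟩
    have := h (i + 1) (by simpa using hi)
    simpa [add_assoc, add_comm 1 i] using this
  · rintro ⟨h, h'⟩ (_ | i) hi
    · exact h
    · have := h' i (by simpa using hi)
      simpa [add_assoc, add_comm 1 i] using this

theorem holdsAt_append {a : ℕ → ℕ} {b : ℕ} {l l' : List ℕ} :
    HoldsAt a b (l ++ l') ↔ HoldsAt a b l ∧ HoldsAt a (b + l.length) l' := by
  induction l generalizing b with
  | nil => simp [HoldsAt]
  | cons x l ih =>
    rw [List.cons_append, holdsAt_cons, holdsAt_cons, ih, and_assoc, List.length_cons,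
      add_assoc, add_comm 1]

theorem pairsCode_cons {n : ℕ} (p : Fin n × List (Fin n)) (ps : List (Fin n × List (Fin n))) :
    pairsCode (p :: ps) =
      (p.1 : ℕ) :: p.2.length :: (p.2.map (fun v : Fin n => (v : ℕ)) ++ pairsCode ps) := by
  simp [pairsCode, List.map_eq_flatMap]

theorem length_pairsCode_cons {n : ℕ} (p : Fin n × List (Fin n))
    (ps : List (Fin n × List (Fin n))) :
    (pairsCode (p :: ps)).length = p.2.length + 2 + (pairsCode ps).length := by
  rw [pairsCode_cons]
  simp
  omega

/-- Marks in the table the set whose elements stand at `p`. -/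
def markSet : Cd :=
  forI .n (.set .inX .i .zero) ;;
  forI .l (.add .z .p .i ;; .get .y .inp .z ;; .set .inX .y .one) ;;
  pack .inX ;; .set .table .code .one

/-- Reads the next winning pair and marks its set if the position is `u`. -/
def pairStep : Cd :=
  .get .a .inp .p ;; .add .z .p .one ;; .get .l .inp .z ;; .add .p .z .one ;;
  .sub .z .a .u ;; .sub .y .u .a ;; .add .z .z .y ;; .ite .z skip markSet ;; .add .p .p .l

def scanProg : Cd := mov .p .ps ;; .forUp .one .q .t .tq pairStep

/-- For all `x < N` whose digit at `h` is `0` and such that `y = x + h` is marked, does `body`. -/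
def bitLoop (body : Cd) : Cd :=
  .const .c 0 ;;
  .forUp .one .x .N .tx
    -- `c` equals `x` modulo `2 h`, so the digit of `x` at `h` is `0` exactly if `c < h`.
    (.sub .z .h .c ;;
      .ite .z (.add .y .x .h ;; .get .z .table .y ;; .ite .z body skip) skip ;;
      -- The remainder is counted up along with `x` and reset when it reaches `2 h`.
      .add .c .c .one ;; .add .z .h .h ;; .sub .z .z .c ;; .ite .z skip (.const .c 0))

/-- Marks all subsets of marked sets. -/
def zetaProg : Cd :=
  .const .h 1 ;; .forUp .one .v .n .tv (bitLoop (.set .table .x .one) ;; .add .h .h .h)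

/-- Takes into account the winning pairs with position `u`, where `hu = 2^u`. -/
def posProg : Cd :=
  .forUp .one .x .N .tx (.set .table .x .zero) ;; scanProg ;; zetaProg ;; mov .h .hu ;;
  bitLoop (.set .cond .y .zero) ;; .add .hu .hu .hu

def condProg : Cd :=
  .forUp .one .x .N .tx (.set .cond .x .one) ;; .const .hu 1 ;; .forUp .one .u .n .tu posProg

/-! ### Binary digits and closure under subsets -/

theorem add_one_mod_eq {x m : ℕ} (hm : 0 < m) :
    (x + 1) % m = if m - (x % m + 1) ≠ 0 then x % m + 1 else 0 := by
  have h := Nat.mod_lt x hm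
  rw [← Nat.mod_add_mod]
  split_ifs with h'
  · exact Nat.mod_eq_of_lt (by omega)
  · rw [show x % m + 1 = m by omega, Nat.mod_self]

theorem mod_lt_iff {n x : ℕ} (v : Fin n) :
    x % 2 ^ ((v : ℕ) + 1) < 2 ^ (v : ℕ) ↔ v ∉ decodeSet n x := by
  rw [mod_two_pow_succ v]
  have : x % 2 ^ (v : ℕ) < 2 ^ (v : ℕ) := Nat.mod_lt _ (by positivity)
  split_ifs with h <;> simp [h, this]

/-- `X` is a subset of a set that satisfies `M` and has the same elements from `k` on. -/
def Below {n : ℕ} (M : Finset (Fin n) → Prop) (k : ℕ) (X : Finset (Fin n)) : Prop :=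
  ∃ S, M S ∧ X ⊆ S ∧ ∀ v ∈ S, k ≤ (v : ℕ) → v ∈ X

theorem below_zero {n : ℕ} {M : Finset (Fin n) → Prop} {X : Finset (Fin n)} :
    Below M 0 X ↔ M X := by
  constructor
  · rintro ⟨S, hS, h, h'⟩
    rwa [h.antisymm fun v hv => h' v hv (Nat.zero_le _)]
  · exact fun h => ⟨X, h, subset_rfl, fun _ h _ => h⟩

theorem below_top {n : ℕ} {M : Finset (Fin n) → Prop} {X : Finset (Fin n)} :
    Below M n X ↔ ∃ S, M S ∧ X ⊆ S :=
  exists_congr fun S => and_congr_right fun _ => and_iff_left fun v _ h => absurd v.2 (by omega)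

/-- If the witness `S` contains `v` but `X` does not, then `S` is a witness for `insert v X`;
otherwise it already is one for `X`. Thus the pass for digit `v` has to inspect one further entry
per set. -/
theorem below_succ {n : ℕ} {M : Finset (Fin n) → Prop} {X : Finset (Fin n)} (v : Fin n) :
    Below M (v + 1) X ↔ Below M v X ∨ (v ∉ X ∧ Below M v (insert v X)) := by
  constructor
  · rintro ⟨S, hS, h, h'⟩
    by_cases hv : v ∈ S ∧ v ∉ X
    · refine .inr ⟨hv.2, S, hS, Finset.insert_subset hv.1 h, fun w hw hvw => ?_⟩
      by_cases hwv : w = v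
      · exact hwv ▸ Finset.mem_insert_self _ _
      · have := mt Fin.val_inj.1 hwv
        exact Finset.mem_insert_of_mem (h' w hw (by omega))
    · refine .inl ⟨S, hS, h, fun w hw hvw => ?_⟩
      by_cases hwv : w = v
      · exact hwv ▸ by_contra fun hx => hv ⟨hwv ▸ hw, hx⟩
      · have := mt Fin.val_inj.1 hwv
        exact h' w hw (by omega)
  · rintro (⟨S, hS, h, h'⟩ | ⟨-, S, hS, h, h'⟩)
    · exact ⟨S, hS, h, fun w hw hvw => h' w hw (by omega)⟩
    · refine ⟨S, hS, (Finset.subset_insert _ _).trans h, fun w hw hvw => ?_⟩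
      have := Finset.mem_insert.1 (h' w hw (by omega))
      exact this.resolve_left fun e => by rw [e] at hvw; omega

section

variable {n e t len : ℕ} {B : Bounds Arr} {s : St} {X : Finset (Fin n)}

theorem wp_markSet (hB : Fits B n e len) (hs : Consts n e t s) {S : List (Fin n)}
    (hl : s.reg .l = S.length) (hS : S.length ≤ n)
    (hp : HoldsAt (s.arr .inp) (s.reg .p) (S.map fun v : Fin n => (v : ℕ)))
    (hlen : s.reg .p + S.length ≤ len) :
    wp B markSet (fun s' => s'.time ≤ s.time + 34 * n ∧
      s'.arr .table = Function.update (s.arr .table) (setCode S.toFinset) 1) s := by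
  have h1 := hB.n_le
  have h2 := hB.n_pos
  have h3 := hB.cell_le
  have h4 := hB.len_le
  rw [markSet, wp_seq]
  refine wp_forUp_time (fun k s' => ∀ v < k, s'.arr .inX v = 0) 5 (by decide) rfl hs.one
    (by rw [hs.n]; omega) (fun t v hv => absurd hv (Nat.not_lt_zero v)) ?_ ?_
  · intro k hk s₁ hs₁ hi hm
    rw [hs.n] at hk
    have hc₁ := hs.of_same hs₁ rfl
    simp only [wp_set, HState.tick_arr, HState.setReg_arr, HState.setArr_arr,
      HState.tick_time, HState.setArr_time, if_true, hi, hc₁.zero, hB.inX]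
    refine ⟨hk, by omega, by omega, fun x t v hv => ?_⟩
    by_cases hvk : v = k
    · simp [hvk]
    · rw [Function.update_of_ne hvk, hm v (by omega)]
  intro s₁ hs₁ ht₁ hX₁
  rw [hs.n] at ht₁ hX₁
  have hc₁ := hs.of_same hs₁ rfl
  have hl₁ : s₁.reg .l = S.length := (hs₁.1 _ rfl).trans hl
  have hp₁ : s₁.reg .p = s.reg .p := hs₁.1 _ rfl
  have hI₁ : s₁.arr .inp = s.arr .inp := hs₁.2 _ rfl
  rw [wp_seq]
  refine wp_forUp_time (fun k s' => IsBits s' .inX (S.take k).toFinset) 8 (by decide) rfl hc₁.one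
    (by rw [hl₁]; omega) (fun t v => by simpa using hX₁ v v.2) ?_ ?_
  · intro k hk s₂ hs₂ hi hm
    rw [hl₁] at hk
    have hc₂ := hc₁.of_same hs₂ rfl
    have hp₂ : s₂.reg .p = s.reg .p := (hs₂.1 _ rfl).trans hp₁
    have hI₂ : s₂.arr .inp = s.arr .inp := (hs₂.2 _ rfl).trans hI₁
    have hk' := hp k (by simpa using hk)
    rw [List.getElem_map] at hk'
    simp only [wp_seq, wp_add, wp_get, wp_set, HState.tick_reg, HState.setReg_reg, reduceCtorEq,
      if_false, if_true, HState.tick_arr, HState.setReg_arr, HState.tick_time,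
      HState.setReg_time, HState.setArr_time, hi, hp₂, hI₂, hc₂.one, hB.inp, hB.inX, hk']
    refine ⟨by omega, by omega, (S[k]).2, by omega, by omega, fun x t v => ?_⟩
    rw [List.take_succ_eq_append_getElem hk]
    simp only [HState.tick_arr, HState.setReg_arr, HState.setArr_arr, if_true, List.mem_toFinset,
      List.mem_append, List.mem_singleton]
    by_cases hv : v = S[k]
    · simp [hv]
    · rw [Function.update_of_ne (mt Fin.val_inj.1 hv), hm v]
      simp [hv]
  intro s₂ hs₂ ht₂ hX₂
  rw [hl₁] at ht₂ hX₂
  rw [List.take_length] at hX₂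
  have hc₂ := hc₁.of_same hs₂ rfl
  rw [wp_seq]
  refine (wp_pack hB hc₂ hB.inX hX₂).mono ?_
  rintro s₃ hs₃ ⟨hcode, ht₃⟩
  have hc₃ := hc₂.of_same hs₃ rfl
  have hT₃ : s₃.arr .table = s.arr .table :=
    ((hs₃.2 _ rfl).trans (hs₂.2 _ rfl)).trans (hs₁.2 _ rfl)
  have hlt := setCode_lt S.toFinset
  simp only [wp_set, HState.tick_arr, HState.setArr_arr, HState.tick_time, HState.setArr_time,
    if_true, hcode, hc₃.one, hB.table, hT₃]
  refine ⟨by omega, by omega, by omega, trivial⟩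

/-- Pairs with another position are skipped in constant time with the help of the stored
cardinality. Only pairs with position `u` cost `O(n)`, so over all `u` each pair is expensive once.
-/
theorem wp_scanProg (hB : Fits B n e len) (hs : Consts n e t s) (u : Fin n)
    {ps : List (Fin n × List (Fin n))} (hu : s.reg .u = u) (ht : ps.length = t)
    (htB : t ≤ B.regMax) (hS : ∀ p ∈ ps, p.2.length ≤ n)
    (hp : HoldsAt (s.arr .inp) (s.reg .ps) (pairsCode ps))
    (hlen : s.reg .ps + (pairsCode ps).length ≤ len)
    (h0 : ∀ X : Finset (Fin n), s.arr .table (setCode X) = 0) :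
    wp B scanProg (fun s' =>
      s'.time ≤ s.time + (15 * t + 34 * n * ps.countP (fun p => p.1 = u) + 4) ∧
      ∀ X : Finset (Fin n),
        s'.arr .table (setCode X) ≠ 0 ↔ ∃ p ∈ ps, p.1 = u ∧ p.2.toFinset = X) s := by
  have h1 := hB.n_le
  have h3 := hB.cell_le
  have h4 := hB.len_le
  have hun := u.2
  rw [scanProg, wp_seq, mov, wp_add]
  refine ⟨by rw [hs.zero]; omega, ?_⟩
  refine wp_forUp (fun k s' => s'.time ≤
      s.time + (15 * k + 34 * n * (ps.take k).countP (fun p => p.1 = u) + 4) ∧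
      HoldsAt (s'.arr .inp) (s'.reg .p) (pairsCode (ps.drop k)) ∧
      s'.reg .p + (pairsCode (ps.drop k)).length ≤ len ∧ ∀ X : Finset (Fin n),
        s'.arr .table (setCode X) ≠ 0 ↔ ∃ p ∈ ps.take k, p.1 = u ∧ p.2.toFinset = X)
    (by decide) rfl (by simp [hs.one]) (by simpa [hs.t] using htB) ?_ ?_ ?_
  · refine ⟨by simp, by simpa [hs.zero] using hp, by simpa [hs.zero] using hlen, by simp [h0]⟩
  · rintro k hk s₁ hs₁ hi ⟨ht₁, hp₁, hl₁, hT₁⟩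
    simp only [HState.tick_reg, HState.setReg_reg, reduceCtorEq, if_false, hs.t] at hk
    have hkp : k < ps.length := by omega
    have hc₁ : Consts n e t s₁ := (hs.congr (s' := (s.setReg .p (s.reg .ps + s.reg .zero)).tick 1)
      (by simp)).of_same hs₁ rfl
    have hu₁ : s₁.reg .u = u := by rw [hs₁.1 _ rfl]; simp [hu]
    rw [List.drop_eq_getElem_cons hkp, pairsCode_cons, holdsAt_cons, holdsAt_cons,
      holdsAt_append] at hp₁
    obtain ⟨ha, hl, hS₁, hrest⟩ := hp₁
    rw [List.drop_eq_getElem_cons hkp, length_pairsCode_cons] at hl₁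
    have hSk := hS _ (List.getElem_mem hkp)
    have hpk := (ps[k]).1.2
    rw [List.length_map] at hrest
    simp only [pairStep, wp_seq, wp_add, wp_sub, wp_get, HState.tick_reg, HState.setReg_reg,
      reduceCtorEq, if_false, if_true, HState.tick_arr, HState.setReg_arr, hc₁.one, ha, hl, hu₁,
      hB.inp]
    refine ⟨by omega, by omega, by omega, by omega, by omega, by omega, by omega, ?_⟩
    set s₂ := ((((((((((((((s₁.setReg .a (ps[k]).1).tick 2).setReg .z (s₁.reg .p + 1)).tick 1).setReg
      .l (ps[k]).2.length).tick 2).setReg .p (s₁.reg .p + 1 + 1)).tick 1).setReg .z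
      ((ps[k]).1 - u)).tick 1).setReg .y (u - (ps[k]).1)).tick 1).setReg .z
      ((ps[k]).1 - u + (u - (ps[k]).1))).tick 1) with hs₂
    have hc₂ : Consts n e t s₂ := hc₁.congr (by simp [hs₂])
    have hp₂ : s₂.reg .p = s₁.reg .p + 1 + 1 := by simp [hs₂]
    have hl₂ : s₂.reg .l = (ps[k]).2.length := by simp [hs₂]
    have hz₂ : s₂.reg .z = (ps[k]).1 - u + (u - (ps[k]).1) := by simp [hs₂]
    have ht₂ : s₂.time = s₁.time + 9 := rfl
    have hA₂ : s₂.arr = s₁.arr := rfl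
    have hbranch : wp B (.ite .z skip markSet) (fun s' =>
        s'.time ≤ s₁.time + 11 + (if (ps[k]).1 = u then 34 * n else 0) ∧ ∀ X : Finset (Fin n),
          s'.arr .table (setCode X) ≠ 0 ↔ (∃ p ∈ ps.take k, p.1 = u ∧ p.2.toFinset = X) ∨
            ((ps[k]).1 = u ∧ (ps[k]).2.toFinset = X)) s₂ := by
      rw [wp_ite, hz₂]
      by_cases heq : (ps[k]).1 = u
      · rw [if_neg (by rw [heq]; omega)]
        refine wp.mono (wp_markSet (s := s₂.tick 1) (S := (ps[k]).2) hB (hc₂.congr (by simp)) hl₂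
          hSk (by rw [HState.tick_arr, hA₂, HState.tick_reg, hp₂]; exact hS₁) ?_) ?_
        · rw [HState.tick_reg, hp₂]; omega
        · rintro s₃ - ⟨ht₃, hT₃⟩
          rw [HState.tick_time, ht₂] at ht₃
          refine ⟨by rw [if_pos heq]; omega, fun X => ?_⟩
          rw [hT₃, HState.tick_arr, hA₂]
          by_cases hX : X = (ps[k]).2.toFinset
          · simp [hX, heq]
          · rw [Function.update_of_ne (setCode_injective.ne hX), hT₁]
            simp [Ne.symm hX]
      · have := mt Fin.val_inj.1 heq
        rw [if_pos (by omega), skip, wp_const]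
        refine ⟨Nat.zero_le _, ?_, fun X => ?_⟩
        · simp only [HState.tick_time, HState.setReg_time, ht₂]
          omega
        · simp only [HState.tick_arr, HState.setReg_arr, hA₂, hT₁]
          simp [heq]
    refine hbranch.mono ?_
    rintro s₃ hs₃ ⟨ht₃, hT₃⟩
    have hp₃ : s₃.reg .p = s₁.reg .p + 1 + 1 := (hs₃.1 _ rfl).trans hp₂
    have hl₃ : s₃.reg .l = (ps[k]).2.length := (hs₃.1 _ rfl).trans hl₂
    have hA₃ : s₃.arr .inp = s₁.arr .inp := hs₃.2 _ rfl
    rw [wp_add]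
    simp only [HState.tick_reg, HState.setReg_reg, if_true,
      HState.tick_arr, HState.setReg_arr, HState.tick_time, HState.setReg_time, hp₃, hl₃, hA₃]
    refine ⟨by omega, ?_, hrest, by omega, fun X => ?_⟩
    · rw [List.take_succ_eq_append_getElem hkp, List.countP_append, List.countP_singleton]
      by_cases heq : (ps[k]).1 = u
      · simp only [heq, if_true, decide_true, mul_add, mul_one] at ht₃ ⊢
        omega
      · simp only [heq, if_false, decide_false, mul_add] at ht₃ ⊢
        simp
        omega
    · rw [hT₃, List.take_succ_eq_append_getElem hkp]
      simp only [List.mem_append, List.mem_singleton, or_and_right, exists_or, exists_eq_left]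
  · rintro s₁ hs₁ ⟨ht₁, -, -, hT₁⟩
    simp only [HState.tick_reg, HState.setReg_reg, reduceCtorEq, if_false, hs.t] at ht₁ hT₁
    rw [List.take_of_length_le ht.le] at ht₁ hT₁
    exact ⟨ht₁, hT₁⟩

/-- `Inv k` describes the arrays when the sets with numbers below `k` have been treated. Both uses
of the loop, the closure under subsets and the update of `cond`, are instances. -/
theorem wp_bitLoop (hB : Fits B n e len) (hs : Consts n e t s) (v : Fin n) {body : Cd}
    (hw : ∀ r, body.writesReg r = false) (Inv : ℕ → (Arr → ℕ → ℕ) → Prop)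
    (hh : s.reg .h = 2 ^ (v : ℕ)) (h0 : Inv 0 s.arr)
    (hskip : ∀ X : Finset (Fin n), ∀ a, Inv (setCode X) a →
      (v ∉ X → a .table (setCode (insert v X)) = 0) → Inv (setCode X + 1) a)
    (hbody : ∀ X : Finset (Fin n), ∀ s', v ∉ X → Inv (setCode X) s'.arr →
      s'.arr .table (setCode (insert v X)) ≠ 0 → s'.reg .x = setCode X →
      s'.reg .y = setCode (insert v X) → Consts n e t s' →
      wp B body (fun s'' => s''.time ≤ s'.time + 2 ∧ Inv (setCode X + 1) s''.arr) s') :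
    wp B (bitLoop body) (fun s' => s'.time ≤ s.time + 16 * 2 ^ n + 4 ∧ Inv (2 ^ n) s'.arr) s := by
  have h4 := hB.pow_le
  have hpow : 2 ^ (v : ℕ) * 2 ≤ 2 ^ n := by
    rw [← pow_succ]
    exact Nat.pow_le_pow_right two_pos v.2
  have hpos : 0 < 2 ^ (v : ℕ) := by positivity
  rw [bitLoop, wp_seq, wp_const]
  refine ⟨Nat.zero_le _, ?_⟩
  refine wp_forUp_time (fun k s' => s'.reg .c = k % 2 ^ ((v : ℕ) + 1) ∧ Inv k s'.arr) 16
    (by decide) ?_ (by simp [hs.one]) ?_ ?_ ?_ ?_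
  · simp [Cmd.keeps, Cmd.writesReg, hw, skip]
  · simp only [HState.tick_reg, HState.setReg_reg, reduceCtorEq, if_false, hs.N]
    omega
  · exact fun t => ⟨by simp, h0⟩
  · rintro k hk s₁ hs₁ hi ⟨hc, hI⟩
    simp only [HState.tick_reg, HState.setReg_reg, reduceCtorEq, if_false, hs.N] at hk
    have hc₁ : Consts n e t s₁ := by
      refine hs.congr fun r hr => ?_
      rw [hs₁.1 r]
      · simp only [List.mem_cons, List.not_mem_nil, or_false] at hr
        rcases hr with rfl | rfl | rfl | rfl | rfl | rfl <;> rfl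
      · simp only [List.mem_cons, List.not_mem_nil, or_false] at hr
        rcases hr with rfl | rfl | rfl | rfl | rfl | rfl <;>
          simp [Cmd.forUp, Cmd.writesReg, hw, skip]
    have hh₁ : s₁.reg .h = 2 ^ (v : ℕ) := by
      rw [hs₁.1 _ (by simp [Cmd.forUp, Cmd.writesReg, hw, skip])]
      simp [hh]
    obtain ⟨X, rfl⟩ : ∃ X : Finset (Fin n), setCode X = k := ⟨_, setCode_decodeSet hk⟩
    have hdig := mod_lt_iff (x := setCode X) v
    rw [decodeSet_setCode] at hdig
    have hmod : setCode X % 2 ^ ((v : ℕ) + 1) < 2 ^ ((v : ℕ) + 1) := Nat.mod_lt _ (by positivity)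
    have hnext := add_one_mod_eq (x := setCode X) (m := 2 ^ ((v : ℕ) + 1)) (by positivity)
    rw [pow_succ] at hdig hmod hnext hc
    simp only [pow_succ]
    rw [wp_seq, wp_sub, wp_seq]
    refine ⟨by rw [hh₁]; omega, ?_⟩
    set s₂ := (s₁.setReg .z (s₁.reg .h - s₁.reg .c)).tick 1 with hs₂
    have hbranch : wp B (.ite .z (.add .y .x .h ;; .get .z .table .y ;; .ite .z body skip) skip)
        (fun s' => s'.time ≤ s₁.time + 8 ∧ Inv (setCode X + 1) s'.arr) s₂ := by
      rw [wp_ite]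
      by_cases hv : v ∈ X
      · have := (not_congr hdig).2 (not_not.2 hv)
        rw [if_neg (by simp [hs₂, hh₁, hc]; omega), skip, wp_const]
        refine ⟨Nat.zero_le _, ?_, hskip X _ hI fun h => absurd hv h⟩
        simp [hs₂]
      · have hlt := hdig.2 hv
        have hins := setCode_lt (insert v X)
        rw [if_pos (by simp [hs₂, hh₁, hc]; omega)]
        rw [setCode_insert hv] at hins
        simp only [wp_seq, wp_add, wp_get, HState.tick_reg, HState.setReg_reg, reduceCtorEq,
          if_false, if_true, HState.tick_arr, HState.setReg_arr, hs₂, hi, hh₁, hB.table]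
        refine ⟨by omega, by omega, ?_⟩
        rw [wp_ite]
        simp only [HState.tick_reg, HState.setReg_reg, if_true]
        split_ifs with hz
        · rw [← setCode_insert hv] at hz
          refine wp.mono (hbody X _ hv hI hz ?_ ?_ (hc₁.congr ?_)) ?_
          · simpa using hi
          · simp [setCode_insert hv]
          · simp
          · rintro s₃ - ⟨ht₃, hI₃⟩
            refine ⟨ht₃.trans ?_, hI₃⟩
            simp only [HState.tick_time, HState.setReg_time]
            omega
        · rw [skip, wp_const]
          refine ⟨Nat.zero_le _, ?_, hskip X _ hI fun h => ?_⟩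
          · simp only [HState.tick_time, HState.setReg_time]
            omega
          · rw [setCode_insert h]
            exact not_not.1 hz
    refine hbranch.mono ?_
    rintro s₃ hs₃ ⟨ht₃, hI₃⟩
    have hc₃ : s₃.reg .c = setCode X % (2 ^ (v : ℕ) * 2) := by
      rw [hs₃.1 _ (by simp [Cmd.writesReg, hw, skip])]
      simp [hs₂, hc]
    have hh₃ : s₃.reg .h = 2 ^ (v : ℕ) := by
      rw [hs₃.1 _ (by simp [Cmd.writesReg, hw, skip])]
      simp [hs₂, hh₁]
    have ho₃ : s₃.reg .one = 1 := by
      rw [hs₃.1 _ (by simp [Cmd.writesReg, hw, skip])]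
      simp [hs₂, hc₁.one]
    simp only [wp_seq, wp_add, wp_sub, wp_ite, skip, wp_const, HState.tick_reg, HState.setReg_reg,
      reduceCtorEq, if_false, if_true, HState.tick_arr, HState.setReg_arr, HState.tick_time,
      HState.setReg_time, hc₃, hh₃, ho₃]
    refine ⟨by omega, by omega, by omega, ?_⟩
    rw [← mul_two]
    split_ifs at hnext ⊢ with hz
    · refine ⟨Nat.zero_le _, by omega, fun _ _ => ⟨hnext.symm, hI₃⟩⟩
    · refine ⟨Nat.zero_le _, by omega, fun _ _ => ⟨hnext.symm, hI₃⟩⟩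
  · rintro s₁ hs₁ ht₁ ⟨-, hI⟩
    simp only [HState.tick_reg, HState.setReg_reg, reduceCtorEq, if_false, hs.N, HState.tick_time,
      HState.setReg_time] at ht₁ hI
    exact ⟨by omega, hI⟩

theorem wp_zetaProg (hB : Fits B n e len) (hs : Consts n e t s) {M : Finset (Fin n) → Prop}
    (hM : ∀ X : Finset (Fin n), s.arr .table (setCode X) ≠ 0 ↔ M X) :
    wp B zetaProg (fun s' => s'.time ≤ s.time + 24 * (2 ^ n * n) + 4 ∧ ∀ X : Finset (Fin n),
      s'.arr .table (setCode X) ≠ 0 ↔ ∃ S, M S ∧ X ⊆ S) s := by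
  have h1 := hB.n_le
  have h2 := hB.n_pos
  have h3 := hB.cell_le
  have h4 := hB.pow_le
  have hN : 1 ≤ 2 ^ n := Nat.one_le_two_pow
  rw [zetaProg, wp_seq, wp_const]
  refine ⟨by omega, ?_⟩
  -- `Below M k` describes the marks after the passes for the digits below `k`.
  refine wp_forUp_time (fun k s' => s'.reg .h = 2 ^ k ∧ ∀ X : Finset (Fin n),
    s'.arr .table (setCode X) ≠ 0 ↔ Below M k X) (16 * 2 ^ n + 8) (by decide) rfl
    (by simp [hs.one]) ?_ ?_ ?_ ?_
  · simp only [HState.tick_reg, HState.setReg_reg, reduceCtorEq, if_false, hs.n]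
    omega
  · exact fun t => ⟨by simp, fun X => by simp [hM, below_zero]⟩
  · rintro k hk s₁ hs₁ hi ⟨hh, hT⟩
    simp only [HState.tick_reg, HState.setReg_reg, reduceCtorEq, if_false, hs.n] at hk
    have hc₁ : Consts n e t s₁ := (hs.congr (s' := (s.setReg .h 1).tick 1)
      (by simp)).of_same hs₁ rfl
    rw [wp_seq]
    obtain ⟨v, rfl⟩ : ∃ v : Fin n, (v : ℕ) = k := ⟨⟨k, hk⟩, rfl⟩
    -- The pass can work in place: the entry of `insert v X`, which is consulted for `X`, has a
    -- larger number and so still has its old value.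
    refine (wp_bitLoop hB hc₁ v (fun _ => rfl) (fun m a => ∀ X : Finset (Fin n),
      a .table (setCode X) ≠ 0 ↔ if setCode X < m then Below M (v + 1) X else Below M v X)
      hh (by simpa using hT) ?_ ?_).mono ?_
    · intro Y a hI hz X
      rw [hI]
      by_cases hXY : X = Y
      · subst hXY
        simp only [lt_self_iff_false, if_false, Nat.lt_succ_self, if_true, below_succ v]
        refine ⟨.inl, fun h => h.resolve_right fun h' => ?_⟩
        have hlt : ¬ setCode (insert v X) < setCode X := by rw [setCode_insert h'.1]; omega
        have := hI (insert v X)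
        rw [if_neg hlt] at this
        exact this.2 h'.2 (hz h'.1)
      · have : setCode X < setCode Y + 1 ↔ setCode X < setCode Y := by
          have := setCode_injective.ne hXY
          omega
        simp only [this]
    · intro Y s' hv hI hz hx hy hc
      have hlt := setCode_lt Y
      simp only [wp_set, HState.tick_arr, HState.setArr_arr, HState.tick_time, HState.setArr_time,
        if_true, hx, hc.one, hB.table]
      refine ⟨by omega, by omega, le_rfl, fun X => ?_⟩
      by_cases hXY : X = Y
      · subst hXY
        have hlt : ¬ setCode (insert v X) < setCode X := by rw [setCode_insert hv]; omega
        have := hI (insert v X)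
        rw [if_neg hlt] at this
        simp [below_succ v, hv, this.1 hz]
      · have hne := setCode_injective.ne hXY
        have : setCode X < setCode Y + 1 ↔ setCode X < setCode Y := by omega
        rw [Function.update_of_ne hne, hI]
        simp only [this]
    · rintro s₂ hs₂ ⟨ht₂, hT₂⟩
      have hh₂ : s₂.reg .h = 2 ^ (v : ℕ) := (hs₂.1 _ rfl).trans hh
      have hpow : 2 ^ (v : ℕ) * 2 ≤ 2 ^ n := by
        rw [← pow_succ]
        exact Nat.pow_le_pow_right two_pos v.2
      simp only [wp_add, HState.tick_reg, HState.setReg_reg, reduceCtorEq, if_false, if_true,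
        HState.tick_arr, HState.setReg_arr, HState.tick_time, HState.setReg_time, hh₂]
      refine ⟨by omega, by omega, fun _ _ => ⟨by rw [pow_succ]; omega, fun X => ?_⟩⟩
      rw [hT₂, if_pos (setCode_lt X)]
  · rintro s₁ hs₁ ht₁ ⟨-, hT⟩
    simp only [HState.tick_reg, HState.setReg_reg, reduceCtorEq, if_false, hs.n, HState.tick_time,
      HState.setReg_time] at ht₁ hT
    refine ⟨?_, fun X => (hT X).trans below_top⟩
    have : n ≤ 2 ^ n * n := Nat.le_mul_of_pos_left n hN
    have h5 : n * (16 * 2 ^ n + 8) = 16 * (2 ^ n * n) + 8 * n := by ring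
    omega

end

section

variable {n e t len : ℕ} {B : Bounds Arr} {s : St}

theorem wp_posProg (hB : Fits B n e len) (hs : Consts n e t s) (u : Fin n)
    {ps : List (Fin n × List (Fin n))} (hu : s.reg .u = u) (hhu : s.reg .hu = 2 ^ (u : ℕ))
    (ht : ps.length = t) (htB : t ≤ B.regMax) (hS : ∀ p ∈ ps, p.2.length ≤ n)
    (hp : HoldsAt (s.arr .inp) (s.reg .ps) (pairsCode ps))
    (hlen : s.reg .ps + (pairsCode ps).length ≤ len) (F : Finset (Fin n) → Prop)
    [DecidablePred F]
    (hF : ∀ X : Finset (Fin n), s.arr .cond (setCode X) = if F X then 0 else 1) :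
    wp B posProg (fun s' =>
      s'.time ≤ s.time + (15 * t + 34 * n * ps.countP (fun p => p.1 = u) + 62 * (2 ^ n * n)) ∧
      s'.reg .hu = 2 ^ (u + 1 : ℕ) ∧ ∀ X : Finset (Fin n), s'.arr .cond (setCode X) =
        if F X ∨ (u ∈ X ∧ ∃ p ∈ ps, p.1 = u ∧ X ⊆ p.2.toFinset) then 0 else 1) s := by
  have h1 := hB.n_le
  have h2 := hB.n_pos
  have h4 := hB.pow_le
  have hN : 1 ≤ 2 ^ n := Nat.one_le_two_pow
  have hN2 : 2 ≤ 2 ^ n := Nat.le_self_pow (by omega) 2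
  have hNn : 2 ^ n ≤ 2 ^ n * n := Nat.le_mul_of_pos_right _ h2
  have hpow : 2 ^ (u : ℕ) * 2 ≤ 2 ^ n := by
    rw [← pow_succ]
    exact Nat.pow_le_pow_right two_pos u.2
  rw [posProg, wp_seq]
  refine wp_forUp_time (fun k s' => ∀ x < k, s'.arr .table x = 0) 5 (by decide) rfl hs.one
    (by rw [hs.N]; omega) (fun t v hv => absurd hv (Nat.not_lt_zero v)) ?_ ?_
  · intro k hk s₁ hs₁ hi hm
    rw [hs.N] at hk
    have hc₁ := hs.of_same hs₁ rfl
    simp only [wp_set, HState.tick_arr, HState.setReg_arr, HState.setArr_arr,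
      HState.tick_time, HState.setArr_time, if_true, hi, hc₁.zero, hB.table]
    refine ⟨by omega, by omega, by omega, fun x t v hv => ?_⟩
    by_cases hvk : v = k
    · simp [hvk]
    · rw [Function.update_of_ne hvk, hm v (by omega)]
  intro s₁ hs₁ ht₁ hT₁
  rw [hs.N] at ht₁ hT₁
  have hc₁ := hs.of_same hs₁ rfl
  have hp₁ : s₁.reg .ps = s.reg .ps := hs₁.1 _ rfl
  have hI₁ : s₁.arr .inp = s.arr .inp := hs₁.2 _ rfl
  rw [wp_seq]
  refine (wp_scanProg hB hc₁ u ((hs₁.1 _ rfl).trans hu) ht htB hS (by rw [hI₁, hp₁]; exact hp)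
    (by rw [hp₁]; exact hlen) fun X => hT₁ _ (setCode_lt X)).mono ?_
  rintro s₂ hs₂ ⟨ht₂, hT₂⟩
  have hc₂ := hc₁.of_same hs₂ rfl
  rw [wp_seq]
  refine (wp_zetaProg hB hc₂ hT₂).mono ?_
  rintro s₃ hs₃ ⟨ht₃, hT₃⟩
  have hc₃ := hc₂.of_same hs₃ rfl
  have hhu₃ : s₃.reg .hu = 2 ^ (u : ℕ) :=
    (((hs₃.1 _ rfl).trans (hs₂.1 _ rfl)).trans (hs₁.1 _ rfl)).trans hhu
  have hF₃ : s₃.arr .cond = s.arr .cond :=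
    ((hs₃.2 _ rfl).trans (hs₂.2 _ rfl)).trans (hs₁.2 _ rfl)
  rw [wp_seq, mov, wp_add, hhu₃, hc₃.zero, wp_seq]
  refine ⟨by omega, ?_⟩
  have hc₄ : Consts n e t ((s₃.setReg .h (2 ^ (u : ℕ) + 0)).tick 1) := hc₃.congr (by simp)
  -- The loop runs through the sets without `u`, so a set `X` with `u ∈ X` is treated when the
  -- counter equals the number of `X.erase u`.
  refine (wp_bitLoop hB hc₄ u (fun _ => rfl) (fun m a => a .table = s₃.arr .table ∧
    ∀ X : Finset (Fin n), a .cond (setCode X) = if F X ∨ (u ∈ X ∧ setCode (X.erase u) < m ∧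
      s₃.arr .table (setCode X) ≠ 0) then 0 else 1) (by simp) ?_ ?_ ?_).mono ?_
  · simp [hF₃, hF]
  · rintro Y a ⟨ha, hI⟩ hz
    refine ⟨ha, fun X => ?_⟩
    rw [hI]
    by_cases hu : u ∈ X
    · by_cases hY : X.erase u = Y
      · have huY : u ∉ Y := hY ▸ Finset.notMem_erase u X
        have := hz huY
        rw [ha, ← hY, Finset.insert_erase hu] at this
        simp [this]
      · have hne := setCode_injective.ne hY
        simp only [show setCode (X.erase u) < setCode Y + 1 ↔ setCode (X.erase u) < setCode Y by
          omega]
    · simp [hu]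
  · rintro Y s' hv ⟨ha, hI⟩ hz hx hy hc
    have hlt := setCode_lt (insert u Y)
    simp only [wp_set, HState.tick_arr, HState.setArr_arr, HState.tick_time, HState.setArr_time,
      if_true, reduceCtorEq, if_false, hy, hc.zero, hB.cond]
    refine ⟨hlt, Nat.zero_le _, le_rfl, ha, fun X => ?_⟩
    by_cases hX : X = insert u Y
    · rw [ha] at hz
      simp [hX, Finset.erase_insert hv, hz]
    · rw [Function.update_of_ne (setCode_injective.ne hX), hI]
      by_cases hu : u ∈ X
      · have hne : setCode (X.erase u) ≠ setCode Y := setCode_injective.ne fun h =>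
          hX (by rw [← h, Finset.insert_erase hu])
        simp only [show setCode (X.erase u) < setCode Y + 1 ↔ setCode (X.erase u) < setCode Y by
          omega]
      · simp [hu]
  · rintro s₄ hs₄ ⟨ht₄, -, hF₄⟩
    have hhu₄ : s₄.reg .hu = 2 ^ (u : ℕ) := by
      rw [hs₄.1 _ rfl]
      simp [hhu₃]
    rw [HState.tick_time, HState.setReg_time] at ht₄
    simp only [wp_add, HState.tick_reg, HState.setReg_reg, if_true,
      HState.tick_arr, HState.setReg_arr, HState.tick_time, HState.setReg_time, hhu₄]
    refine ⟨by omega, by omega, by rw [pow_succ]; omega, fun X => ?_⟩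
    rw [hF₄]
    congr 1
    simp only [setCode_lt, true_and, hT₃, eq_iff_iff]
    refine or_congr_right (and_congr_right fun _ => ?_)
    constructor
    · rintro ⟨S, ⟨p, hp, hpu, rfl⟩, hX⟩
      exact ⟨p, hp, hpu, hX⟩
    · rintro ⟨p, hp, hpu, hX⟩
      exact ⟨_, ⟨p, hp, hpu, rfl⟩, hX⟩

/-- Each of the `n` rounds takes `O(t + 2^n n)` steps plus `O(n)` for each pair with the position of
the round. The latter terms add up to `O(n t)`, and `t ≤ 2^n n`. -/
theorem wp_condProg (hB : Fits B n e len) (hs : Consts n e t s)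
    {ps : List (Fin n × List (Fin n))} (ht : ps.length = t) (htB : t ≤ B.regMax)
    (htn : t ≤ 2 ^ n * n) (hS : ∀ p ∈ ps, p.2.length ≤ n)
    (hp : HoldsAt (s.arr .inp) (s.reg .ps) (pairsCode ps))
    (hlen : s.reg .ps + (pairsCode ps).length ≤ len) :
    wp B condProg (fun s' => s'.time ≤ s.time + 130 * (2 ^ n * n ^ 2) ∧
      ∀ X : Finset (Fin n), s'.arr .cond (setCode X) =
        if ∃ p ∈ ps, p.1 ∈ X ∧ X ⊆ p.2.toFinset then 0 else 1) s := by
  have h1 := hB.n_le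
  have h2 := hB.n_pos
  have h3 := hB.cell_le
  have h4 := hB.pow_le
  have hN : 1 ≤ 2 ^ n := Nat.one_le_two_pow
  rw [condProg, wp_seq]
  refine wp_forUp_time (fun k s' => ∀ x < k, s'.arr .cond x = 1) 5 (by decide) rfl hs.one
    (by rw [hs.N]; omega) (fun t v hv => absurd hv (Nat.not_lt_zero v)) ?_ ?_
  · intro k hk s₁ hs₁ hi hm
    rw [hs.N] at hk
    have hc₁ := hs.of_same hs₁ rfl
    simp only [wp_set, HState.tick_arr, HState.setReg_arr, HState.setArr_arr,
      HState.tick_time, HState.setArr_time, if_true, hi, hc₁.one, hB.cond]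
    refine ⟨by omega, by omega, by omega, fun x t v hv => ?_⟩
    by_cases hvk : v = k
    · simp [hvk]
    · rw [Function.update_of_ne hvk, hm v (by omega)]
  intro s₁ hs₁ ht₁ hF₁
  rw [hs.N] at ht₁ hF₁
  have hc₁ := hs.of_same hs₁ rfl
  have hp₁ : s₁.reg .ps = s.reg .ps := hs₁.1 _ rfl
  have hI₁ : s₁.arr .inp = s.arr .inp := hs₁.2 _ rfl
  rw [wp_seq, wp_const]
  refine ⟨by omega, ?_⟩
  set s₂ := (s₁.setReg .hu 1).tick 1 with hs₂
  have hc₂ : Consts n e t s₂ := hc₁.congr (by simp [hs₂])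
  -- The costs of the rounds differ, so the invariant counts the pairs with positions below `k` that
  -- have been read.
  refine wp_forUp (fun k s' => s'.time ≤ s₂.time +
      (k * (15 * t + 62 * (2 ^ n * n) + 3) + 34 * n * ps.countP (fun p => (p.1 : ℕ) < k) + 3) ∧
      s'.reg .hu = 2 ^ k ∧ ∀ X : Finset (Fin n), s'.arr .cond (setCode X) =
        if ∃ p ∈ ps, (p.1 : ℕ) < k ∧ p.1 ∈ X ∧ X ⊆ p.2.toFinset then 0 else 1)
    (by decide) rfl hc₂.one (by rw [hc₂.n]; omega) ?_ ?_ ?_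
  · refine ⟨by simp, by simp [hs₂], fun X => ?_⟩
    simp [hs₂, hF₁ _ (setCode_lt X)]
  · rintro k hk s₃ hs₃ hi ⟨ht₃, hh₃, hF₃⟩
    rw [hc₂.n] at hk
    obtain ⟨u, rfl⟩ : ∃ u : Fin n, (u : ℕ) = k := ⟨⟨k, hk⟩, rfl⟩
    have hc₃ := hc₂.of_same hs₃ rfl
    have hp₃ : s₃.reg .ps = s.reg .ps := ((hs₃.1 _ rfl).trans (by simp [hs₂])).trans hp₁
    have hI₃ : s₃.arr .inp = s.arr .inp := ((hs₃.2 _ rfl).trans (by simp [hs₂])).trans hI₁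
    refine (wp_posProg hB hc₃ u hi hh₃ ht htB hS (by rw [hI₃, hp₃]; exact hp)
      (by rw [hp₃]; exact hlen) _ hF₃).mono ?_
    rintro s₄ hs₄ ⟨ht₄, hh₄, hF₄⟩
    simp only [HState.tick_reg, HState.setReg_reg, reduceCtorEq, if_false, HState.tick_arr,
      HState.setReg_arr, HState.tick_time, HState.setReg_time]
    have hcount : ps.countP (fun p => (p.1 : ℕ) < u + 1) =
        ps.countP (fun p => (p.1 : ℕ) < u) + ps.countP (fun p => p.1 = u) := by
      clear * -
      induction ps with
      | nil => rfl
      | cons p ps ih =>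
        simp only [List.countP_cons, ih, decide_eq_true_eq, Fin.ext_iff]
        split_ifs <;> omega
    refine ⟨?_, hh₄, fun X => ?_⟩
    · rw [hcount]
      linarith
    · rw [hF₄]
      congr 1
      rw [eq_iff_iff]
      constructor
      · rintro (⟨p, hp, hlt, h⟩ | ⟨hu, p, hp, rfl, h⟩)
        · exact ⟨p, hp, by omega, h⟩
        · exact ⟨p, hp, by omega, hu, h⟩
      · rintro ⟨p, hp, hlt, hu, h⟩
        by_cases hpu : p.1 = u
        · exact .inr ⟨hpu ▸ hu, p, hp, hpu, h⟩
        · have := mt Fin.val_inj.1 hpu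
          exact .inl ⟨p, hp, by omega, hu, h⟩
  · rintro s₃ hs₃ ⟨ht₃, -, hF₃⟩
    rw [hc₂.n] at ht₃ hF₃
    have hcount : ps.countP (fun p => (p.1 : ℕ) < n) ≤ 2 ^ n * n :=
      List.countP_le_length.trans (ht.le.trans htn)
    have ht₂ : s₂.time = s₁.time + 1 := rfl
    refine ⟨?_, fun X => by simp only [hF₃, Fin.is_lt, true_and]⟩
    have e1 := Nat.mul_le_mul_left (34 * n) hcount
    have e2 := Nat.mul_le_mul_left n htn
    have e3 : n * (15 * t + 62 * (2 ^ n * n) + 3) = 15 * (n * t) + 62 * (2 ^ n * n ^ 2) + 3 * n := by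
      ring
    have e4 : 34 * n * (2 ^ n * n) = 34 * (2 ^ n * n ^ 2) := by ring
    have e5 : n * (2 ^ n * n) = 2 ^ n * n ^ 2 := by ring
    have e6 : n ≤ 2 ^ n * n ^ 2 := by
      rw [← e5]
      exact Nat.le_mul_of_pos_right _ (Nat.mul_pos hN h2)
    have e7 : 2 ^ n ≤ 2 ^ n * n ^ 2 := Nat.le_mul_of_pos_right _ (pow_pos h2 2)
    omega

end

/-! ### Input -/

theorem holdsAt_getD (l : List ℕ) : HoldsAt (fun i => l.getD i 0) 0 l := fun i hi => by
  simp [hi]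

theorem length_arenaCode {n : ℕ} (A : Arena (Fin n)) (es : List (Fin n × Fin n)) :
    (arenaCode A es).length = n + 2 * es.length := by
  simp [arenaCode, List.length_flatMap, mul_comm]

theorem HoldsAt.edges {n : ℕ} {a : ℕ → ℕ} {b : ℕ} {es : List (Fin n × Fin n)}
    (h : HoldsAt a b (es.flatMap fun e => [(e.1 : ℕ), (e.2 : ℕ)])) (k : ℕ) (hk : k < es.length) :
    a (b + 2 * k) = (es[k]).1 ∧ a (b + 2 * k + 1) = (es[k]).2 := by
  induction es generalizing b k with
  | nil => simp at hk
  | cons e es ih =>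
    rw [List.flatMap_cons, List.cons_append, List.cons_append, List.nil_append, holdsAt_cons,
      holdsAt_cons] at h
    rcases k with _ | k
    · exact ⟨h.1, h.2.1⟩
    · have := ih h.2.2 k (by simpa using hk)
      rw [show b + 2 * (k + 1) = b + 1 + 1 + 2 * k by ring]
      simpa using this

theorem HoldsAt.holdsArena {n : ℕ} {A : Arena (Fin n)} {es : List (Fin n × Fin n)} {s : St}
    (h : HoldsAt (s.arr .inp) 0 (arenaCode A es)) : HoldsArena A es s := by
  obtain ⟨h1, h2⟩ := holdsAt_append.1 h
  rw [List.length_ofFn, zero_add] at h2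
  refine ⟨fun v => ?_, fun k hk => (h2.edges k hk).1, fun k hk => (h2.edges k hk).2⟩
  have := h1 v (by simp)
  simpa using this

namespace KLGame

variable {n : ℕ} {G : KLGame (Fin n)} {es : List (Fin n × Fin n)}
  {ps : List (Fin n × List (Fin n))}

theorem PairsListedBy.length (h : G.PairsListedBy ps) : ps.length = G.pairs.length :=
  (List.Forall₂.length_eq h).symm

theorem PairsListedBy.exists_iff (h : G.PairsListedBy ps) (P : Fin n → Finset (Fin n) → Prop) :
    (∃ p ∈ ps, P p.1 p.2.toFinset) ↔ ∃ p ∈ G.pairs, P p.1 p.2 := by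
  unfold PairsListedBy at h
  generalize G.pairs = l at h ⊢
  induction h with
  | nil => simp
  | @cons p q _ _ hpq _ ih =>
    simp only [List.mem_cons, exists_eq_or_imp, ih]
    have : q.2.toFinset = p.2 := by
      rw [← List.toFinset_coe, hpq.2, Finset.val_toFinset]
    rw [hpq.1, this]

theorem PairsListedBy.length_le (h : G.PairsListedBy ps) : ∀ p ∈ ps, p.2.length ≤ n := by
  unfold PairsListedBy at h
  generalize G.pairs = l at h
  induction h with
  | nil => simp
  | @cons p q _ _ hpq _ ih =>
    refine List.forall_mem_cons.2 ⟨?_, ih⟩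
    rw [← Multiset.coe_card, hpq.2]
    exact (Finset.card_le_univ p.2).trans_eq (Fintype.card_fin n)

theorem PairsListedBy.length_pairsCode (h : G.PairsListedBy ps) :
    (pairsCode ps).length = G.pairs.length + (G.pairs.map fun p => 1 + p.2.card).sum := by
  unfold PairsListedBy at h
  generalize G.pairs = l at h ⊢
  induction h with
  | nil => rfl
  | @cons p q _ _ hpq _ ih =>
    rw [length_pairsCode_cons, ih, ← Multiset.coe_card, hpq.2, List.length_cons, List.map_cons,
      List.sum_cons, Finset.card_val]
    omega

theorem pairs_length_le (G : KLGame (Fin n)) :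
    G.pairs.length ≤ (G.pairs.map fun p => 1 + p.2.card).sum := by
  induction G.pairs with
  | nil => simp
  | cons p l ih => simp only [List.length_cons, List.map_cons, List.sum_cons]; omega

theorem sum_pairs_le (G : KLGame (Fin n)) :
    (G.pairs.map fun p => 1 + p.2.card).sum ≤ G.pairs.length * (1 + n) := by
  induction G.pairs with
  | nil => simp
  | cons p l ih =>
    have := (Finset.card_le_univ p.2).trans_eq (Fintype.card_fin n)
    simp only [List.length_cons, List.map_cons, List.sum_cons, add_mul]
    omega

/-- An edge joins positions of different owners, hence two positions. For `n = 1` the bound `2 ^ (c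
* n)` on registers would be too small for the addresses. -/
theorem two_le (G : KLGame (Fin n)) (hn : 0 < n) : 2 ≤ n := by
  obtain ⟨w, hw⟩ := G.arena.total ⟨0, hn⟩
  have h1 := G.arena.bipartite _ hw
  by_contra h
  have : Subsingleton (Fin n) := Fin.subsingleton_iff_le_one.2 (by omega)
  exact h1 (congrArg _ (Subsingleton.elim _ _))

theorem card_edges_le (G : KLGame (Fin n)) : G.arena.edges.card ≤ n ^ 2 := by
  refine (Finset.card_le_univ _).trans_eq ?_
  rw [Fintype.card_prod, Fintype.card_fin, sq]

/-- Addresses fit into registers of `O(n)` bits because the index `t` is at most `2^n n`. -/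
theorem size_add_le (G : KLGame (Fin n)) (hn : 0 < n) : G.size + 2 ^ n ≤ 2 ^ (3 * n + 3) := by
  have h1 := G.card_edges_le
  have h2 := G.sum_pairs_le
  have h3 := G.index_le
  have h4 : n ≤ 2 ^ n := Nat.lt_two_pow_self.le
  have h5 : 1 ≤ 2 ^ n := Nat.one_le_two_pow
  have h6 := G.two_le hn
  rw [Fintype.card_fin] at h3
  rw [size, Fintype.card_fin, show 2 ^ (3 * n + 3) = 8 * (2 ^ n) ^ 3 by ring]
  set N := 2 ^ n
  have h7 : G.pairs.length * (1 + n) ≤ N * N * (2 * N) := Nat.mul_le_mul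
    (h3.trans (Nat.mul_le_mul_left N h4)) (by omega)
  have h8 : n ^ 2 ≤ N ^ 2 := Nat.pow_le_pow_left h4 2
  have h9 : N ^ 2 ≤ N ^ 3 := Nat.pow_le_pow_right h5 (by norm_num)
  have h10 : N ≤ N ^ 3 := Nat.le_self_pow (by norm_num) N
  have h11 : N * N * (2 * N) = 2 * N ^ 3 := by ring
  omega

end KLGame

/-! ### The arrays in memory -/

section

variable {n c : ℕ} {G : KLGame (Fin n)} {es : List (Fin n × Fin n)}
  {ps : List (Fin n × List (Fin n))}

def arrLen (n e len : ℕ) : Arr → ℕ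
  | .inp => len
  | .start => n + 1
  | .src => e
  | .inX | .inB | .rest | .deg | .queue | .mark => n
  | .cond => 2 ^ n
  | .table => 2 * 2 ^ n

/-- The working arrays follow the input without gaps. The input stays at address `0`, where the
listing of the arena and the solution are expected at the end. -/
def arrBase (n e len : ℕ) : Arr → ℕ
  | .inp => 0
  | .start => len
  | .src => len + n + 1
  | .inX => len + n + 1 + e
  | .inB => len + n + 1 + e + n
  | .rest => len + n + 1 + e + n + n
  | .deg => len + n + 1 + e + n + n + n
  | .queue => len + n + 1 + e + n + n + n + n
  | .mark => len + n + 1 + e + n + n + n + n + n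
  | .cond => len + n + 1 + e + n + n + n + n + n + n
  | .table => len + n + 1 + e + n + n + n + n + n + n + 2 ^ n

/-- An edge takes two cells, and a pair takes one more than `|G|` counts, for the cardinality. The
listing thus has at most `2 |G|` cells, and `16` leaves ample room for the working arrays. -/
theorem length_add_le (hes : G.arena.ListedBy es) (hps : G.PairsListedBy ps) (hc : 16 ≤ c) :
    (arenaCode G.arena es ++ pairsCode ps).length + (n + 1 + es.length + 6 * n + 3 * 2 ^ n) + 2 ≤
      (G.limits c).space := by
  have h1 := G.pairs_length_le
  have h2 := hes.length
  have h3 : 1 ≤ 2 ^ n := Nat.one_le_two_pow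
  have h4 : 16 * (G.size + 2 ^ n) ≤ c * (G.size + 2 ^ n) := Nat.mul_le_mul_right _ hc
  rw [List.length_append, length_arenaCode, hps.length_pairsCode]
  refine le_trans ?_ h4
  rw [KLGame.size, Fintype.card_fin]
  omega

theorem space_le_regMax (hn : 0 < n) (hc : 16 ≤ c) :
    (G.limits c).space ≤ (G.limits c).regMax := by
  have h1 := G.size_add_le hn
  have h2 := G.two_le hn
  calc c * (G.size + 2 ^ n) ≤ 2 ^ c * 2 ^ (3 * n + 3) := Nat.mul_le_mul Nat.lt_two_pow_self.le h1
    _ = 2 ^ (c + (3 * n + 3)) := (pow_add ..).symm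
    _ ≤ 2 ^ (c * n) := Nat.pow_le_pow_right two_pos (by nlinarith)

theorem cellMax_le_regMax : (G.limits c).cellMax ≤ (G.limits c).regMax :=
  calc n ^ c ≤ (2 ^ n) ^ c := Nat.pow_le_pow_left Nat.lt_two_pow_self.le c
    _ = 2 ^ (c * n) := by rw [← pow_mul, mul_comm]

theorem sq_le_cellMax (hn : 0 < n) (hc : 16 ≤ c) : n ^ 2 ≤ (G.limits c).cellMax :=
  Nat.pow_le_pow_right hn (by omega)

/-- The arrays in memory during the computation. -/
def workLayout (hes : G.arena.ListedBy es) (hps : G.PairsListedBy ps) (hc : 16 ≤ c) :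
    Layout Arr (G.limits c) where
  base := arrBase n es.length (arenaCode G.arena es ++ pairsCode ps).length
  len := arrLen n es.length (arenaCode G.arena es ++ pairsCode ps).length
  base_add_len_le k := by
    have := length_add_le hes hps hc
    cases k <;> simp only [arrBase, arrLen] <;> omega
  disjoint k l h := by
    have := Nat.zero_le (2 ^ n)
    cases k <;> cases l <;> first | exact absurd rfl h | (simp only [arrBase, arrLen]; omega)

theorem fits_workLayout (hn : 0 < n) (hes : G.arena.ListedBy es) (hps : G.PairsListedBy ps)
    (hc : 16 ≤ c) : Fits (workLayout hes hps hc).bounds n es.length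
      (arenaCode G.arena es ++ pairsCode ps).length := by
  have h1 := length_add_le hes hps hc
  have h2 := space_le_regMax (G := G) hn hc
  have h3 := sq_le_cellMax (G := G) hn hc
  have h4 := G.two_le hn
  have h5 := G.card_edges_le
  have h6 : n ≤ n ^ 2 := Nat.le_self_pow (by norm_num) n
  refine ⟨hn, hes.card_le_length, h6.trans h3, (hes.length.le.trans h5).trans h3,
    cellMax_le_regMax (G := G), ?_, by change _ ≤ (G.limits c).regMax; omega, rfl, rfl, rfl, rfl, rfl, rfl,
    rfl, rfl, rfl, rfl, rfl⟩
  calc 4 * 2 ^ n = 2 ^ (n + 2) := by ring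
    _ ≤ 2 ^ (c * n) := Nat.pow_le_pow_right two_pos (by nlinarith)

end

/-! ### Initialization -/

/-- The registers of the machine, and those for the base addresses of the arrays. -/
abbrev MReg := Reg ⊕ Arr

/-- `n`, `e`, `t` are the first constructors of `Reg`, so they are the registers `0`, `1`, `2` that
hold the input. Registers from `40` to `50` are for base addresses. -/
def workMap : RegMap Reg Arr where
  reg := Reg.ctorIdx
  base k := 40 + k.ctorIdx
  aux := 51
  reg_injective r r' h := by rw [← Reg.ofNat_ctorIdx r, h, Reg.ofNat_ctorIdx]
  reg_ne_base r k := by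
    have : r.ctorIdx < 40 := by cases r <;> decide
    omega
  reg_ne_aux r := by
    have : r.ctorIdx < 40 := by cases r <;> decide
    omega
  base_ne_aux k := by
    have : k.ctorIdx < 11 := by cases k <;> decide
    omega

/-- During initialization, the whole memory is one array, and the base addresses are computed in
registers. -/
def initMap : RegMap MReg Unit where
  reg := Sum.elim workMap.reg workMap.base
  -- Register `51` is `0` at the start, which is the base address of the whole memory. Later it is
  -- the auxiliary register of `workMap`.
  base _ := 51
  aux := 52
  reg_injective := by
    refine workMap.reg_injective.sumElim (fun k k' h => ?_) workMap.reg_ne_base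
    have h' : k.ctorIdx = k'.ctorIdx := Nat.add_left_cancel h
    rw [← Arr.ofNat_ctorIdx k, h', Arr.ofNat_ctorIdx]
  reg_ne_base r _ := by
    rcases r with r | k
    · exact workMap.reg_ne_aux r
    · exact workMap.base_ne_aux k
  reg_ne_aux r := by
    rcases r with r | k
    · have : r.ctorIdx < 40 := by cases r <;> decide
      simp only [workMap, Sum.elim_inl]
      omega
    · have : k.ctorIdx < 11 := by cases k <;> decide
      simp only [workMap, Sum.elim_inr]
      omega
  base_ne_aux _ := by decide

/-- Finds the winning pairs and their end, and computes `2^n`. -/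
def findProg : Cmd MReg Unit :=
  .const (.inl .one) 1 ;; .add (.inl .ps) (.inl .n) (.inl .e) ;;
  .add (.inl .ps) (.inl .ps) (.inl .e) ;; .add (.inl .fin) (.inl .ps) (.inl .zero) ;;
  .forUp (.inl .one) (.inl .q) (.inl .t) (.inl .tq)
    (.add (.inl .z) (.inl .fin) (.inl .one) ;; .get (.inl .l) () (.inl .z) ;;
      .add (.inl .fin) (.inl .z) (.inl .one) ;; .add (.inl .fin) (.inl .fin) (.inl .l)) ;;
  .const (.inl .N) 1 ;;
  .forUp (.inl .one) (.inl .i) (.inl .n) (.inl .ti) (.add (.inl .N) (.inl .N) (.inl .N))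

/-- Computes the base addresses. -/
def basesProg : Cmd MReg Unit :=
  .add (.inr .start) (.inl .fin) (.inl .zero) ;;
  .add (.inr .src) (.inr .start) (.inl .n) ;; .add (.inr .src) (.inr .src) (.inl .one) ;;
  .add (.inr .inX) (.inr .src) (.inl .e) ;; .add (.inr .inB) (.inr .inX) (.inl .n) ;;
  .add (.inr .rest) (.inr .inB) (.inl .n) ;; .add (.inr .deg) (.inr .rest) (.inl .n) ;;
  .add (.inr .queue) (.inr .deg) (.inl .n) ;; .add (.inr .mark) (.inr .queue) (.inl .n) ;;
  .add (.inr .cond) (.inr .mark) (.inl .n) ;; .add (.inr .table) (.inr .cond) (.inl .N)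

section

variable {n e t c : ℕ} {B : Bounds Unit} {s : HState MReg Unit} {ps : List (Fin n × List (Fin n))}

theorem wp_findProg (hn : s.reg (.inl .n) = n) (he : s.reg (.inl .e) = e)
    (ht : s.reg (.inl .t) = t) (hz : s.reg (.inl .zero) = 0) (hps : ps.length = t)
    (hp : HoldsAt (s.arr ()) (n + 2 * e) (pairsCode ps))
    (hlen : n + 2 * e + (pairsCode ps).length + n + 2 ≤ B.regMax) (htB : t ≤ B.regMax)
    (hlen' : n + 2 * e + (pairsCode ps).length ≤ B.len ()) (hN : 2 * 2 ^ n ≤ B.regMax) :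
    wp B findProg (fun s' => s'.time ≤ s.time + (8 * t + 4 * n + 11) ∧ s'.reg (.inl .one) = 1 ∧
      s'.reg (.inl .N) = 2 ^ n ∧ s'.reg (.inl .ps) = n + 2 * e ∧
      s'.reg (.inl .fin) = n + 2 * e + (pairsCode ps).length) s := by
  simp only [findProg, wp_seq, wp_const, wp_add, HState.tick_reg, HState.setReg_reg, reduceCtorEq,
    if_false, if_true, Sum.inl.injEq, hn, he, hz]
  refine ⟨by omega, by omega, by omega, by omega, ?_⟩
  set s₁ := ((((((((s.setReg (.inl .one) 1).tick 1).setReg (.inl .ps) (n + e)).tick 1).setReg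
    (.inl .ps) (n + e + e)).tick 1).setReg (.inl .fin) (n + e + e + 0)).tick 1) with hs₁
  have ht₁ : s₁.reg (.inl .t) = t := by simp [hs₁, ht]
  have ho₁ : s₁.reg (.inl .one) = 1 := by simp [hs₁]
  have hp₁ : s₁.reg (.inl .ps) = n + 2 * e := by simp [hs₁]; omega
  have hn₁ : s₁.reg (.inl .n) = n := by simp [hs₁, hn]
  refine wp_forUp_time (fun k s' => HoldsAt (s'.arr ()) (s'.reg (.inl .fin)) (pairsCode (ps.drop k)) ∧
    s'.reg (.inl .fin) + (pairsCode (ps.drop k)).length = n + 2 * e + (pairsCode ps).length) 8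
    (by decide) rfl ho₁ (by omega) ?_ ?_ ?_
  · intro x
    have : s₁.reg (.inl .fin) = n + 2 * e := by simp [hs₁]; omega
    simp only [HState.tick_reg, HState.setReg_reg, reduceCtorEq, if_false, Sum.inl.injEq, this,
      HState.tick_arr, HState.setReg_arr, List.drop_zero, and_true]
    exact hp
  · rintro k hk s₂ hs₂ hi ⟨hp₂, hl₂⟩
    rw [ht₁] at hk
    have hkp : k < ps.length := by omega
    have ho₂ : s₂.reg (.inl .one) = 1 := (hs₂.1 _ rfl).trans ho₁
    rw [List.drop_eq_getElem_cons hkp, length_pairsCode_cons] at hl₂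
    rw [List.drop_eq_getElem_cons hkp, pairsCode_cons, holdsAt_cons, holdsAt_cons,
      holdsAt_append, List.length_map] at hp₂
    obtain ⟨-, hl, -, hrest⟩ := hp₂
    simp only [wp_seq, wp_add, wp_get, HState.tick_reg, HState.setReg_reg, reduceCtorEq,
      if_false, if_true, Sum.inl.injEq, HState.tick_arr, HState.setReg_arr, HState.tick_time,
      HState.setReg_time, ho₂, hl]
    refine ⟨by omega, by omega, by omega, by omega, by omega, fun x y => ⟨hrest, by omega⟩⟩
  rintro s₂ hs₂ ht₂ ⟨-, hf₂⟩
  rw [ht₁] at ht₂ hf₂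
  have ho₂ : s₂.reg (.inl .one) = 1 := (hs₂.1 _ rfl).trans ho₁
  have hn₂ : s₂.reg (.inl .n) = n := (hs₂.1 _ rfl).trans hn₁
  have hp₂ : s₂.reg (.inl .ps) = n + 2 * e := (hs₂.1 _ rfl).trans hp₁
  have htime : s₁.time = s.time + 4 := rfl
  rw [List.drop_of_length_le hps.le] at hf₂
  rw [wp_seq, wp_const]
  refine ⟨by omega, ?_⟩
  refine wp_forUp_time (fun k (s' : HState MReg Unit) => s'.reg (.inl .N) = 2 ^ k) 4 (by decide) rfl (by simp [ho₂]) ?_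
    (fun x => by simp) ?_ ?_
  · simp only [HState.tick_reg, HState.setReg_reg, reduceCtorEq, if_false, Sum.inl.injEq, hn₂]
    omega
  · intro k hk s₃ hs₃ hi hN₃
    simp only [HState.tick_reg, HState.setReg_reg, reduceCtorEq, if_false, Sum.inl.injEq, hn₂] at hk
    have hpow : 2 ^ k * 2 ≤ 2 ^ n := by
      rw [← pow_succ]
      exact Nat.pow_le_pow_right two_pos hk
    simp only [wp_add, HState.tick_reg, HState.setReg_reg, reduceCtorEq, if_false, if_true,
      Sum.inl.injEq, HState.tick_time, HState.setReg_time, hN₃]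
    exact ⟨by omega, by omega, fun x y => by rw [pow_succ]; omega⟩
  · rintro s₃ hs₃ ht₃ hN₃
    simp only [HState.tick_reg, HState.setReg_reg, reduceCtorEq, if_false, Sum.inl.injEq, hn₂,
      HState.tick_time, HState.setReg_time] at ht₃ hN₃
    refine ⟨by omega, ?_, hN₃, ?_, ?_⟩
    · rw [hs₃.1 _ rfl]; simp [ho₂]
    · rw [hs₃.1 _ rfl]; simp [hp₂]
    · rw [hs₃.1 _ rfl]; simpa [pairsCode] using hf₂

theorem wp_basesProg {len : ℕ} (hn : s.reg (.inl .n) = n) (he : s.reg (.inl .e) = e)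
    (ho : s.reg (.inl .one) = 1) (hz : s.reg (.inl .zero) = 0) (hN : s.reg (.inl .N) = 2 ^ n)
    (hf : s.reg (.inl .fin) = len) (hi : s.reg (.inr .inp) = 0)
    (hle : len + (n + 1 + e + 6 * n + 3 * 2 ^ n) ≤ B.regMax) :
    wp B basesProg (fun s' => s'.time = s.time + 11 ∧
      ∀ k, s'.reg (.inr k) = arrBase n e len k) s := by
  simp only [basesProg, wp_seq, wp_add, HState.tick_reg, HState.setReg_reg, reduceCtorEq,
    if_false, if_true, Sum.inr.injEq, hn, he, ho, hz, hN, hf, HState.tick_time,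
    HState.setReg_time, add_zero]
  refine ⟨by omega, by omega, by omega, by omega, by omega, by omega, by omega, by omega, by omega,
    by omega, by omega, trivial, fun k => ?_⟩
  cases k <;> simp [arrBase, hi]

end

section

variable {n c : ℕ} {G : KLGame (Fin n)} {es : List (Fin n × Fin n)}
  {ps : List (Fin n × List (Fin n))}

theorem le_of_mem_code (hn : 0 < n) (hps : G.PairsListedBy ps) {x : ℕ}
    (hx : x ∈ arenaCode G.arena es ++ pairsCode ps) : x ≤ n := by
  have h2 := G.two_le hn
  simp only [arenaCode, pairsCode, List.mem_append, List.mem_flatMap, List.mem_ofFn',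
    Set.mem_range] at hx
  rcases hx with (⟨v, rfl⟩ | ⟨e, -, hx⟩) | ⟨p, hp, hx⟩
  · omega
  · simp only [List.mem_cons, List.not_mem_nil, or_false] at hx
    omega
  · have := hps.length_le p hp
    simp at hx
    rcases hx with rfl | rfl | ⟨v, -, rfl⟩ <;> omega

def initProg : Prog := (findProg ;; basesProg).compile initMap

def initLayout (L : Limits) : Layout Unit L := ⟨fun _ => 0, fun _ => L.space, fun _ => by simp,
  fun _ _ h => absurd rfl h⟩

/-- The state after initialization. -/
theorem exists_exec_initProg (hn : 0 < n) (hes : G.arena.ListedBy es) (hps : G.PairsListedBy ps)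
    (hc : 16 ≤ c) : ∃ m s t, Exec (G.limits c) initProg (G.input es ps) m t ∧
      t ≤ 8 * G.pairs.length + 4 * n + 22 ∧ Represents workMap (workLayout hes hps hc) s m ∧
      Consts n es.length G.pairs.length s ∧ s.reg .ps = n + 2 * es.length ∧
      (s.arr .inp = fun i => (arenaCode G.arena es ++ pairsCode ps).getD i 0) ∧
      ∀ k ≠ .inp, s.arr k = fun _ => 0 := by
  set code := arenaCode G.arena es ++ pairsCode ps with hcode
  have hlen := length_add_le hes hps hc
  have hreg := space_le_regMax (G := G) hn hc
  have hcell := cellMax_le_regMax (G := G) (c := c)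
  have hfits := fits_workLayout hn hes hps hc
  have hlencode : code.length = n + 2 * es.length + (pairsCode ps).length := by
    rw [hcode, List.length_append, length_arenaCode]
  have htpos : G.pairs.length ≤ (pairsCode ps).length := by
    rw [hps.length_pairsCode]; omega
  have hle : ∀ i, code.getD i 0 ≤ (G.limits c).regMax := fun i => by
    rw [List.getD_eq_getElem?_getD]
    rcases lt_or_ge i code.length with hi | hi
    · rw [List.getElem?_eq_getElem hi]
      exact (le_of_mem_code hn hps (List.getElem_mem hi)).trans (hfits.n_le.trans hfits.cell_le)
    · simp [List.getElem?_eq_none hi]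
  rw [← hcode] at hlen
  set s₀ : HState MReg Unit :=
    ⟨fun r => (G.input es ps).reg (initMap.reg r), fun _ i => code.getD i 0, 0⟩ with hs₀
  have hrep : Represents initMap (initLayout (G.limits c)) s₀ (G.input es ps) :=
    ⟨fun _ => rfl, fun _ => rfl, fun _ i _ => by rw [initLayout, zero_add]; rfl, fun _ i _ => hle i⟩
  have hn₀ : s₀.reg (.inl .n) = n := rfl
  have he₀ : s₀.reg (.inl .e) = es.length := hes.length.symm
  have ht₀ : s₀.reg (.inl .t) = G.pairs.length := rfl
  have hz₀ : s₀.reg (.inl .zero) = 0 := rfl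
  have hi₀ : s₀.reg (.inr .inp) = 0 := rfl
  have hpairs : HoldsAt (s₀.arr ()) (n + 2 * es.length) (pairsCode ps) := by
    have := (holdsAt_append.1 (holdsAt_getD code)).2
    rwa [length_arenaCode, zero_add] at this
  have hN : 1 ≤ 2 ^ n := Nat.one_le_two_pow
  have hwp : wp (initLayout (G.limits c)).bounds (findProg ;; basesProg) (fun s' =>
      s'.time ≤ 8 * G.pairs.length + 4 * n + 22 ∧ s'.reg (.inl .one) = 1 ∧
      s'.reg (.inl .N) = 2 ^ n ∧ s'.reg (.inl .ps) = n + 2 * es.length ∧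
      ∀ k, s'.reg (.inr k) = arrBase n es.length code.length k) s₀ := by
    rw [wp_seq]
    refine (wp_findProg hn₀ he₀ ht₀ hz₀ hps.length hpairs ?_ ?_ ?_ ?_).mono ?_
    · change _ ≤ (G.limits c).regMax
      omega
    · change _ ≤ (G.limits c).regMax
      omega
    · change _ ≤ (G.limits c).space
      omega
    · change _ ≤ (G.limits c).regMax
      omega
    rintro s₁ hs₁ ⟨ht₁, ho₁, hN₁, hp₁, hf₁⟩
    refine (wp_basesProg ((hs₁.1 _ rfl).trans hn₀) ((hs₁.1 _ rfl).trans he₀) ho₁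
      ((hs₁.1 _ rfl).trans hz₀) hN₁ (hf₁.trans hlencode.symm) ((hs₁.1 _ rfl).trans hi₀) ?_).mono ?_
    · change _ ≤ (G.limits c).regMax
      omega
    rintro s₂ hs₂ ⟨ht₂, hb₂⟩
    have e : s₀.time = 0 := rfl
    refine ⟨by omega, (hs₂.1 _ rfl).trans ho₁, (hs₂.1 _ rfl).trans hN₁, (hs₂.1 _ rfl).trans hp₁,
      hb₂⟩
  obtain ⟨s₁, hrun, ht₁, ho₁, hN₁, hp₁, hb₁⟩ := hwp
  obtain ⟨m, t, hexec, ht, hm⟩ := hrun.compile hreg hcell hrep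
  have hsame := hrun.same
  refine ⟨m, ⟨fun r => m.reg (workMap.reg r),
    fun k i => if k = .inp then code.getD i 0 else 0, 0⟩, t, hexec, ?_, ⟨fun _ => rfl, ?_, ?_, ?_⟩,
    ⟨?_, ?_, ?_, ?_, ?_, ?_⟩, ?_, ?_, ?_⟩
  · have e : s₀.time = 0 := rfl
    omega
  · exact fun k => (hm.reg (.inr k)).trans (hb₁ k)
  -- Initialization stores nothing, so the memory still holds the listing followed by zeros; all
  -- arrays but `inp` lie beyond the listing.
  · intro k i hi
    have hsp := (workLayout hes hps hc).base_add_len_le k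
    have := hm.arr () ((workLayout hes hps hc).base k + i) (by
      change _ < (G.limits c).space
      omega)
    rw [hsame.2 _ rfl] at this
    change m.mem (0 + ((workLayout hes hps hc).base k + i)) = code.getD _ 0 at this
    rw [zero_add] at this
    rw [this]
    dsimp only
    by_cases hk : k = .inp
    · subst hk
      rw [if_pos rfl]
      change code.getD (0 + i) 0 = _
      rw [zero_add]
    · rw [if_neg hk]
      refine List.getD_eq_default _ _ ?_
      change code.length ≤ arrBase n es.length code.length k + i
      cases k <;> first | exact absurd rfl hk | (simp only [arrBase]; omega)
  · intro k i _
    dsimp only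
    split_ifs
    · exact hle i
    · exact Nat.zero_le _
  · exact (hm.reg (.inl .n)).trans ((hsame.1 _ rfl).trans hn₀)
  · exact (hm.reg (.inl .e)).trans ((hsame.1 _ rfl).trans he₀)
  · exact (hm.reg (.inl .t)).trans ((hsame.1 _ rfl).trans ht₀)
  · exact (hm.reg (.inl .one)).trans ho₁
  · exact (hm.reg (.inl .zero)).trans ((hsame.1 _ rfl).trans hz₀)
  · exact (hm.reg (.inl .N)).trans hN₁
  · exact (hm.reg (.inl .ps)).trans hp₁
  · rfl
  · intro k hk
    simp [hk]

end

/-! ### The programs -/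

section

variable {n c : ℕ} {G : KLGame (Fin n)} {es : List (Fin n × Fin n)}
  {ps : List (Fin n × List (Fin n))}

namespace KLGame

/-- Player `σ` wins the plays with infinity set `X`. -/
def PlayerCond (G : KLGame (Fin n)) (σ : Fin 2) (X : Finset (Fin n)) : Prop := X ∈ G.toMuller.F σ

theorem toMuller_wins_iff (G : KLGame (Fin n)) (σ : Fin 2) (ρ : ℕ → Fin n) :
    G.toMuller.Wins σ ρ ↔ G.Wins σ ρ := by
  match σ with
  | 0 => exact Iff.rfl
  | 1 => exact Iff.rfl

theorem complementary_playerCond (G : KLGame (Fin n)) : Arena.Complementary G.PlayerCond := by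
  intro σ τ h X
  match σ, τ with
  | 0, 0 => exact absurd rfl h
  | 0, 1 => exact not_not.symm
  | 1, 0 => exact Iff.rfl
  | 1, 1 => exact absurd rfl h

theorem winsFrom_iff (G : KLGame (Fin n)) (σ : Fin 2) (v : Fin n) :
    G.WinsFrom σ v ↔ G.arena.WinsOn G.PlayerCond σ Finset.univ {v} := by
  rw [WinsFrom, Arena.canForce_iff]
  exact iff_of_eq (congrArg _ (funext fun ρ => propext (G.toMuller_wins_iff σ ρ).symm))

end KLGame

/-- Decides a KL game. -/
def solveProg : Cd := condProg ;; predsProg ;; tableProg ;; regionProg ;; outputProg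

theorem wp_condProg_input (hn : 0 < n) (hes : G.arena.ListedBy es) (hps : G.PairsListedBy ps)
    (hc : 16 ≤ c) {s : St} (hs : Consts n es.length G.pairs.length s)
    (hps₀ : s.reg .ps = n + 2 * es.length)
    (hinp : s.arr .inp = fun i => (arenaCode G.arena es ++ pairsCode ps).getD i 0) :
    wp (workLayout hes hps hc).bounds condProg
      (fun s' => s'.time ≤ s.time + 130 * (2 ^ n * n ^ 2) ∧ ∀ X : Finset (Fin n),
        s'.arr .cond (setCode X) < 2 ∧
          ∀ σ : Fin 2, X ∈ G.toMuller.F σ ↔ s'.arr .cond (setCode X) = σ) s := by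
  have hB := fits_workLayout hn hes hps hc
  have hlen := hB.len_le
  have hidx := G.index_le
  rw [Fintype.card_fin] at hidx
  have hpairs := (holdsAt_append.1 (holdsAt_getD (arenaCode G.arena es ++ pairsCode ps))).2
  rw [length_arenaCode, zero_add] at hpairs
  have htpos : G.pairs.length ≤ (pairsCode ps).length := by
    rw [hps.length_pairsCode]; omega
  have hlencode : (arenaCode G.arena es ++ pairsCode ps).length =
      n + 2 * es.length + (pairsCode ps).length := by
    rw [List.length_append, length_arenaCode]
  refine (wp_condProg hB hs hps.length (by omega) hidx hps.length_le
    (by rw [hinp, hps₀]; exact hpairs) (by omega)).mono ?_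
  rintro s' - ⟨ht, hF⟩
  refine ⟨ht, fun X => ?_⟩
  have hiff : (∃ p ∈ ps, p.1 ∈ X ∧ X ⊆ p.2.toFinset) ↔ G.Cond X :=
    hps.exists_iff fun u S => u ∈ X ∧ X ⊆ S
  rw [hF]
  by_cases h : G.Cond X
  · rw [if_pos (hiff.2 h)]
    refine ⟨by norm_num, fun σ => ?_⟩
    match σ with
    | 0 => exact iff_of_true h rfl
    | 1 => exact iff_of_false (not_not.2 h) (by norm_num)
  · rw [if_neg (mt hiff.1 h)]
    refine ⟨by norm_num, fun σ => ?_⟩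
    match σ with
    | 0 => exact iff_of_false h (by norm_num)
    | 1 => exact iff_of_true h rfl

theorem wp_solveProg (hn : 0 < n) (hes : G.arena.ListedBy es) (hps : G.PairsListedBy ps)
    (hc : 16 ≤ c) {s : St} (hs : Consts n es.length G.pairs.length s)
    (hps₀ : s.reg .ps = n + 2 * es.length)
    (hinp : s.arr .inp = fun i => (arenaCode G.arena es ++ pairsCode ps).getD i 0)
    (h0 : ∀ k ≠ .inp, s.arr k = fun _ => 0) :
    wp (workLayout hes hps hc).bounds solveProg
      (fun s' => s'.time ≤ s.time + 650 * (2 ^ n * n * es.length) ∧ ∀ v : Fin n,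
        s'.arr .inp v < 2 ∧ ∀ σ : Fin 2, G.WinsFrom σ v ↔ s'.arr .inp v = σ) s := by
  have hB := fits_workLayout hn hes hps hc
  have hlencode : (arenaCode G.arena es ++ pairsCode ps).length =
      n + 2 * es.length + (pairsCode ps).length := by
    rw [List.length_append, length_arenaCode]
  set len := (arenaCode G.arena es ++ pairsCode ps).length with hlendef
  have hlen : n + 2 * es.length ≤ len := by omega
  have hA : HoldsArena G.arena es s := by
    refine HoldsAt.holdsArena ?_
    rw [hinp]
    exact (holdsAt_append.1 (holdsAt_getD _)).1
  have hempty : ∀ k ≠ .inp, IsBits (n := n) s k ∅ := fun k hk v => by rw [h0 k hk]; simp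
  have hC := G.complementary_playerCond
  rw [solveProg, wp_seq]
  refine (wp_condProg_input hn hes hps hc hs hps₀ hinp).mono ?_
  rintro s₁ hs₁ ⟨ht₁, hF₁⟩
  have hc₁ := hs.of_same hs₁ rfl
  have hA₁ := hA.of_eq (hs₁.2 _ rfl)
  have hC₁ : HoldsCond G.PlayerCond s₁ := fun X =>
    ⟨⟨_, (hF₁ X).1⟩, rfl, ((hF₁ X).2 ⟨_, (hF₁ X).1⟩).2 rfl⟩
  rw [wp_seq]
  refine (wp_predsProg hB hc₁ hA₁ rfl hlen).mono ?_
  rintro s₂ hs₂ ⟨ht₂, hP₂⟩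
  have hc₂ := hc₁.of_same hs₂ rfl
  have hA₂ := hA₁.of_eq (hs₂.2 _ rfl)
  have hC₂ : HoldsCond G.PlayerCond s₂ := fun X => by rw [hs₂.2 _ rfl]; exact hC₁ X
  have hB₂ : IsBits (n := n) s₂ .inB ∅ :=
    ((hempty .inB (by decide)).of_eq (hs₁.2 _ rfl)).of_eq (hs₂.2 _ rfl)
  have hm₂ : IsBits (n := n) s₂ .mark ∅ :=
    ((hempty .mark (by decide)).of_eq (hs₁.2 _ rfl)).of_eq (hs₂.2 _ rfl)
  rw [wp_seq]
  refine (wp_tableProg hB hc₂ hA₂ hes hP₂ rfl hlen hB₂ hC hC₂).mono ?_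
  rintro s₃ hs₃ ⟨ht₃, hT₃⟩
  have hc₃ := hc₂.of_same hs₃ rfl
  have hA₃ := hA₂.of_eq (hs₃.2 _ rfl)
  have hP₃ := hP₂.of_eq (hs₃.2 _ rfl) (hs₃.2 _ rfl)
  rw [wp_seq]
  refine (wp_regionProg hB hc₃ hA₃ hes hP₃ rfl hlen (hm₂.of_eq (hs₃.2 _ rfl)) hT₃).mono ?_
  rintro s₄ hs₄ ⟨ht₄, W, hW, hWY⟩
  refine (wp_outputProg hB (hc₃.of_same hs₄ rfl) hW (by omega)).mono ?_
  rintro s₅ hs₅ ⟨ht₅, hout⟩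
  constructor
  -- The Muller table costs `2^n n^2`, which is at most `2^n n |E|` because `n ≤ |E|`.
  · have e1 : n ≤ es.length := hes.card_le_length
    have e2 : 2 ^ n * n ^ 2 ≤ 2 ^ n * n * es.length := by
      rw [sq, ← mul_assoc]
      exact Nat.mul_le_mul_left _ e1
    have e3 : n * es.length ≤ 2 ^ n * n * es.length := by
      rw [mul_assoc]
      exact Nat.le_mul_of_pos_left _ (by positivity)
    have e4 : n ≤ n * es.length := Nat.le_mul_of_pos_right n (by omega)
    rw [← mul_assoc (2 ^ n)] at ht₃ ht₄
    omega
  · intro v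
    -- The marked set is the union of traps from `exists_trap_iff`, hence the winning region of
    -- Player `0`; the rest belongs to Player `1`.
    have key := Arena.exists_trap_iff hC (σ := 0) (τ := 1) (by decide)
      G.arena.subarena_univ (Finset.mem_univ v)
    rw [← hWY, ← G.winsFrom_iff, ← G.winsFrom_iff] at key
    obtain ⟨k0, k1⟩ := key
    rw [hout]
    by_cases hv : v ∈ W
    · rw [if_pos hv]
      refine ⟨by norm_num, fun σ => ?_⟩
      match σ with
      | 0 => exact iff_of_true (k0.2 hv) rfl
      | 1 => exact iff_of_false (fun h => k1.1 h (k0.2 hv)) (by norm_num)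
    · rw [if_neg hv]
      refine ⟨by norm_num, fun σ => ?_⟩
      match σ with
      | 0 => exact iff_of_false (mt k0.1 hv) (by norm_num)
      | 1 => exact iff_of_true (k1.2 (mt k0.1 hv)) rfl

def solver : Prog := .seq initProg (solveProg.compile workMap)

/-- Computes the Muller game of a KL game. -/
def transformer : Prog := .seq initProg (.seq (condProg.compile workMap)
  -- The address of the table is moved to register `0`, which is no longer needed for `n`.
  (.add 0 (workMap.base .cond) (workMap.reg .zero)))

theorem exists_exec_solve (hn : 0 < n) (hes : G.arena.ListedBy es) (hps : G.PairsListedBy ps)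
    (hc : 1000 ≤ c) : ∃ m t,
      Exec (G.limits c) solver (G.input es ps) m t ∧
      t ≤ c * (2 ^ n * n * G.arena.edges.card) ∧ G.SolutionHeldIn (G.limits c) m := by
  have hc' : 16 ≤ c := by omega
  obtain ⟨m, s, t, hexec, ht, hm, hs, hps₀, hinp, h0⟩ := exists_exec_initProg hn hes hps hc'
  obtain ⟨s', hrun, ht', hsol⟩ := wp_solveProg hn hes hps hc' hs hps₀ hinp h0
  obtain ⟨m', t', hexec', htt, hm'⟩ :=
    hrun.compile (space_le_regMax hn hc') cellMax_le_regMax hm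
  have hlen := length_add_le hes hps hc'
  rw [List.length_append, length_arenaCode] at hlen
  refine ⟨m', t + t', .seq hexec hexec', ?_, by omega, fun v => ?_⟩
  · have h1 := G.index_le
    have h2 : n ≤ G.arena.edges.card := hes.length ▸ hes.card_le_length
    -- With `t` and `n` bounded by `2^n n`, initialization takes at most `34` times the final bound
    -- and the main program at most `650` times, so `1000` suffices.
    have h3 : 2 ^ n * n ≤ 2 ^ n * n * G.arena.edges.card := Nat.le_mul_of_pos_right _ (by omega)
    have h4 : n ≤ 2 ^ n * n := Nat.le_mul_of_pos_left n (by positivity)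
    have h5 := Nat.mul_le_mul_right (2 ^ n * n * G.arena.edges.card) hc
    rw [Fintype.card_fin] at h1
    rw [hes.length] at ht'
    omega
  · have := hm'.arr .inp v ?_
    · change m'.mem (0 + v) = _ at this
      rw [zero_add] at this
      rw [this]
      exact hsol v
    · change (v : ℕ) < (arenaCode G.arena es ++ pairsCode ps).length
      rw [List.length_append, length_arenaCode]
      omega

theorem exists_exec_toMuller (hn : 0 < n) (hes : G.arena.ListedBy es) (hps : G.PairsListedBy ps)
    (hc : 1000 ≤ c) : ∃ m t,
      Exec (G.limits c) transformer (G.input es ps) m t ∧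
      t ≤ c * (2 ^ n * n ^ 2) ∧ G.toMuller.HeldIn es (G.limits c) m := by
  have hc' : 16 ≤ c := by omega
  obtain ⟨m, s, t, hexec, ht, hm, hs, hps₀, hinp, -⟩ := exists_exec_initProg hn hes hps hc'
  obtain ⟨s', hrun, ht', hF⟩ := wp_condProg_input hn hes hps hc' hs hps₀ hinp
  obtain ⟨m', t', hexec', htt, hm'⟩ :=
    hrun.compile (space_le_regMax hn hc') cellMax_le_regMax hm
  have hlen := length_add_le hes hps hc'
  have hcond := (workLayout hes hps hc').base_add_len_le .cond
  change (workLayout hes hps hc').base .cond + 2 ^ n ≤ _ at hcond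
  have hz : m'.reg (workMap.reg .zero) = 0 :=
    (hm'.reg .zero).trans ((hrun.same.1 _ rfl).trans hs.zero)
  have hb := hm'.base .cond
  have hreg := space_le_regMax (G := G) hn hc'
  have htable : ∀ X : Finset (Fin n),
      m'.mem ((workLayout hes hps hc').base .cond + setCode X) = s'.arr .cond (setCode X) :=
    fun X => hm'.arr .cond _ (setCode_lt X)
  refine ⟨_, t + (t' + 1), .seq hexec (.seq hexec' (.add (by rw [hb, hz]; omega))), ?_, ?_, ?_, ?_,
    ?_⟩
  · have h1 := G.index_le
    have h2 : 2 ^ n * n ≤ 2 ^ n * n ^ 2 := Nat.mul_le_mul_left _ (Nat.le_self_pow (by norm_num) n)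
    have h3 : n ≤ 2 ^ n * n := Nat.le_mul_of_pos_left n (by positivity)
    have h4 := Nat.mul_le_mul_right (2 ^ n * n ^ 2) hc
    rw [Fintype.card_fin] at h1
    omega
  · rw [List.length_append] at hlen
    change (arenaCode G.arena es).length ≤ _
    omega
  · simp only [hb, hz, Function.update_self, add_zero]
    exact hcond
  · intro i hi
    change i < (arenaCode G.arena es).length at hi
    have h1 : i < (arenaCode G.arena es ++ pairsCode ps).length := by
      rw [List.length_append]
      omega
    have h2 := hm'.arr .inp i h1
    change m'.mem (0 + i) = _ at h2
    rw [zero_add, hrun.same.2 _ rfl, hinp] at h2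
    refine h2.trans ?_
    dsimp only
    rw [List.getD_eq_getElem _ _ h1]
    exact List.getElem_append_left hi
  · simp only [hb, hz, Function.update_self, add_zero, htable]
    exact hF

end

/-- First part: one program decides all KL games on a nonempty set of `n` positions, in time
`O(2^n n |E|)` and with `O(|G| + 2^n)` memory cells of `O(log n)` bits (and finitely many registers
of `O(n)` bits). Second part: one program transforms all KL games into Muller games in which every
play has the same winner, in time `O(2^n n^2)` and with `O(|G| + 2^n)` memory cells. -/
theorem mainTheorem8 :
    (∃ (P : Prog) (c : ℕ), ∀ (n : ℕ) (_ : 0 < n) (G : KLGame (Fin n))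
      (es : List (Fin n × Fin n)) (ps : List (Fin n × List (Fin n))),
      G.arena.ListedBy es → G.PairsListedBy ps →
      ∃ (s : MState) (time : ℕ),
        Exec (G.limits c) P (G.input es ps) s time ∧
        time ≤ c * (2 ^ n * n * G.arena.edges.card) ∧
        G.SolutionHeldIn (G.limits c) s) ∧
    (∃ (P : Prog) (c : ℕ), ∀ (n : ℕ) (_ : 0 < n) (G : KLGame (Fin n))
      (es : List (Fin n × Fin n)) (ps : List (Fin n × List (Fin n))),
      G.arena.ListedBy es → G.PairsListedBy ps →
      ∃ (s : MState) (time : ℕ),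
        Exec (G.limits c) P (G.input es ps) s time ∧
        time ≤ c * (2 ^ n * n ^ 2) ∧
        G.toMuller.HeldIn es (G.limits c) s ∧
        ∀ (σ : Fin 2) (ρ : ℕ → Fin n), G.toMuller.Wins σ ρ ↔ G.Wins σ ρ) := by
  refine ⟨⟨solver, 1000, fun n hn G es ps hes hps => exists_exec_solve hn hes hps le_rfl⟩,
    ⟨transformer, 1000, fun n hn G es ps hes hps => ?_⟩⟩
  obtain ⟨m, t, h⟩ := exists_exec_toMuller hn hes hps le_rfl
  exact ⟨m, t, h.1, h.2.1, h.2.2, G.toMuller_wins_iff⟩
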